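/- **Conventions.** $\mathbb N=\{0,1,2,\dots\}$, $I=[0,1]$, and $Q=I^{\mathbb N}$ is the Hilbert cube. Maps are continuous. An ANR is a metrizable space that is a neighbourhood retract of every metrizable space containing it as a closed subset. $\operatorname{cov}(Y)$ is the set of open covers of $Y$. For spaces $D,Y$ the set $C(D,Y)$ of all maps carries the limitation topology: $O$ is open iff for each $f\in O$ there is $\mathcal U\in\operatorname{cov}(Y)$ such that $O$ contains every $g$ that is $\mathcal U$-close to $f$ (for each $x$ some $U\in\mathcal U$ contains both $f(x)$ and $g(x)$). For $B\subset Y$ let $S_Y(D,B)=\{g\in C(D,Y):\overline{g(D)}\subset B\}$. A set $E\subset C(D,Y)$ has *SMAP* (the small maps approximation property) if there is $\mathcal U\in\operatorname{cov}(Y)$ with $\bigcup_{B\in\mathcal U}S_Y(D,B)\subset\overline{E}$. A closed set $A\subset X$ is a *$Z$-set* in $X$ if $C(Q,X\setminus A)$ is dense in $C(Q,X)$; it is a *strong $Z$-set* in $X$ if for every $\mathcal U\in\operatorname{cov}(X)$ there is a map $u:X\to X$ that is $\mathcal U$-close to $\mathrm{id}_X$ with $A\cap\overline{u(X)}=\varnothing$.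 $X$ is *FDT* if every open cover of $X$ has an open refinement of finite order, and *locally FDT* [*locally separable*] if every point has a neighbourhood that is FDT [separable]; $\dim$ is covering dimension. $\operatorname{comp}(X)$ is the least infinite cardinal $\kappa$ such that every open cover of $X$ has a subcover of cardinality $<\kappa$, and $\operatorname{comp}_l(X)$ is the least infinite cardinal $\kappa$ such that every point of $X$ has a neighbourhood $F$ with $\operatorname{comp}(F)\le\kappa$. Cardinals $\alpha$, finite or infinite, are regarded as discrete spaces. For $\alpha>0$ and $n\ge1$, $J_n(\alpha)$ is the simplicial complex on an orthonormal basis $\mathcal E$ of a Hilbert space of dimension $\alpha$, with a fixed $e\in\mathcal E$, whose simplices are the nonempty finite $\sigma\subset\mathcal E$ with $\operatorname{card}(\sigma\cup\{e\})\le n+1$; $|J_n(\alpha)|_m$ and $|J_n(\alpha)|_w$ denote its geometric realization with the topology induced by the Hilbert space and with the weak topology, respectively. $X$ has *SDAP* if the maps $f$ for which $\{f(I^{n+1})\}_{n\in\mathbb N}$ is discrete in $X$ are dense in $C(\bigoplus_{n\in\mathbb N}I^{n+1},X)$. It has the *$\alpha$-discrete $m$-cells property* if the maps $f$ for which $\{f(I^m\times\{\beta\})\}_{\beta<\alpha}$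 is discrete in $X$ are dense in $C(I^m\times\alpha,X)$. It has *$\omega$-LFAP* if for every $\mathcal U\in\operatorname{cov}(X)$ there are maps $f_n:X\to X$ ($n\in\mathbb N$), each $\mathcal U$-close to $\mathrm{id}_X$, such that $\{f_n(X)\}_{n\in\mathbb N}$ is locally finite in $X$. (A family is discrete in $X$ if every point of $X$ has a neighbourhood meeting at most one member of the indexed family.) **Proposition.** Let $X$ be an ANR and $A$ a closed subset of $X$. * (Z1) If $X$ is locally compact, then every $Z$-set in $X$ is a strong $Z$-set. * (Z2) If $X$ is locally separable, then $A$ is a strong $Z$-set in $X$ iff $S_X(\bigoplus_{n\in\mathbb N}I^{n+1},X\setminus A)$ has SMAP, iff $S_X(Q\setminus\{\text{point}\},X\setminus A)$ has SMAP (whichever point is removed). * (Z3) If $X$ is locally FDT, then $A$ is a strong $Z$-set in $X$ iff $S_X(I^n\times\alpha,X\setminus A)$ has SMAP for each integer $n$ with $1\le n\le\max(1,\dim X)$ and each cardinal $\alpha<\operatorname{comp}_l(X)$. * (Z4) For each $\tau\in\{m,w\}$: $A$ is a strong $Z$-set in $X$ iff $S_X(\bigoplus_{n\in\mathbb N}|J_{n+1}(\alpha)|_\tau,X\setminus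 A)$ has SMAP for each cardinal $\alpha$ with $0<\alpha<\operatorname{comp}_l(X)$. * (Z5) If $A$ is a strong $Z$-set in $X$, then $U\cap A$ is a strong $Z$-set in $U$ for each open $U\subset X$. * (Z6) If every point of $A$ has an open neighbourhood $U$ in $X$ such that $A\cap U$ is a strong $Z$-set in $U$, then $A$ is a strong $Z$-set in $X$. * (Z7) If $X$ is locally separable and has SDAP, or if $X$ has $\omega$-LFAP and the $\alpha$-discrete $m$-cells property for each integer $m\ge1$ and each cardinal $\alpha<\operatorname{comp}_l(X)$, then every $Z$-set in $X$ is a strong $Z$-set. -/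

import Mathlib

open Set Filter Topology TopologicalSpace
open scoped Cardinal

universe u v w

noncomputable section

namespace StrongZ

/-! ### Covers, absolute neighbourhood retracts, cardinal and dimension invariants -/

/-- The collection `cov(X)` of all open covers of `X`. -/
def Cov (X : Type u) [TopologicalSpace X] : Set (Set (Set X)) :=
  {𝒰 | (∀ U ∈ 𝒰, IsOpen U) ∧ ⋃₀ 𝒰 = univ}

/-- `𝒱` refines `𝒰`. -/
def Refines {X : Type u} (𝒱 𝒰 : Set (Set X)) : Prop :=
  ∀ V ∈ 𝒱, ∃ U ∈ 𝒰, V ⊆ U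

/-- Every point lies in at most `k` members of `𝒱`. -/
def PointwiseAtMost {X : Type u} (𝒱 : Set (Set X)) (k : ℕ) : Prop :=
  ∀ x : X, {V | V ∈ 𝒱 ∧ x ∈ V}.encard ≤ k

/-- An ANR: a metrizable space which is a neighbourhood retract of every metrizable space
in which it is embedded as a closed subset. -/
def IsANR (X : Type u) [TopologicalSpace X] : Prop :=
  MetrizableSpace X ∧
    ∀ (M : Type u) [TopologicalSpace M] [MetrizableSpace M] (i : X → M), IsClosedEmbedding i →
      ∃ U : Set M, IsOpen U ∧ range i ⊆ U ∧
        ∃ r : C(U, X), ∀ (x : X) (hx : i x ∈ U), r ⟨i x, hx⟩ = x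

/-- Every point has a separable neighbourhood. -/
def LocallySeparable (X : Type u) [TopologicalSpace X] : Prop :=
  ∀ x : X, ∃ F ∈ 𝓝 x, SeparableSpace F

/-- Finite-dimensional type: every open cover (finite or not) has an open refinement
of finite order. -/
def IsFDT (X : Type u) [TopologicalSpace X] : Prop :=
  ∀ 𝒰 ∈ Cov X, ∃ 𝒱 ∈ Cov X, Refines 𝒱 𝒰 ∧ ∃ k : ℕ, PointwiseAtMost 𝒱 k

/-- Every point has a (not necessarily open) neighbourhood of finite-dimensional type. -/
def LocallyFDT (X : Type u) [TopologicalSpace X] : Prop :=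
  ∀ x : X, ∃ F ∈ 𝓝 x, IsFDT F

/-- `dim X ≤ n` for the covering dimension: every finite open cover has an open refinement
no point of which lies in more than `n + 1` members. -/
def CoveringDimLE (X : Type u) [TopologicalSpace X] (n : ℕ) : Prop :=
  ∀ 𝒰 ∈ Cov X, 𝒰.Finite → ∃ 𝒱 ∈ Cov X, Refines 𝒱 𝒰 ∧ PointwiseAtMost 𝒱 (n + 1)

open Classical in
/-- The covering dimension; the value `⊥` (that is, `-1`) is taken exactly by the empty space
and `⊤` by the infinite-dimensional spaces. -/
def coveringDim (X : Type u) [TopologicalSpace X] : WithBot ℕ∞ :=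
  if IsEmpty X then ⊥ else ((sInf {d : ℕ∞ | ∃ n : ℕ, d = n ∧ CoveringDimLE X n} : ℕ∞) : WithBot ℕ∞)

/-- `comp(X)`: the least infinite cardinal `κ` such that every open cover of `X` has a subcover
of cardinality less than `κ`. -/
def comp (X : Type u) [TopologicalSpace X] : Cardinal.{u} :=
  sInf {κ | ℵ₀ ≤ κ ∧ ∀ 𝒰 ∈ Cov X, ∃ 𝒱 ⊆ 𝒰, 𝒱 ∈ Cov X ∧ #𝒱 < κ}

/-- `comp_l(X)`: the least infinite cardinal `κ` such that every point of `X` has a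
(not necessarily open) neighbourhood `F` with `comp(F) ≤ κ`. -/
def compL (X : Type u) [TopologicalSpace X] : Cardinal.{u} :=
  sInf {κ | ℵ₀ ≤ κ ∧ ∀ x : X, ∃ F ∈ 𝓝 x, comp F ≤ κ}

/-! ### The limitation topology, small maps and SMAP -/

/-- `B(f, 𝒰)`: the maps which are `𝒰`-close to `f`. -/
def closeTo {X : Type u} {Y : Type v} [TopologicalSpace X] [TopologicalSpace Y]
    (f : C(X, Y)) (𝒰 : Set (Set Y)) : Set C(X, Y) :=
  {g | ∀ x : X, ∃ U ∈ 𝒰, f x ∈ U ∧ g x ∈ U}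

/-- The limitation topology on the set of all maps from `X` to `Y`: a set `O` is open iff
for each `f ∈ O` there is an open cover `𝒰` of `Y` with `B(f, 𝒰) ⊆ O`. -/
@[reducible] def limitationTopology (X : Type u) (Y : Type v) [TopologicalSpace X] [TopologicalSpace Y] :
    TopologicalSpace C(X, Y) where
  IsOpen O := ∀ f ∈ O, ∃ 𝒰 ∈ Cov Y, closeTo f 𝒰 ⊆ O
  isOpen_univ _ _ := ⟨{univ}, ⟨by simp, by simp⟩, subset_univ _⟩
  isOpen_inter O₁ O₂ h₁ h₂ f hf := by
    obtain ⟨𝒰, h𝒰, hU⟩ := h₁ f hf.1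
    obtain ⟨𝒱, h𝒱, hV⟩ := h₂ f hf.2
    refine ⟨{W | ∃ U ∈ 𝒰, ∃ V ∈ 𝒱, W = U ∩ V}, ⟨?_, ?_⟩, fun g hg => ⟨hU fun x => ?_, hV fun x => ?_⟩⟩
    · rintro W ⟨U, hU', V, hV', rfl⟩
      exact (h𝒰.1 U hU').inter (h𝒱.1 V hV')
    · refine eq_univ_of_forall fun y => ?_
      obtain ⟨U, hU', hyU⟩ : y ∈ ⋃₀ 𝒰 := h𝒰.2 ▸ mem_univ y
      obtain ⟨V, hV', hyV⟩ : y ∈ ⋃₀ 𝒱 := h𝒱.2 ▸ mem_univ y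
      exact ⟨U ∩ V, ⟨U, hU', V, hV', rfl⟩, hyU, hyV⟩
    · obtain ⟨W, ⟨U, hU', V, hV', rfl⟩, hf', hg'⟩ := hg x
      exact ⟨U, hU', hf'.1, hg'.1⟩
    · obtain ⟨W, ⟨U, hU', V, hV', rfl⟩, hf', hg'⟩ := hg x
      exact ⟨V, hV', hf'.2, hg'.2⟩
  isOpen_sUnion S hS f := by
    rintro ⟨O, hO, hf⟩
    obtain ⟨𝒰, h𝒰, hU⟩ := hS O hO f hf
    exact ⟨𝒰, h𝒰, hU.trans (subset_sUnion_of_mem hO)⟩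

/-- Density in the limitation topology. -/
def LimitationDense {X : Type u} {Y : Type v} [TopologicalSpace X] [TopologicalSpace Y]
    (D : Set C(X, Y)) : Prop :=
  closure[limitationTopology X Y] D = univ

/-- `S_Y(X, B)`: the maps from `X` to `Y` such that the closure of the image is contained
in `B`. -/
def smallMaps (X : Type u) {Y : Type v} [TopologicalSpace X] [TopologicalSpace Y] (B : Set Y) :
    Set C(X, Y) :=
  {g | closure (range g) ⊆ B}

/-- The small maps approximation property of a set `D` of maps: for some open cover `𝒰` of `Y`,
all `𝒰`-small maps belong to the closure of `D` in the limitation topology. -/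
def SMAP {X : Type u} {Y : Type v} [TopologicalSpace X] [TopologicalSpace Y]
    (D : Set C(X, Y)) : Prop :=
  ∃ 𝒰 ∈ Cov Y, (⋃ B ∈ 𝒰, smallMaps X B) ⊆ closure[limitationTopology X Y] D

/-! ### Test spaces -/

/-- The cube `I^n`. -/
abbrev Cube (n : ℕ) : Type := Fin n → unitInterval

/-- The Hilbert cube `Q`. -/
abbrev HilbertCube : Type := ℕ → unitInterval

/-- The disjoint union of the cubes `I^1, I^2, …`. -/
abbrev CubeSum : Type := Σ n : ℕ, Cube (n + 1)

open Classical in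
/-- The closed simplex spanned by the vertices in `σ`; the vertex `t` is identified with the
`t`-th vector of the standard orthonormal basis of the Hilbert space `ℓ²(T)`. -/
def cell {T : Type u} (σ : Finset T) : Set (lp (fun _ : T => ℝ) 2) :=
  convexHull ℝ ((fun t : T => lp.single 2 t (1 : ℝ)) '' (σ : Set T))

/-- The underlying set of the geometric realization of a simplicial complex. -/
def realization {T : Type u} (K : PreAbstractSimplicialComplex T) :
    Set (lp (fun _ : T => ℝ) 2) :=
  ⋃ σ ∈ K.faces, cell σ

/-- `|K|_m`: the realization with the topology induced from `ℓ²(T)`. -/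
def MetricRealization {T : Type u} (K : PreAbstractSimplicialComplex T) : Type u :=
  realization K

instance {T : Type u} (K : PreAbstractSimplicialComplex T) :
    TopologicalSpace (MetricRealization K) :=
  inferInstanceAs (TopologicalSpace (realization K))

/-- `|K|_w`: the realization with the weak topology, in which a set is open iff its
intersection with each closed simplex of `K` is open in that simplex. -/
def WeakRealization {T : Type u} (K : PreAbstractSimplicialComplex T) : Type u :=
  realization K

/-- The inclusion of a closed simplex into the realization. -/
def cellInclusion {T : Type u} (K : PreAbstractSimplicialComplex T) (σ : K.faces)
    (x : cell σ.1) : WeakRealization K :=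
  ⟨x.1, mem_iUnion₂.2 ⟨σ.1, σ.2, x.2⟩⟩

instance {T : Type u} (K : PreAbstractSimplicialComplex T) :
    TopologicalSpace (WeakRealization K) :=
  ⨆ σ : K.faces, TopologicalSpace.coinduced (cellInclusion K σ) inferInstance

open Classical in
/-- The complex `J_n(α)` with vertex set `T` (of cardinality `α`) and a distinguished vertex `e`:
its faces are the nonempty finite sets `σ` of vertices such that `σ ∪ {e}` has at most `n + 1`
elements. -/
def complexJ {T : Type u} (e : T) (n : ℕ) : PreAbstractSimplicialComplex T where
  faces := {σ | σ.Nonempty ∧ (insert e σ).card ≤ n + 1}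
  isRelLowerSet_faces := fun _ hσ =>
    ⟨hσ.1, fun _ hρ hne => ⟨hne, (Finset.card_le_card (Finset.insert_subset_insert e hρ)).trans hσ.2⟩⟩

/-- The disjoint union of the spaces `|J_1(α)|_m, |J_2(α)|_m, …`. -/
abbrev MetricJSum {T : Type u} (e : T) : Type u :=
  Σ n : ℕ, MetricRealization (complexJ e (n + 1))

/-- The disjoint union of the spaces `|J_1(α)|_w, |J_2(α)|_w, …`. -/
abbrev WeakJSum {T : Type u} (e : T) : Type u :=
  Σ n : ℕ, WeakRealization (complexJ e (n + 1))

/-! ### Approximation properties -/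

/-- An indexed family of sets is discrete: every point has a neighbourhood which meets the set
with index `i` for at most one `i`. -/
def DiscreteFamily {ι : Type u} {X : Type v} [TopologicalSpace X] (S : ι → Set X) : Prop :=
  ∀ x : X, ∃ N ∈ 𝓝 x, {i | (S i ∩ N).Nonempty}.Subsingleton

/-- The countable locally finite approximation property (`ω`-LFAP). -/
def OmegaLFAP (X : Type u) [TopologicalSpace X] : Prop :=
  ∀ 𝒰 ∈ Cov X, ∃ f : ℕ → C(X, X),
    (∀ n, f n ∈ closeTo (ContinuousMap.id X) 𝒰) ∧ LocallyFinite fun n => range (f n)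

/-- The `κ`-discrete `m`-cells property; here `T` is a discrete space of cardinality `κ`. -/
def DiscreteCells (T : Type v) [TopologicalSpace T] (m : ℕ) (X : Type u) [TopologicalSpace X] :
    Prop :=
  LimitationDense
    {f : C(Cube m × T, X) | DiscreteFamily fun t : T => range fun x : Cube m => f (x, t)}

/-- The strong discrete approximation property. -/
def SDAP (X : Type u) [TopologicalSpace X] : Prop :=
  LimitationDense
    {f : C(CubeSum, X) | DiscreteFamily fun n : ℕ => range fun x : Cube (n + 1) => f ⟨n, x⟩}

/-! ### `Z`-sets and strong `Z`-sets -/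

/-- A closed set `A` is a `Z`-set if the maps of the Hilbert cube into `X` which omit `A` are
dense. -/
def IsZSet {X : Type u} [TopologicalSpace X] (A : Set X) : Prop :=
  IsClosed A ∧ LimitationDense {f : C(HilbertCube, X) | range f ⊆ Aᶜ}

/-- A closed set `A` is a strong `Z`-set if for every open cover `𝒰` there is a map `u` from `X`
to `X` which is `𝒰`-close to the identity and the closure of whose image is disjoint from `A`. -/
def IsStrongZSet {X : Type u} [TopologicalSpace X] (A : Set X) : Prop :=
  IsClosed A ∧ ∀ 𝒰 ∈ Cov X, ∃ g : C(X, X),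
    g ∈ closeTo (ContinuousMap.id X) 𝒰 ∧ A ∩ closure (range g) = ∅

end StrongZ

end

/-!
# Strong `Z`-sets

All questions are about pushing maps `f : Y → X` off the closed set `A`: `CanAvoid A f` says that `f`
is a limit of maps the closure of whose image misses `A`.  With a metric on `X`, closeness is
measured by positive `1`-Lipschitz functions (`IsControl`).  The set `A` is a strong `Z`-set iff the
identity of `X` can be pushed off `A`, and then so can all maps, by composition.  Hence each
equivalence has an easy half, and the other half asks for the converse: if small maps of certain
test spaces can be pushed off `A`, then so can the identity.

*Interpolation.*  The ANR `X` embeds isometrically in a normed space, as a neighbourhood retract of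
a convex set (`IsANR.exists_convexRetract`).  Nearby maps can therefore be joined by straight lines
and retracted to `X`, and a homotopy between maps avoiding `A` along which not much moves, measured
by the distance to `A`, avoids `A` as well.

*Locality.*  If `A` can be avoided locally over small pieces of `X`, it can be avoided globally
(`canAvoid_of_locally`): by a `σ`-discrete refinement of a cover of a metric space, the local
modifications are done simultaneously on discrete families of pieces, and in countably many steps
which are locally finite.  So it is enough to push the inclusions of small closed balls off `A`.

*Polyhedra of finite dimension.*  If families of maps of cubes can be pushed off `A`, so can all
maps of complexes of finite dimension in the weak topology, skeleton by skeleton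
(`canAvoid_weakRealization`).  Nerves of covers of finite order then take care of the spaces of
finite-dimensional type (`canAvoid_of_covers`).

*The telescope.*  Without a bound on the dimension of the nerves one works with a sequence of test
spaces: a continuous function `φ` divides the domain into shells `n ≤ φ ≤ n + 1`, in the `n`-th of
which the map factors through the `n`-th test space, and a second sequence of test spaces serves to
join what was obtained on consecutive shells (`canAvoid_of_telescope`).  For separable domains these
spaces are cubes, for domains covered by `α` compact sets they are realizations of `J_n(α)`.  The
latter case applies to the nerve, in the metric topology, of a cover of a small ball: the inclusion
of the ball factors approximately through it.

Finally, a locally finite family of maps can be pushed off `A` if each of its members can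
(`famCanAvoid_of_locallyFinite`).  This turns general position properties of `X` into the required
properties of `Z`-sets.
-/

namespace StrongZ

/-! ### Controls and the limitation topology of a metric space -/

/-- A *control* on a metric space: a positive function which does not exceed its value at another
point by more than the distance.  Closeness of maps with respect to open covers of a metric space
is measured by controls: `g` is `δ`-close to `f` if `dist (f z) (g z) < δ (f z)` for all `z`. -/
structure IsControl {X : Type*} [MetricSpace X] (δ : X → ℝ) : Prop where
  pos : ∀ x, 0 < δ x
  le_add : ∀ x y, δ x ≤ δ y + dist x y

section Control

variable {X : Type*} [MetricSpace X]

theorem IsControl.const {c : ℝ} (hc : 0 < c) : IsControl (fun _ : X => c) :=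
  ⟨fun _ => hc, fun _ _ => by simp⟩

theorem IsControl.min {δ δ' : X → ℝ} (h : IsControl δ) (h' : IsControl δ') :
    IsControl (fun x => min (δ x) (δ' x)) :=
  ⟨fun x => lt_min (h.pos x) (h'.pos x), fun x y => by
    have h1 := h.le_add x y
    have h2 := h'.le_add x y
    rcases le_total (δ y) (δ' y) with h3 | h3
    · rw [min_eq_left h3]; exact (min_le_left _ _).trans h1
    · rw [min_eq_right h3]; exact (min_le_right _ _).trans h2⟩

theorem IsControl.div {δ : X → ℝ} (h : IsControl δ) {c : ℝ} (hc : 1 ≤ c) :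
    IsControl (fun x => δ x / c) := by
  have hc' : 0 < c := by linarith
  refine ⟨fun x => div_pos (h.pos x) hc', fun x y => ?_⟩
  have h1 := h.le_add x y
  have h2 : dist x y / c ≤ dist x y := div_le_self dist_nonneg hc
  calc δ x / c ≤ (δ y + dist x y) / c := by gcongr
    _ = δ y / c + dist x y / c := by ring
    _ ≤ _ := by linarith

theorem IsControl.continuous {δ : X → ℝ} (h : IsControl δ) : Continuous δ := by
  have : LipschitzWith 1 δ := LipschitzWith.of_le_add fun x y => h.le_add x y
  exact this.continuous

/-- Controls are obtained from local conditions: if every point `x` admits a radius `ρ > 0` with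
`Q x ρ`, and `Q` passes to smaller balls, then the radius can be chosen as a control. -/
theorem exists_control {Q : X → ℝ → Prop} (hex : ∀ x, ∃ ρ > 0, Q x ρ)
    (hanti : ∀ x y ρ ρ', Q x ρ → ρ' + dist x y ≤ ρ → 0 < ρ' → Q y ρ') :
    ∃ δ : X → ℝ, IsControl δ ∧ ∀ x, Q x (δ x) := by
  set R : X → Set ℝ := fun x => {ρ | 0 < ρ ∧ ρ ≤ 1 ∧ Q x ρ}
  have hne : ∀ x, (R x).Nonempty := fun x => by
    obtain ⟨ρ, hρ, hQ⟩ := hex x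
    refine ⟨min ρ 1, lt_min hρ one_pos, min_le_right _ _, hanti x x ρ _ hQ ?_ (lt_min hρ one_pos)⟩
    simp
  have hbd : ∀ x, BddAbove (R x) := fun x => ⟨1, fun ρ h => h.2.1⟩
  have hpos : ∀ x, 0 < sSup (R x) := fun x => by
    obtain ⟨ρ, hρ⟩ := hne x
    exact hρ.1.trans_le (le_csSup (hbd x) hρ)
  have hlip : ∀ x y, sSup (R x) ≤ sSup (R y) + dist x y := fun x y => by
    refine csSup_le (hne x) fun ρ hρ => ?_
    by_cases h : 0 < ρ - dist x y
    · have : ρ - dist x y ∈ R y :=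
        ⟨h, by linarith [hρ.2.1, dist_nonneg (x := x) (y := y)], hanti x y ρ _ hρ.2.2 (by simp) h⟩
      linarith [le_csSup (hbd y) this]
    · linarith [hpos y]
  have hC : IsControl fun x => sSup (R x) := ⟨hpos, hlip⟩
  refine ⟨_, hC.div (c := 2) (by norm_num), fun x => ?_⟩
  obtain ⟨ρ, hρ, hlt⟩ := exists_lt_of_lt_csSup (hne x) (half_lt_self (hpos x))
  exact hanti x x ρ _ hρ.2.2 (by simpa using hlt.le) (half_pos (hpos x))

theorem exists_control_of_cov {𝒰 : Set (Set X)} (h𝒰 : 𝒰 ∈ Cov X) :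
    ∃ δ : X → ℝ, IsControl δ ∧ ∀ x, ∃ U ∈ 𝒰, Metric.ball x (δ x) ⊆ U := by
  refine exists_control (Q := fun x ρ => ∃ U ∈ 𝒰, Metric.ball x ρ ⊆ U) (fun x => ?_) ?_
  · obtain ⟨U, hU, hx⟩ : x ∈ ⋃₀ 𝒰 := h𝒰.2 ▸ mem_univ x
    obtain ⟨ρ, hρ, h⟩ := Metric.isOpen_iff.1 (h𝒰.1 U hU) x hx
    exact ⟨ρ, hρ, U, hU, h⟩
  · rintro x y ρ ρ' ⟨U, hU, h⟩ hle -
    refine ⟨U, hU, fun z hz => h ?_⟩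
    have := dist_triangle z y x
    rw [Metric.mem_ball] at *
    rw [dist_comm y x] at this
    linarith

theorem exists_cov_of_control {δ : X → ℝ} (hδ : IsControl δ) :
    ∃ 𝒰 ∈ Cov X, ∀ U ∈ 𝒰, ∀ x ∈ U, ∀ y ∈ U, dist x y < δ x := by
  refine ⟨range fun x => Metric.ball x (δ x / 4), ⟨?_, ?_⟩, ?_⟩
  · rintro _ ⟨x, rfl⟩; exact Metric.isOpen_ball
  · refine eq_univ_of_forall fun x => ⟨_, ⟨x, rfl⟩, Metric.mem_ball_self ?_⟩
    linarith [hδ.pos x]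
  · rintro _ ⟨z, rfl⟩ x hx y hy
    rw [Metric.mem_ball] at hx hy
    have h1 := hδ.le_add z x
    have h2 := dist_triangle_right x y z
    rw [dist_comm z x] at h1
    linarith [hδ.pos z]

/-- Small perturbations of a closed set which is disjoint from `A` stay away from `A`. -/
theorem exists_control_avoiding {A N : Set X} (hA : IsClosed A) (hN : IsClosed N)
    (hAN : Disjoint A N) :
    ∃ η : X → ℝ, IsControl η ∧ ∀ V : Set X, (∀ v ∈ V, ∃ u ∈ N, dist u v < η u) →
      Disjoint A (closure V) := by
  obtain ⟨η, hη, hQ⟩ := exists_control (X := X)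
    (Q := fun x ρ => Disjoint (Metric.ball x (2 * ρ)) A ∨ Disjoint (Metric.ball x (2 * ρ)) N)
    (fun x => by
      by_cases hx : x ∈ A
      · have hx' : x ∈ Nᶜ := fun h => hAN.le_bot ⟨hx, h⟩
        obtain ⟨ρ, hρ, h⟩ := Metric.isOpen_iff.1 hN.isOpen_compl x hx'
        refine ⟨ρ / 2, by linarith, Or.inr ?_⟩
        rw [mul_div_cancel₀ _ two_ne_zero]
        exact disjoint_left.2 fun y hy hy' => h hy hy'
      · obtain ⟨ρ, hρ, h⟩ := Metric.isOpen_iff.1 hA.isOpen_compl x hx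
        refine ⟨ρ / 2, by linarith, Or.inl ?_⟩
        rw [mul_div_cancel₀ _ two_ne_zero]
        exact disjoint_left.2 fun y hy hy' => h hy hy')
    (fun x y ρ ρ' h hle _ => by
      have : Metric.ball y (2 * ρ') ⊆ Metric.ball x (2 * ρ) :=
        Metric.ball_subset_ball' (by rw [dist_comm]; linarith [dist_nonneg (x := x) (y := y)])
      exact h.imp (fun h => h.mono_left this) fun h => h.mono_left this)
  refine ⟨η, hη, fun V hV => disjoint_left.2 fun a ha hcl => ?_⟩
  obtain ⟨v, hv, hav⟩ := Metric.mem_closure_iff.1 hcl (η a / 4) (by linarith [hη.pos a])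
  obtain ⟨u, hu, huv⟩ := hV v hv
  have h1 : 2 * η a ≤ dist u a := by
    by_contra! h
    rcases hQ a with h' | h'
    · exact disjoint_left.1 h' (Metric.mem_ball_self (by linarith [hη.pos a])) ha
    · exact disjoint_left.1 h' (Metric.mem_ball.2 h) hu
  have h2 : 2 * η u ≤ dist u a := by
    by_contra! h
    rcases hQ u with h' | h'
    · exact disjoint_left.1 h' (Metric.mem_ball.2 (by rwa [dist_comm])) ha
    · exact disjoint_left.1 h' (Metric.mem_ball_self (by linarith [hη.pos u])) hu
  have h3 := dist_triangle_right u a v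
  linarith [hη.pos a]

/-- The closure of a set of maps in the limitation topology, described by controls. -/
theorem mem_closure_limitation_iff {D : Type*} [TopologicalSpace D] {f : C(D, X)}
    {S : Set C(D, X)} :
    f ∈ closure[limitationTopology D X] S ↔
      ∀ δ : X → ℝ, IsControl δ → ∃ g ∈ S, ∀ z, dist (f z) (g z) < δ (f z) := by
  let _ := limitationTopology D X
  constructor
  · intro hf δ hδ
    let O : Set C(D, X) :=
      {g | ∃ ε, IsControl ε ∧ ∀ h : C(D, X), (∀ z, dist (g z) (h z) < ε (g z)) →
        ∀ z, dist (f z) (h z) < δ (f z)}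
    have hO : IsOpen O := by
      rintro g ⟨ε, hε, hg⟩
      obtain ⟨𝒰, h𝒰, hU⟩ := exists_cov_of_control (hε.div (c := 4) (by norm_num))
      refine ⟨𝒰, h𝒰, fun h hh => ⟨fun x => ε x / 4, hε.div (by norm_num), fun k hk => hg k fun z => ?_⟩⟩
      obtain ⟨U, hU', h1, h2⟩ := hh z
      have h3 := hU U hU' _ h1 _ h2
      have h4 := hk z
      have h5 := dist_triangle (g z) (h z) (k z)
      have h6 := hε.le_add (h z) (g z)
      rw [dist_comm (h z)] at h6
      linarith [hε.pos (g z)]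
    obtain ⟨g, ⟨ε, hε, hg⟩, hgS⟩ := mem_closure_iff.1 hf O hO ⟨δ, hδ, fun h hh => hh⟩
    exact ⟨g, hgS, hg g fun z => by simpa using hε.pos _⟩
  · intro h
    rw [mem_closure_iff]
    intro O hO hfO
    obtain ⟨𝒰, h𝒰, hU⟩ := hO f hfO
    obtain ⟨δ, hδ, hδU⟩ := exists_control_of_cov h𝒰
    obtain ⟨g, hg, hfg⟩ := h δ hδ
    refine ⟨g, hU fun z => ?_, hg⟩
    obtain ⟨U, hU', hb⟩ := hδU (f z)
    exact ⟨U, hU', hb (Metric.mem_ball_self (hδ.pos _)),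
      hb (Metric.mem_ball.2 (by rw [dist_comm]; exact hfg z))⟩

theorem limitationDense_iff {D : Type*} [TopologicalSpace D] {S : Set C(D, X)} :
    LimitationDense S ↔ ∀ f : C(D, X), ∀ δ : X → ℝ, IsControl δ →
      ∃ g ∈ S, ∀ z, dist (f z) (g z) < δ (f z) := by
  unfold LimitationDense
  rw [eq_univ_iff_forall]
  exact forall_congr' fun f => mem_closure_limitation_iff

/-! ### Maps and families of maps which can be pushed off `A` -/

/-- The map `f` can be approximated arbitrarily closely by maps the closure of whose image
misses `A`. -/
def CanAvoid {D : Type*} [TopologicalSpace D] (A : Set X) (f : C(D, X)) : Prop :=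
  ∀ δ : X → ℝ, IsControl δ →
    ∃ g : C(D, X), (∀ z, dist (f z) (g z) < δ (f z)) ∧ Disjoint A (closure (range g))

/-- The maps of a family can be approximated arbitrarily closely, by maps such that the closure of
the union of all their images misses `A`. -/
def FamCanAvoid {S : Type*} {Z : S → Type*} [∀ s, TopologicalSpace (Z s)] (A : Set X)
    (f : ∀ s, C(Z s, X)) : Prop :=
  ∀ δ : X → ℝ, IsControl δ → ∃ g : ∀ s, C(Z s, X),
    (∀ s z, dist (f s z) (g s z) < δ (f s z)) ∧ Disjoint A (closure (⋃ s, range (g s)))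

theorem mem_closure_smallMaps_iff {D : Type*} [TopologicalSpace D] {A : Set X} {f : C(D, X)} :
    f ∈ closure[limitationTopology D X] (smallMaps D Aᶜ) ↔ CanAvoid A f := by
  rw [mem_closure_limitation_iff]
  refine forall₂_congr fun δ _ => exists_congr fun g => ?_
  rw [and_comm, smallMaps, mem_ofPred_eq, disjoint_comm, subset_compl_iff_disjoint_right]

theorem CanAvoid.comp {D D' : Type*} [TopologicalSpace D] [TopologicalSpace D'] {A : Set X}
    {f : C(D, X)} (h : CanAvoid A f) (p : C(D', D)) : CanAvoid A (f.comp p) := fun δ hδ => by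
  obtain ⟨g, hg, hgA⟩ := h δ hδ
  exact ⟨g.comp p, fun z => hg (p z), hgA.mono_right (closure_mono (range_comp_subset_range p g))⟩

theorem isStrongZSet_iff {A : Set X} :
    IsStrongZSet A ↔ IsClosed A ∧ CanAvoid A (ContinuousMap.id X) := by
  refine and_congr_right fun _ => ⟨fun h δ hδ => ?_, fun h 𝒰 h𝒰 => ?_⟩
  · obtain ⟨𝒰, h𝒰, hU⟩ := exists_cov_of_control hδ
    obtain ⟨g, hg, hgA⟩ := h 𝒰 h𝒰
    refine ⟨g, fun z => ?_, disjoint_iff_inter_eq_empty.2 hgA⟩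
    obtain ⟨U, hU', h1, h2⟩ := hg z
    exact hU U hU' _ h1 _ h2
  · obtain ⟨δ, hδ, hδU⟩ := exists_control_of_cov h𝒰
    obtain ⟨g, hg, hgA⟩ := h δ hδ
    refine ⟨g, fun z => ?_, disjoint_iff_inter_eq_empty.1 hgA⟩
    obtain ⟨U, hU', hb⟩ := hδU z
    exact ⟨U, hU', hb (Metric.mem_ball_self (hδ.pos _)),
      hb (Metric.mem_ball.2 (by rw [dist_comm]; exact hg z))⟩

theorem IsStrongZSet.canAvoid {D : Type*} [TopologicalSpace D] {A : Set X} (h : IsStrongZSet A)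
    (f : C(D, X)) : CanAvoid A f :=
  (isStrongZSet_iff.1 h).2.comp f

theorem IsStrongZSet.smap {D : Type*} [TopologicalSpace D] {A : Set X} (h : IsStrongZSet A) :
    SMAP (smallMaps D Aᶜ) :=
  ⟨{univ}, ⟨by simp, by simp⟩, fun f _ => mem_closure_smallMaps_iff.2 (h.canAvoid f)⟩

theorem SMAP.exists_canAvoid {D : Type*} [TopologicalSpace D] {A : Set X}
    (h : SMAP (smallMaps D Aᶜ)) (a : X) :
    ∃ ρ > 0, ∀ f : C(D, X), (∀ z, f z ∈ Metric.closedBall a ρ) → CanAvoid A f := by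
  obtain ⟨𝒰, h𝒰, hU⟩ := h
  obtain ⟨B, hB, ha⟩ : a ∈ ⋃₀ 𝒰 := h𝒰.2 ▸ mem_univ a
  obtain ⟨ρ, hρ, hb⟩ := Metric.nhds_basis_closedBall.mem_iff.1 ((h𝒰.1 B hB).mem_nhds ha)
  refine ⟨ρ, hρ, fun f hf => mem_closure_smallMaps_iff.1 (hU ?_)⟩
  refine mem_iUnion₂.2 ⟨B, hB, ?_⟩
  exact (closure_minimal (range_subset_iff.2 hf) Metric.isClosed_closedBall).trans hb

/-- Maps of retracts of the Hilbert cube are pushed off a `Z`-set.  By compactness the closure of the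
image misses it as well. -/
theorem IsZSet.canAvoid {Z : Type*} [TopologicalSpace Z] [CompactSpace Z] {A : Set X}
    (h : IsZSet A) (i : C(Z, HilbertCube)) (p : C(HilbertCube, Z)) (hpi : ∀ z, p (i z) = z)
    (f : C(Z, X)) : CanAvoid A f := fun δ hδ => by
  obtain ⟨g, hg, hfg⟩ := limitationDense_iff.1 h.2 (f.comp p) δ hδ
  refine ⟨g.comp i, fun z => by simpa [hpi] using hfg (i z), ?_⟩
  rw [(isCompact_range (g.comp i).continuous).isClosed.closure_eq]
  exact disjoint_left.2 fun a ha ⟨z, hz⟩ => hg ⟨i z, hz⟩ ha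

/-- Sufficiently small perturbations of a locally finite family of sets are locally finite. -/
theorem exists_control_locallyFinite {S : Type*} {N : S → Set X} (hN : LocallyFinite N) :
    ∃ η : X → ℝ, IsControl η ∧ ∀ V : S → Set X, (∀ s, ∀ v ∈ V s, ∃ u ∈ N s, dist u v < η u) →
      LocallyFinite V := by
  obtain ⟨η, hη, hQ⟩ := exists_control (X := X)
    (Q := fun x ρ => {s | (N s ∩ Metric.ball x ρ).Nonempty}.Finite)
    (fun x => by
      obtain ⟨t, ht, hfin⟩ := hN x
      obtain ⟨ρ, hρ, hb⟩ := Metric.mem_nhds_iff.1 ht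
      exact ⟨ρ, hρ, hfin.subset fun s hs => hs.mono (inter_subset_inter_right _ hb)⟩)
    (fun x y ρ ρ' hfin hle _ => hfin.subset fun s hs => hs.mono (inter_subset_inter_right _
      (Metric.ball_subset_ball' (by rwa [dist_comm]))))
  refine ⟨_, hη.div (c := 4) (by norm_num), fun V hV a => ⟨Metric.ball a (η a / 8),
    Metric.ball_mem_nhds a (by linarith [hη.pos a]), (hQ a).subset ?_⟩⟩
  rintro s ⟨v, hv, hva⟩
  obtain ⟨u, hu, huv⟩ := hV s v hv
  refine ⟨u, hu, ?_⟩
  have h2 := dist_triangle u v a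
  have h3 := hη.le_add u a
  rw [Metric.mem_ball] at *
  linarith [hη.pos a]

theorem disjoint_closure_iUnion {S : Type*} {A : Set X} {V : S → Set X} (hV : LocallyFinite V)
    (h : ∀ s, Disjoint A (closure (V s))) : Disjoint A (closure (⋃ s, V s)) := by
  rw [hV.closure_iUnion]
  exact disjoint_iUnion_right.2 h

/-- A family of maps with locally finite images can be pushed off `A` as soon as each of its
members can. -/
theorem famCanAvoid_of_locallyFinite {S : Type*} {Z : S → Type*} [∀ s, TopologicalSpace (Z s)]
    {A : Set X} {f : ∀ s, C(Z s, X)} (hf : LocallyFinite fun s => range (f s))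
    (h : ∀ s, CanAvoid A (f s)) : FamCanAvoid A f := fun δ hδ => by
  obtain ⟨η, hη, hV⟩ := exists_control_locallyFinite hf
  choose g hg hgA using fun s => h s _ (hδ.min hη)
  refine ⟨g, fun s z => (hg s z).trans_le (min_le_left _ _),
    disjoint_closure_iUnion (hV _ ?_) hgA⟩
  rintro s _ ⟨z, rfl⟩
  exact ⟨_, ⟨z, rfl⟩, (hg s z).trans_le (min_le_right _ _)⟩

theorem DiscreteFamily.locallyFinite {S : Type*} {Y : Type*} [TopologicalSpace Y] {R : S → Set Y}
    (h : DiscreteFamily R) : LocallyFinite R := fun x => by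
  obtain ⟨N, hN, hs⟩ := h x
  exact ⟨N, hN, hs.finite⟩

end Control

end StrongZ

namespace StrongZ

/-! ### Absolute neighbourhood retracts as neighbourhood retracts of convex sets -/

/-- Clamping a real number to the unit interval. -/
noncomputable def clamp (t : ℝ) : ℝ := max 0 (min 1 t)

theorem clamp_nonneg (t : ℝ) : 0 ≤ clamp t := le_max_left _ _

theorem clamp_le_one (t : ℝ) : clamp t ≤ 1 := max_le zero_le_one (min_le_left _ _)

theorem clamp_of_le {t : ℝ} (h : t ≤ 0) : clamp t = 0 :=
  max_eq_left ((min_le_right _ _).trans h)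

theorem clamp_of_ge {t : ℝ} (h : 1 ≤ t) : clamp t = 1 := by
  rw [clamp, min_eq_left h, max_eq_right zero_le_one]

theorem clamp_of_mem {t : ℝ} (h0 : 0 ≤ t) (h1 : t ≤ 1) : clamp t = t := by
  rw [clamp, min_eq_right h1, max_eq_right h0]

@[fun_prop]
theorem continuous_clamp : Continuous clamp := by unfold clamp; fun_prop

/-- An isometric embedding `emb` of a metric space `X` into a convex subset `C` of a normed space,
together with a retraction `r` onto `X` of a relatively open subset `S` of `C`.  The values of
`r` outside of `S` are irrelevant. -/
structure ConvexRetract (X : Type*) [MetricSpace X] (E : Type*) [NormedAddCommGroup E]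
    [NormedSpace ℝ E] where
  emb : X → E
  isometry_emb : Isometry emb
  C : Set E
  convex_C : Convex ℝ C
  S : Set E
  exists_ball : ∀ e ∈ S, ∃ ρ > 0, ∀ e' ∈ C, dist e' e < ρ → e' ∈ S
  S_subset : S ⊆ C
  r : E → X
  continuousOn_r : ContinuousOn r S
  emb_mem : ∀ x, emb x ∈ S
  r_emb : ∀ x, r (emb x) = x

section Embedding

variable (X : Type u) [MetricSpace X]

/-- The Kuratowski embedding `x ↦ dist x · - dist x₀ ·`. -/
noncomputable def kuratowski {X : Type u} [MetricSpace X] (x₀ x : X) : BoundedContinuousFunction X ℝ :=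
  BoundedContinuousFunction.ofNormedAddCommGroup (fun z => dist x z - dist x₀ z) (by fun_prop)
    (dist x x₀) fun z => abs_dist_sub_le x x₀ z

variable {X}

theorem kuratowski_apply (x₀ x z : X) : kuratowski x₀ x z = dist x z - dist x₀ z := rfl

theorem isometry_kuratowski (x₀ : X) : Isometry (kuratowski x₀) := by
  refine Isometry.of_dist_eq fun x y => le_antisymm ?_ ?_
  · refine (BoundedContinuousFunction.dist_le dist_nonneg).2 fun z => ?_
    rw [kuratowski_apply, kuratowski_apply, Real.dist_eq, sub_sub_sub_cancel_right]
    exact abs_dist_sub_le x y z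
  · have := BoundedContinuousFunction.dist_coe_le_dist (f := kuratowski x₀ x)
      (g := kuratowski x₀ y) y
    rw [kuratowski_apply, kuratowski_apply, Real.dist_eq, sub_sub_sub_cancel_right, dist_self,
      sub_zero, abs_of_nonneg dist_nonneg] at this
    exact this

/-- A point of the convex hull of the image of the Kuratowski embedding which is a limit of points
of the image belongs to the image: if `∑ tᵢ dist xᵢ ·` is close to `dist y ·`, then evaluation at
`y` shows that `y` is close to every `xᵢ` with `tᵢ > 0`. -/
theorem kuratowski_mem_range_of_mem_closure (x₀ : X) {e : BoundedContinuousFunction X ℝ}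
    (he : e ∈ convexHull ℝ (range (kuratowski x₀))) (hcl : e ∈ closure (range (kuratowski x₀))) :
    e ∈ range (kuratowski x₀) := by
  obtain ⟨ι, _, t, z, ht, hsum, hz, rfl⟩ := mem_convexHull_iff_exists_fintype.1 he
  choose x hx using hz
  obtain ⟨i, -, hi⟩ : ∃ i ∈ Finset.univ, 0 < t i := by
    by_contra! h
    have : ∑ i, t i ≤ 0 := Finset.sum_nonpos h
    linarith
  refine ⟨x i, eq_of_forall_dist_le fun ε hε => ?_⟩
  obtain ⟨_, ⟨y, rfl⟩, hy⟩ := Metric.mem_closure_iff.1 hcl (min (ε / 2) (t i * (ε / 2)))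
    (lt_min (by positivity) (by positivity))
  have h1 := (BoundedContinuousFunction.dist_coe_le_dist (f := ∑ i, t i • z i)
    (g := kuratowski x₀ y) y).trans hy.le
  have h2 : (∑ i, t i • z i : BoundedContinuousFunction X ℝ) y
      = ∑ i, t i * dist (x i) y - dist x₀ y := by
    rw [BoundedContinuousFunction.coe_sum, Finset.sum_apply]
    simp_rw [← hx, BoundedContinuousFunction.coe_smul, kuratowski_apply, smul_eq_mul, mul_sub]
    rw [Finset.sum_sub_distrib, ← Finset.sum_mul, hsum, one_mul]
  rw [h2, kuratowski_apply, Real.dist_eq, sub_sub_sub_cancel_right, dist_self, sub_zero] at h1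
  have h3 : t i * dist (x i) y ≤ ∑ i, t i * dist (x i) y :=
    Finset.single_le_sum (f := fun i => t i * dist (x i) y)
      (fun j _ => mul_nonneg (ht j) dist_nonneg) (Finset.mem_univ i)
  have h4 : t i * dist (x i) y ≤ t i * (ε / 2) :=
    (h3.trans (le_abs_self _)).trans (h1.trans (min_le_right _ _))
  have h5 : dist (x i) y ≤ ε / 2 := le_of_mul_le_mul_left h4 hi
  calc dist (kuratowski x₀ (x i)) (∑ i, t i • z i)
      ≤ dist (kuratowski x₀ (x i)) (kuratowski x₀ y) + dist (∑ i, t i • z i) (kuratowski x₀ y) :=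
        dist_triangle_right _ _ _
    _ ≤ ε / 2 + ε / 2 := add_le_add (by rwa [(isometry_kuratowski x₀).dist_eq])
        (hy.le.trans (min_le_left _ _))
    _ = ε := by ring

theorem IsANR.exists_convexRetract [Nonempty X] (hX : IsANR X) :
    Nonempty (ConvexRetract X (BoundedContinuousFunction X ℝ)) := by
  classical
  obtain ⟨x₀⟩ := ‹Nonempty X›
  set H : Set (BoundedContinuousFunction X ℝ) := convexHull ℝ (range (kuratowski x₀))
  have hmem : ∀ x, kuratowski x₀ x ∈ H := fun x => subset_convexHull ℝ _ ⟨x, rfl⟩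
  let i : X → H := fun x => ⟨kuratowski x₀ x, hmem x⟩
  have hi : Isometry i := Isometry.of_dist_eq fun x y => (isometry_kuratowski x₀).dist_eq x y
  have hcl : IsClosedEmbedding i := by
    refine ⟨hi.isEmbedding, isClosed_of_closure_subset fun e he => ?_⟩
    have h1 : (e : BoundedContinuousFunction X ℝ) ∈ closure (range (kuratowski x₀)) := by
      have := image_closure_subset_closure_image continuous_subtype_val (mem_image_of_mem _ he)
      rwa [← range_comp] at this
    obtain ⟨x, hx⟩ := kuratowski_mem_range_of_mem_closure x₀ e.2 h1
    exact ⟨x, Subtype.ext hx⟩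
  obtain ⟨U, hU, hiU, ρ, hρ⟩ := hX.2 H i hcl
  have hr : ∃ r : BoundedContinuousFunction X ℝ → X, ∀ u : U, r u.1.1 = ρ u := by
    refine ⟨fun e => if h : ∃ u : U, u.1.1 = e then ρ h.choose else x₀, fun u => ?_⟩
    have h : ∃ v : U, v.1.1 = u.1.1 := ⟨u, rfl⟩
    dsimp only
    rw [dif_pos h]
    congr 1
    exact Subtype.ext (Subtype.ext h.choose_spec)
  obtain ⟨r, hr⟩ := hr
  refine ⟨⟨kuratowski x₀, isometry_kuratowski x₀, H, convex_convexHull ℝ _, (↑) '' U, ?_, ?_, r,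
    ?_, fun x => ⟨i x, hiU ⟨x, rfl⟩, rfl⟩, fun x => ?_⟩⟩
  · rintro _ ⟨u, hu, rfl⟩
    obtain ⟨ε, hε, hb⟩ := Metric.isOpen_iff.1 hU u hu
    exact ⟨ε, hε, fun e' he' hd => ⟨⟨e', he'⟩, hb hd, rfl⟩⟩
  · rintro _ ⟨u, -, rfl⟩; exact u.2
  · rw [continuousOn_iff_continuous_domRestrict]
    have h1 : ∀ e : ((↑) '' U : Set (BoundedContinuousFunction X ℝ)), ∃ h : e.1 ∈ H, (⟨e, h⟩ : H) ∈ U := by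
      rintro ⟨_, u, hu, rfl⟩; exact ⟨u.2, hu⟩
    have h2 : ((↑) '' U : Set (BoundedContinuousFunction X ℝ)).domRestrict r
        = fun e => ρ ⟨⟨e.1, (h1 e).1⟩, (h1 e).2⟩ :=
      funext fun e => hr ⟨⟨e.1, (h1 e).1⟩, (h1 e).2⟩
    rw [h2]
    fun_prop
  · rw [show kuratowski x₀ x = (⟨i x, hiU ⟨x, rfl⟩⟩ : U).1.1 from rfl, hr]
    exact hρ x _

end Embedding

namespace ConvexRetract

variable {X : Type*} [MetricSpace X] {E : Type*} [NormedAddCommGroup E] [NormedSpace ℝ E]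
  (R : ConvexRetract X E)

theorem continuous_emb : Continuous R.emb := R.isometry_emb.continuous

theorem emb_mem_C (x : X) : R.emb x ∈ R.C := R.S_subset (R.emb_mem x)

theorem continuous_r_comp {Y : Type*} [TopologicalSpace Y] {e : Y → E} (he : Continuous e)
    (h : ∀ y, e y ∈ R.S) : Continuous fun y => R.r (e y) :=
  R.continuousOn_r.comp_continuous he h

/-- Points of `C` which are sufficiently close to `emb x` are retracted to points close to `x`. -/
theorem exists_control {ε : X → ℝ} (hε : IsControl ε) :
    ∃ δ : X → ℝ, IsControl δ ∧ (∀ x, δ x ≤ ε x) ∧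
      ∀ x, ∀ e ∈ R.C, dist e (R.emb x) < δ x → e ∈ R.S ∧ dist (R.r e) x < ε x := by
  obtain ⟨δ, hδ, hQ⟩ := StrongZ.exists_control (X := X)
    (Q := fun x ρ => ∀ e ∈ R.C, ∀ y, dist e (R.emb x) < ρ → dist x y < ρ →
      e ∈ R.S ∧ dist (R.r e) y < ε y)
    (fun x => by
      obtain ⟨ρ₁, hρ₁, h1⟩ := R.exists_ball _ (R.emb_mem x)
      obtain ⟨ρ₂, hρ₂, h2⟩ := Metric.continuousWithinAt_iff.1
        (R.continuousOn_r _ (R.emb_mem x)) (ε x / 4) (by linarith [hε.pos x])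
      refine ⟨min (min ρ₁ ρ₂) (ε x / 4), by
        have := hε.pos x; positivity, fun e he y hd hxy => ?_⟩
      have hS := h1 e he (hd.trans_le ((min_le_left _ _).trans (min_le_left _ _)))
      refine ⟨hS, ?_⟩
      have h3 := h2 hS (hd.trans_le ((min_le_left _ _).trans (min_le_right _ _)))
      rw [R.r_emb] at h3
      have h4 := hxy.trans_le (min_le_right _ _)
      have h5 := dist_triangle (R.r e) x y
      have h6 := hε.le_add x y
      linarith [hε.pos x])
    (fun x y ρ ρ' h hle _ e he z hd hyz => h e he z
      (by
        have := dist_triangle e (R.emb y) (R.emb x)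
        rw [R.isometry_emb.dist_eq, dist_comm y] at this
        linarith)
      (by linarith [dist_triangle x y z]))
  refine ⟨_, hδ.min hε, fun x => min_le_right _ _, fun x e he hd => ?_⟩
  exact hQ x e he x (hd.trans_le (min_le_left _ _)) (by simpa using hδ.pos x)

/-- Every point has small convex neighbourhoods in `C` which are retracted to a prescribed
ball. -/
theorem exists_radius (a : X) {ρ : ℝ} (hρ : 0 < ρ) :
    ∃ R₀ > 0, R₀ ≤ ρ ∧ ∀ e ∈ R.C, dist e (R.emb a) ≤ R₀ → e ∈ R.S ∧ dist (R.r e) a ≤ ρ := by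
  obtain ⟨δ, hδ, hle, h⟩ := R.exists_control (IsControl.const (X := X) hρ)
  refine ⟨δ a / 2, half_pos (hδ.pos a), by linarith [hle a, hδ.pos a], fun e he hd => ?_⟩
  obtain ⟨h1, h2⟩ := h a e he (by linarith [hδ.pos a])
  exact ⟨h1, h2.le⟩

/-- The restriction of the structure to a nonempty open subset. -/
noncomputable def restrict (U : Set X) (hU : IsOpen U) (hne : U.Nonempty) : ConvexRetract U E := by
  classical
  exact
  { emb := fun x => R.emb x
    isometry_emb := R.isometry_emb.comp isometry_subtype_coe
    C := R.C
    convex_C := R.convex_C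
    S := {e | e ∈ R.S ∧ R.r e ∈ U}
    exists_ball := fun e he => by
      obtain ⟨ρ₁, hρ₁, h1⟩ := R.exists_ball e he.1
      obtain ⟨ε, hε, hb⟩ := Metric.isOpen_iff.1 hU _ he.2
      obtain ⟨ρ₂, hρ₂, h2⟩ := Metric.continuousWithinAt_iff.1 (R.continuousOn_r _ he.1) ε hε
      refine ⟨min ρ₁ ρ₂, lt_min hρ₁ hρ₂, fun e' he' hd => ?_⟩
      have hS := h1 e' he' (hd.trans_le (min_le_left _ _))
      exact ⟨hS, hb (h2 hS (hd.trans_le (min_le_right _ _)))⟩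
    S_subset := fun e he => R.S_subset he.1
    r := fun e => if h : R.r e ∈ U then ⟨R.r e, h⟩ else ⟨hne.some, hne.some_mem⟩
    continuousOn_r := by
      rw [continuousOn_iff_continuous_domRestrict]
      have : ({e | e ∈ R.S ∧ R.r e ∈ U} : Set E).domRestrict
          (fun e => if h : R.r e ∈ U then (⟨R.r e, h⟩ : U) else ⟨hne.some, hne.some_mem⟩)
          = fun e => ⟨R.r e.1, e.2.2⟩ := funext fun e => dif_pos e.2.2
      rw [this]
      exact Continuous.subtype_mk (R.continuous_r_comp continuous_subtype_val fun e => e.2.1) _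
    emb_mem := fun x => ⟨R.emb_mem x, by rw [R.r_emb]; exact x.2⟩
    r_emb := fun x => by
      have h : R.r (R.emb x) ∈ U := by rw [R.r_emb]; exact x.2
      rw [dif_pos h]
      exact Subtype.ext (R.r_emb x) }

theorem add_smul_sub_mem {u v : E} (hu : u ∈ R.C) (hv : v ∈ R.C) {t : ℝ} (h0 : 0 ≤ t)
    (h1 : t ≤ 1) : u + t • (v - u) ∈ R.C :=
  R.convex_C.add_smul_sub_mem hu hv ⟨h0, h1⟩

theorem dist_add_smul_sub_le (u v : E) {t : ℝ} (h0 : 0 ≤ t) (h1 : t ≤ 1) :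
    dist (u + t • (v - u)) u ≤ dist u v := by
  rw [dist_eq_norm, add_sub_cancel_left, norm_smul, Real.norm_of_nonneg h0, dist_comm,
    dist_eq_norm]
  exact mul_le_of_le_one_left (norm_nonneg _) h1

/-- Interpolation between a map `f` and a map `g` which is only defined on a closed set `F`, with
weight `s` given to `g`. -/
theorem exists_blend (R : ConvexRetract X E) {Y : Type*} [TopologicalSpace Y] (f : C(Y, X))
    {F : Set Y} (hF : IsClosed F) (g : C(F, X)) (s : C(Y, ℝ)) (hs : ∀ y ∉ F, s y = 0)
    (hS : ∀ y : F, R.emb (f y) + s y • (R.emb (g y) - R.emb (f y)) ∈ R.S) :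
    ∃ G : C(Y, X), (∀ y : F, G y = R.r (R.emb (f y) + s y • (R.emb (g y) - R.emb (f y)))) ∧
      ∀ y ∉ F, G y = f y := by
  classical
  let e : Y → E := fun y => R.emb (f y) +
    s y • ((if h : y ∈ F then R.emb (g ⟨y, h⟩) else R.emb (f y)) - R.emb (f y))
  have he1 : ∀ y : F, e y = R.emb (f y) + s y • (R.emb (g y) - R.emb (f y)) := fun y => by
    simp only [e]
    rw [dif_pos y.2]
  have he2 : ∀ y, s y = 0 → e y = R.emb (f y) := fun y hy => by
    simp only [e]
    rw [hy, zero_smul, add_zero]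
  have he : Continuous e := by
    have hfc := f.continuous
    have h1 : ContinuousOn e F := by
      rw [continuousOn_iff_continuous_domRestrict]
      have : F.domRestrict e = fun y => R.emb (f y.1) +
          s y.1 • (R.emb (g y) - R.emb (f y.1)) := funext he1
      rw [this]
      have := R.continuous_emb
      fun_prop
    have h2 : ContinuousOn e {y | s y = 0} :=
      (R.continuous_emb.comp hfc).continuousOn.congr fun y hy => he2 y hy
    have h3 := h1.union_of_isClosed h2 hF (isClosed_eq s.continuous continuous_const)
    rw [← continuousOn_univ]
    refine h3.mono fun y _ => ?_
    by_cases h : y ∈ F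
    · exact Or.inl h
    · exact Or.inr (hs y h)
  have heS : ∀ y, e y ∈ R.S := fun y => by
    by_cases h : y ∈ F
    · rw [he1 ⟨y, h⟩]; exact hS ⟨y, h⟩
    · rw [he2 y (hs y h)]; exact R.emb_mem _
  refine ⟨⟨fun y => R.r (e y), R.continuous_r_comp he heS⟩, fun y => ?_, fun y hy => ?_⟩
  · exact congrArg R.r (he1 y)
  · exact (congrArg R.r (he2 y (hs y hy))).trans (R.r_emb _)

/-- Approximations of `f` over the preimage of a ball extend, by interpolation with `f`, to
approximations of `f` which agree with the given ones over a smaller ball. -/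
theorem exists_extension (R : ConvexRetract X E) {Y : Type*} [TopologicalSpace Y] {A : Set X}
    (f : C(Y, X)) (a : X) {ρ : ℝ} (hρ : 0 < ρ)
    (hf : CanAvoid A (f.restrict (f ⁻¹' Metric.closedBall a ρ)))
    {δ : X → ℝ} (hδ : IsControl δ) :
    ∃ g : C(Y, X), (∀ y, dist (f y) (g y) < δ (f y)) ∧
      Disjoint A (closure (g '' (f ⁻¹' Metric.closedBall a (ρ / 2)))) := by
  obtain ⟨δ', hδ', -, hR⟩ := R.exists_control hδ
  obtain ⟨g, hg, hgA⟩ := hf δ' hδ'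
  let s : C(Y, ℝ) := ⟨fun y => clamp (3 - 4 * dist (f y) a / ρ), by
    have := f.continuous
    fun_prop⟩
  have hd : ∀ y : f ⁻¹' Metric.closedBall a ρ, _ := fun y =>
    hR (f y) (R.emb (f y) + s y • (R.emb (g y) - R.emb (f y)))
      (R.add_smul_sub_mem (R.emb_mem_C _) (R.emb_mem_C _) (clamp_nonneg _) (clamp_le_one _))
      ((dist_add_smul_sub_le _ _ (clamp_nonneg _) (clamp_le_one _)).trans_lt
        (by rw [R.isometry_emb.dist_eq]; exact hg y))
  obtain ⟨G, hG1, hG2⟩ := R.exists_blend f (Metric.isClosed_closedBall.preimage f.continuous) g s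
    (fun y hy => clamp_of_le (by
      have : ρ < dist (f y) a := not_le.1 hy
      rw [sub_nonpos, le_div_iff₀ hρ]; linarith)) fun y => (hd y).1
  refine ⟨G, fun y => ?_, hgA.mono_right (closure_mono ?_)⟩
  · by_cases hy : y ∈ f ⁻¹' Metric.closedBall a ρ
    · rw [dist_comm, hG1 ⟨y, hy⟩]; exact (hd ⟨y, hy⟩).2
    · rw [hG2 y hy, dist_self]; exact hδ.pos _
  · rintro _ ⟨y, hy, rfl⟩
    have hy' : y ∈ f ⁻¹' Metric.closedBall a ρ := Metric.closedBall_subset_closedBall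
      (by linarith) hy
    have hs1 : s y = 1 := clamp_of_ge (by
      have : dist (f y) a ≤ ρ / 2 := hy
      rw [le_sub_iff_add_le, ← le_sub_iff_add_le', div_le_iff₀ hρ]; linarith)
    refine ⟨⟨y, hy'⟩, ?_⟩
    rw [hG1 ⟨y, hy'⟩]
    simp only [hs1]
    rw [one_smul, add_sub_cancel, R.r_emb]

end ConvexRetract

end StrongZ

namespace StrongZ

/-! ### Pushing maps off a closed set is a local problem -/

section Locality

variable {X : Type*} [MetricSpace X]

/-- Every map from `Y` to `X` can be approximated by maps which keep the preimage of `V` away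
from `A`. -/
def AvoidsOver (Y : Type*) [TopologicalSpace Y] (A V : Set X) : Prop :=
  ∀ f : C(Y, X), ∀ δ : X → ℝ, IsControl δ →
    ∃ g : C(Y, X), (∀ y, dist (f y) (g y) < δ (f y)) ∧ Disjoint A (closure (g '' (f ⁻¹' V)))

variable {Y : Type*} [TopologicalSpace Y] {A : Set X}

theorem AvoidsOver.mono {V V' : Set X} (h : AvoidsOver Y A V) (hV : V' ⊆ V) : AvoidsOver Y A V' :=
  fun f δ hδ => by
    obtain ⟨g, hg, hgA⟩ := h f δ hδ
    exact ⟨g, hg, hgA.mono_right (closure_mono (image_mono (preimage_mono hV)))⟩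

theorem avoidsOver_of_disjoint {V : Set X} (h : Disjoint A (closure V)) : AvoidsOver Y A V :=
  fun f δ hδ => ⟨f, fun y => by simpa using hδ.pos _,
    h.mono_right (closure_mono (image_preimage_subset f V))⟩

theorem AvoidsOver.union (hA : IsClosed A) {V₁ V₂ F O : Set X} (h₁ : AvoidsOver Y A V₁)
    (h₂ : AvoidsOver Y A V₂) (hF : IsClosed F) (hO : IsOpen O) (hFO : F ⊆ O) (hOV : O ⊆ V₂) :
    AvoidsOver Y A (V₁ ∪ F) := fun f δ hδ => by
  obtain ⟨κ, hκ, hQ⟩ := exists_control (X := X)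
    (Q := fun x ρ => Metric.ball x ρ ⊆ O ∨ Disjoint (Metric.ball x ρ) F)
    (fun x => by
      by_cases hx : x ∈ F
      · obtain ⟨ρ, hρ, h⟩ := Metric.isOpen_iff.1 hO x (hFO hx)
        exact ⟨ρ, hρ, Or.inl h⟩
      · obtain ⟨ρ, hρ, h⟩ := Metric.isOpen_iff.1 hF.isOpen_compl x hx
        exact ⟨ρ, hρ, Or.inr (disjoint_left.2 fun y hy hy' => h hy hy')⟩)
    (fun x y ρ ρ' h hle _ => by
      have : Metric.ball y ρ' ⊆ Metric.ball x ρ :=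
        Metric.ball_subset_ball' (by rwa [dist_comm])
      exact h.imp this.trans fun h => h.mono_left this)
  obtain ⟨g₁, hg₁, hA₁⟩ := h₁ f _ ((hδ.div (c := 4) (by norm_num)).min hκ)
  obtain ⟨η, hη, hηA⟩ := exists_control_avoiding hA isClosed_closure hA₁
  obtain ⟨g₂, hg₂, hA₂⟩ := h₂ g₁ _ ((hδ.div (c := 4) (by norm_num)).min hη)
  refine ⟨g₂, fun y => ?_, ?_⟩
  · have e1 := (hg₁ y).trans_le (min_le_left _ _)
    have e2 := (hg₂ y).trans_le (min_le_left _ _)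
    have e3 := hδ.le_add (g₁ y) (f y)
    have e4 := dist_triangle (f y) (g₁ y) (g₂ y)
    rw [dist_comm (g₁ y) (f y)] at e3
    linarith [hδ.pos (f y)]
  · have : g₂ '' (f ⁻¹' (V₁ ∪ F)) ⊆ g₂ '' (f ⁻¹' V₁) ∪ g₂ '' (g₁ ⁻¹' V₂) := by
      rintro _ ⟨y, hy | hy, rfl⟩
      · exact Or.inl ⟨y, hy, rfl⟩
      · refine Or.inr ⟨y, hOV ?_, rfl⟩
        rcases hQ (f y) with h | h
        · exact h (by rw [Metric.mem_ball, dist_comm]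
                      exact (hg₁ y).trans_le (min_le_right _ _))
        · exact (disjoint_left.1 h (Metric.mem_ball_self (hκ.pos _)) hy).elim
    refine Disjoint.mono_right (closure_mono this) ?_
    rw [closure_union]
    refine disjoint_union_right.2 ⟨hηA _ ?_, hA₂⟩
    rintro _ ⟨y, hy, rfl⟩
    exact ⟨g₁ y, subset_closure ⟨y, hy, rfl⟩, (hg₂ y).trans_le (min_le_right _ _)⟩

variable {E : Type*} [NormedAddCommGroup E] [NormedSpace ℝ E]

theorem AvoidsOver.of_discreteFamily (R : ConvexRetract X E) {ι : Type*} {O : ι → Set X}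
    (hO : ∀ i, IsOpen (O i)) (hd : DiscreteFamily O) (h : ∀ i, AvoidsOver Y A (O i)) {F : Set X}
    (hF : IsClosed F) (hFO : F ⊆ ⋃ i, O i) : AvoidsOver Y A F := fun f δ hδ => by
  classical
  obtain ⟨δ', hδ', -, hR⟩ := R.exists_control hδ
  obtain ⟨η, hη, hV⟩ := exists_control_locallyFinite hd.locallyFinite
  choose g hg hgA using fun i => h i f _ (hδ'.min hη)
  obtain ⟨s, hs0, hs1, hs⟩ := exists_continuous_zero_one_of_isClosed
    (isOpen_iUnion hO).isClosed_compl hF (disjoint_left.2 fun x hx hx' => hx (hFO hx'))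
  let e : Y → E := fun y => if h : ∃ i, f y ∈ O i then
    R.emb (f y) + s (f y) • (R.emb (g h.choose y) - R.emb (f y)) else R.emb (f y)
  have huniq : ∀ x i j, x ∈ O i → x ∈ O j → i = j := fun x i j hi hj => by
    obtain ⟨N, hN, hsub⟩ := hd x
    exact hsub ⟨x, hi, mem_of_mem_nhds hN⟩ ⟨x, hj, mem_of_mem_nhds hN⟩
  have hei : ∀ y i, f y ∈ O i →
      e y = R.emb (f y) + s (f y) • (R.emb (g i y) - R.emb (f y)) := fun y i hi => by
    have hex : ∃ i, f y ∈ O i := ⟨i, hi⟩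
    simp only [e]
    rw [dif_pos hex, huniq _ _ _ hex.choose_spec hi]
  have he0 : ∀ y, (∀ i, f y ∉ O i) → e y = R.emb (f y) := fun y hy =>
    dif_neg fun ⟨i, hi⟩ => hy i hi
  have hfc := f.continuous
  have hec : Continuous e := by
    rw [continuous_iff_continuousAt]
    intro y₀
    obtain ⟨N, hN, hsub⟩ := hd (f y₀)
    have hN' : ∀ᶠ y in 𝓝 y₀, f y ∈ N := hfc.continuousAt hN
    by_cases hi : ∃ i, (O i ∩ N).Nonempty
    · obtain ⟨i, hi⟩ := hi
      have : Continuous fun y => R.emb (f y) + s (f y) • (R.emb (g i y) - R.emb (f y)) := by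
        have := R.continuous_emb
        fun_prop
      refine this.continuousAt.congr (hN'.mono fun y hy => ?_)
      by_cases hyi : f y ∈ O i
      · exact (hei y i hyi).symm
      · have hno : ∀ j, f y ∉ O j := fun j hj => hyi (hsub ⟨_, hj, hy⟩ hi ▸ hj)
        have hsy : s (f y) = 0 := hs0 (x := f y) (by simpa using hno)
        rw [he0 y hno]
        simp [hsy]
    · refine (R.continuous_emb.comp hfc).continuousAt.congr (hN'.mono fun y hy => ?_)
      exact (he0 y fun i hyi => hi ⟨i, _, hyi, hy⟩).symm
  have hd : ∀ y, e y ∈ R.C ∧ dist (e y) (R.emb (f y)) < δ' (f y) := fun y => by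
    by_cases hy : ∃ i, f y ∈ O i
    · obtain ⟨i, hi⟩ := hy
      rw [hei y i hi]
      refine ⟨R.add_smul_sub_mem (R.emb_mem_C _) (R.emb_mem_C _) (hs _).1 (hs _).2,
        (ConvexRetract.dist_add_smul_sub_le _ _ (hs _).1 (hs _).2).trans_lt ?_⟩
      rw [R.isometry_emb.dist_eq]
      exact (hg i y).trans_le (min_le_left _ _)
    · rw [he0 y (not_exists.1 hy), dist_self]
      exact ⟨R.emb_mem_C _, hδ'.pos _⟩
  refine ⟨⟨fun y => R.r (e y), R.continuous_r_comp hec fun y => (hR _ _ (hd y).1 (hd y).2).1⟩,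
    fun y => ?_, (disjoint_closure_iUnion (hV (fun i => g i '' (f ⁻¹' O i)) ?_) hgA).mono_right
      (closure_mono ?_)⟩
  · rw [dist_comm]; exact (hR _ _ (hd y).1 (hd y).2).2
  · rintro i _ ⟨y, hy, rfl⟩
    exact ⟨f y, hy, (hg i y).trans_le (min_le_right _ _)⟩
  · rintro _ ⟨y, hy, rfl⟩
    obtain ⟨i, hi⟩ := mem_iUnion.1 (hFO hy)
    refine mem_iUnion.2 ⟨i, y, hi, ?_⟩
    simp only [ContinuousMap.coe_mk]
    rw [hei y i hi, hs1 hy]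
    simp [R.r_emb]

theorem avoidsOver_of_subset_iUnion_lt (hA : IsClosed A) {G : ℕ → Set X} (hG : ∀ k, IsOpen (G k))
    (h : ∀ k, AvoidsOver Y A (G k)) (n : ℕ) :
    ∀ H : Set X, IsClosed H → H ⊆ ⋃ k < n, G k → AvoidsOver Y A H := by
  induction n with
  | zero =>
    intro H _ hH
    have : H = ∅ := by simpa using hH
    rw [this]
    exact avoidsOver_of_disjoint (by simp)
  | succ n ih =>
    intro H hHc hH
    have hP : IsOpen (⋃ k < n, G k) := isOpen_biUnion fun k _ => hG k
    obtain ⟨O, hO, h1, h2⟩ := normal_exists_closure_subset (hHc.sdiff (hG n)) hP (fun x hx => by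
      obtain ⟨k, hk, hxk⟩ := mem_iUnion₂.1 (hH hx.1)
      rcases Nat.lt_succ_iff_lt_or_eq.1 hk with hk' | rfl
      · exact mem_iUnion₂.2 ⟨k, hk', hxk⟩
      · exact (hx.2 hxk).elim)
    refine ((ih (H ∩ closure O) (hHc.inter isClosed_closure) fun x hx => h2 hx.2).union hA (h n)
      (hHc.sdiff hO) (hG n) (fun x hx => ?_) subset_rfl).mono fun x hx => ?_
    · by_contra hxn
      exact hx.2 (h1 ⟨hx.1, hxn⟩)
    · by_cases hxO : x ∈ O
      · exact Or.inl ⟨hx, subset_closure hxO⟩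
      · exact Or.inr ⟨hx, hxO⟩

theorem exists_continuous_index {Z : Type*} [TopologicalSpace Z] [NormalSpace Z]
    [ParacompactSpace Z] {N : Z → ℕ} (hN : ∀ z, ∀ᶠ z' in 𝓝 z, N z' ≤ N z) :
    ∃ φ : C(Z, ℝ), ∀ z, (N z : ℝ) ≤ φ z :=
  exists_continuous_forall_mem_convex_of_local_const (t := fun z => Ici (N z : ℝ))
    (fun _ => convex_Ici _) fun z => ⟨N z, (hN z).mono fun z' h => by
      simpa using h⟩

/-- A countable open cover by sets over which maps can be pushed off `A` suffices: the space is
divided into the shells `φ⁻¹ [n, n + 1]`, each of which lies in a finite union of the given sets,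
and the shells with even (odd) `n` form a discrete family. -/
theorem avoidsOver_univ_of_countable (R : ConvexRetract X E) (hA : IsClosed A) {G : ℕ → Set X}
    (hG : ∀ k, IsOpen (G k)) (hcov : ⋃ k, G k = univ) (h : ∀ k, AvoidsOver Y A (G k)) :
    AvoidsOver Y A univ := by
  classical
  have hex : ∀ x, ∃ k, x ∈ G k := fun x => mem_iUnion.1 (hcov ▸ mem_univ x)
  obtain ⟨φ, hφ⟩ := exists_continuous_index (N := fun x => Nat.find (hex x)) (fun x => by
    filter_upwards [(hG _).mem_nhds (Nat.find_spec (hex x))] with y hy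
    exact Nat.find_min' _ hy)
  have hφc := φ.continuous
  have hφ0 : ∀ x, 0 ≤ φ x := fun x => (Nat.cast_nonneg _).trans (hφ x)
  have hle : ∀ (n : ℕ) x, φ x < n → x ∈ ⋃ k < n, G k := fun n x hx =>
    mem_iUnion₂.2 ⟨_, by exact_mod_cast (hφ x).trans_lt hx, Nat.find_spec (hex x)⟩
  -- the slightly enlarged shells of a given parity `c`
  have key : ∀ c : ℕ, c ≤ 1 → AvoidsOver Y A
      (⋃ n : ℕ, φ ⁻¹' Icc (2 * n + c - 1 / 8 : ℝ) (2 * n + c + 9 / 8)) := by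
    intro c hc
    have hdisc : DiscreteFamily fun n : ℕ => φ ⁻¹' Ioo (2 * n + c - 1 / 4 : ℝ) (2 * n + c + 5 / 4) := by
      intro x
      refine ⟨_, hφc.continuousAt (Metric.ball_mem_nhds (φ x) (by norm_num : (0:ℝ) < 1 / 8)), ?_⟩
      rintro m ⟨y, hy, hy'⟩ n ⟨z, hz, hz'⟩
      simp only [mem_preimage, Metric.mem_ball, Real.dist_eq, abs_lt, mem_Ioo] at hy hy' hz hz'
      have h1 : (m : ℝ) < n + 1 := by linarith
      have h2 : (n : ℝ) < m + 1 := by linarith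
      norm_cast at h1 h2
      omega
    refine AvoidsOver.of_discreteFamily R (fun n => isOpen_Ioo.preimage hφc) hdisc (fun n => ?_)
      (LocallyFinite.isClosed_iUnion (hdisc.locallyFinite.subset fun n => preimage_mono ?_)
        fun n => isClosed_Icc.preimage hφc) (iUnion_mono fun n => preimage_mono ?_)
    · refine (avoidsOver_of_subset_iUnion_lt hA hG h (2 * n + c + 2) (φ ⁻¹' Iic (2 * n + c + 5 / 4))
        (isClosed_Iic.preimage hφc) fun x hx => hle _ x ?_).mono
        (preimage_mono fun t ht => ht.2.le)
      push_cast
      simp only [mem_preimage, mem_Iic] at hx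
      linarith
    all_goals
      intro t ht
      exact ⟨by linarith [ht.1], by linarith [ht.2]⟩
  have hclosed : IsClosed (⋃ n : ℕ, φ ⁻¹' Icc (2 * n + 1 : ℝ) (2 * n + 2)) := by
    refine LocallyFinite.isClosed_iUnion (fun x => ?_) fun n => isClosed_Icc.preimage hφc
    refine ⟨_, hφc.continuousAt (Metric.ball_mem_nhds (φ x) (by norm_num : (0:ℝ) < 1 / 8)),
      Set.Subsingleton.finite ?_⟩
    rintro m ⟨y, hy, hy'⟩ n ⟨z, hz, hz'⟩
    simp only [mem_preimage, Metric.mem_ball, Real.dist_eq, abs_lt, mem_Icc] at hy hy' hz hz'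
    have h1 : (m : ℝ) < n + 1 := by linarith
    have h2 : (n : ℝ) < m + 1 := by linarith
    norm_cast at h1 h2
    omega
  refine ((key 0 zero_le_one).union hA (key 1 le_rfl) hclosed
    (isOpen_iUnion fun n : ℕ => (isOpen_Ioo (a := (2 * n + 1 - 1 / 8 : ℝ)) (b := 2 * n + 1 + 9 / 8)).preimage hφc)
    (iUnion_mono fun n => preimage_mono fun t ht => ⟨by linarith [ht.1], by linarith [ht.2]⟩)
    (iUnion_mono fun n => preimage_mono fun t ht => by
      simp only [Nat.cast_one]
      exact ⟨ht.1.le, ht.2.le⟩)).mono fun x _ => ?_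
  have h1 := Nat.floor_le (hφ0 x)
  have h2 := Nat.lt_floor_add_one (φ x)
  obtain ⟨n, hn | hn⟩ := Nat.even_or_odd' ⌊φ x⌋₊
  · refine Or.inl (mem_iUnion.2 ⟨n, ?_⟩)
    rw [hn] at h1 h2
    push_cast at h1 h2
    simp only [mem_preimage, mem_Icc, Nat.cast_zero]
    exact ⟨by linarith, by linarith⟩
  · refine Or.inr (mem_iUnion.2 ⟨n, ?_⟩)
    rw [hn] at h1 h2
    push_cast at h1 h2
    exact ⟨by linarith, by linarith⟩

/-- Pushing maps off `A` is a local problem in the target.  The open cover of `X` by sets over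
which maps can be pushed off `A` has a `σ`-discrete refinement, by Stone's argument. -/
theorem canAvoid_of_locally (R : ConvexRetract X E) (hA : IsClosed A)
    (h : ∀ a ∈ A, ∃ V ∈ 𝓝 a, AvoidsOver Y A V) (f : C(Y, X)) : CanAvoid A f := by
  classical
  have hloc : ∀ x, ∃ V : Set X, IsOpen V ∧ x ∈ V ∧ AvoidsOver Y A V := fun x => by
    by_cases hx : x ∈ A
    · obtain ⟨V, hV, hVA⟩ := h x hx
      exact ⟨interior V, isOpen_interior, mem_interior_iff_mem_nhds.2 hV,
        hVA.mono interior_subset⟩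
    · obtain ⟨V, hV, h1, h2⟩ := normal_exists_closure_subset (isClosed_singleton (x := x))
        hA.isOpen_compl (by simpa using hx)
      exact ⟨V, hV, by simpa using h1, avoidsOver_of_disjoint
        (disjoint_left.2 fun a ha ha' => h2 ha' ha)⟩
  choose V hVo hxV hVA using hloc
  -- the first member of the cover containing a point, for some well-ordering
  have hwf : WellFounded (WellOrderingRel (α := X)) := WellOrderingRel.isWellOrder.wf
  let idx : X → X := fun x => hwf.min {t | x ∈ V t} ⟨x, hxV x⟩
  have hidx : ∀ x, x ∈ V (idx x) := fun x => hwf.min_mem {t | x ∈ V t} ⟨x, hxV x⟩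
  have hidx' : ∀ x t, x ∈ V t → ¬ WellOrderingRel t (idx x) := fun x t ht =>
    hwf.not_lt_min {t | x ∈ V t} ht
  set η : ℕ → ℝ := fun k => 1 / (k + 1)
  have hη : ∀ k, 0 < η k := fun k => Nat.one_div_pos_of_nat
  let P : ℕ → X → Set X := fun k t => {x | idx x = t ∧ Metric.ball x (η k) ⊆ V t}
  have hsep : ∀ k t u x y, x ∈ P k t → y ∈ P k u → dist x y < η k → t = u := by
    intro k t u x y hx hy hd
    rcases trichotomous_of WellOrderingRel t u with hlt | heq | hlt
    · exact (hidx' y t (hx.2 (by rwa [Metric.mem_ball, dist_comm])) (hy.1 ▸ hlt)).elim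
    · exact heq
    · exact (hidx' x u (hy.2 (by rwa [Metric.mem_ball])) (hx.1 ▸ hlt)).elim
  have hdisc : ∀ k, DiscreteFamily fun t => Metric.thickening (η k / 3) (P k t) := by
    intro k x
    refine ⟨_, Metric.ball_mem_nhds x (by linarith [hη k] : 0 < η k / 6), ?_⟩
    rintro t ⟨y, hy, hyx⟩ u ⟨z, hz, hzx⟩
    obtain ⟨y', hy', hyy⟩ := Metric.mem_thickening_iff.1 hy
    obtain ⟨z', hz', hzz⟩ := Metric.mem_thickening_iff.1 hz
    rw [Metric.mem_ball] at hyx hzx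
    refine hsep k t u y' z' hy' hz' ?_
    have h1 := dist_triangle4 y' y z z'
    have h2 := dist_triangle_right y z x
    rw [dist_comm y' y] at h1
    linarith
  refine fun δ hδ => ?_
  have := avoidsOver_univ_of_countable (Y := Y) R hA
    (G := fun k => Metric.thickening (η k / 4) (⋃ t, P k t))
    (fun k => Metric.isOpen_thickening) (eq_univ_of_forall fun x => ?_) (fun k => ?_) f δ hδ
  · obtain ⟨g, hg, hgA⟩ := this
    exact ⟨g, hg, by rwa [preimage_univ, image_univ] at hgA⟩
  · obtain ⟨ρ, hρ, hb⟩ := Metric.isOpen_iff.1 (hVo (idx x)) x (hidx x)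
    obtain ⟨k, hk⟩ := exists_nat_one_div_lt hρ
    exact mem_iUnion.2 ⟨k, Metric.self_subset_thickening (by linarith [hη k]) _
      (mem_iUnion.2 ⟨idx x, rfl, (Metric.ball_subset_ball hk.le).trans hb⟩)⟩
  · refine (AvoidsOver.of_discreteFamily R (fun t => Metric.isOpen_thickening) (hdisc k)
      (fun t => (hVA t).mono ?_) (F := Metric.cthickening (η k / 4) (⋃ t, P k t))
      Metric.isClosed_cthickening ?_).mono (Metric.thickening_subset_cthickening _ _)
    · intro x hx
      obtain ⟨y, hy, hxy⟩ := Metric.mem_thickening_iff.1 hx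
      exact hy.2 (by rw [Metric.mem_ball]; linarith [hη k])
    · rw [← Metric.thickening_iUnion]
      exact Metric.cthickening_subset_thickening' (by linarith [hη k]) (by linarith [hη k]) _

end Locality

end StrongZ

namespace StrongZ

/-! ### Local character of strong `Z`-sets, and the locally compact case -/

section Local

variable {X : Type*} [MetricSpace X] {E : Type*} [NormedAddCommGroup E] [NormedSpace ℝ E]
  {A : Set X}

theorem canAvoid_of_restrict_closedBall {Y : Type*} [TopologicalSpace Y] (R : ConvexRetract X E)
    (hA : IsClosed A) (h : ∀ a ∈ A, ∃ ρ > 0, ∀ f : C(Y, X),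
      CanAvoid A (f.restrict (f ⁻¹' Metric.closedBall a ρ))) (f : C(Y, X)) : CanAvoid A f :=
  canAvoid_of_locally R hA (fun a ha => by
    obtain ⟨ρ, hρ, hf⟩ := h a ha
    exact ⟨_, Metric.closedBall_mem_nhds a (half_pos hρ),
      fun f δ hδ => R.exists_extension f a hρ (hf f) hδ⟩) f

/-- The inclusion of a subset. -/
def inclusion (F : Set X) : C(F, X) := ⟨Subtype.val, continuous_subtype_val⟩

theorem isStrongZSet_of_inclusion (R : ConvexRetract X E) (hA : IsClosed A)
    (h : ∀ a ∈ A, ∃ ρ > 0, CanAvoid A (inclusion (Metric.closedBall a ρ))) : IsStrongZSet A := by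
  refine isStrongZSet_iff.2 ⟨hA, canAvoid_of_restrict_closedBall R hA (fun a ha => ?_) _⟩
  obtain ⟨ρ, hρ, hi⟩ := h a ha
  exact ⟨ρ, hρ, fun f => hi.comp
    (⟨fun y => ⟨f y, y.2⟩, by fun_prop⟩ : C(f ⁻¹' Metric.closedBall a ρ, Metric.closedBall a ρ))⟩

theorem isStrongZSet_of_isEmpty {X : Type*} [TopologicalSpace X] [IsEmpty X] (A : Set X) :
    IsStrongZSet A :=
  ⟨by rw [Set.eq_empty_of_isEmpty A]; exact isClosed_empty, fun _ _ =>
    ⟨ContinuousMap.id X, fun x => isEmptyElim x, Set.eq_empty_of_isEmpty _⟩⟩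

theorem IsStrongZSet.preimage_val (R : ConvexRetract X E) (h : IsStrongZSet A) {U : Set X}
    (hU : IsOpen U) : IsStrongZSet ((↑) ⁻¹' A : Set U) := by
  rcases U.eq_empty_or_nonempty with rfl | hne
  · exact isStrongZSet_of_isEmpty _
  refine isStrongZSet_of_inclusion (R.restrict U hU hne)
    (h.1.preimage continuous_subtype_val) fun x _ => ?_
  obtain ⟨ρ, hρ, hb⟩ := Metric.isOpen_iff.1 hU x x.2
  refine ⟨ρ / 3, by positivity, fun δ hδ => ?_⟩
  -- a control on `X` which does not exceed `δ` on the ball in question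
  obtain ⟨κ, hκ, hQ⟩ := exists_control (X := X)
    (Q := fun y r => ∀ u : U, dist u x ≤ ρ / 3 → dist y u < r → r ≤ δ u)
    (fun y => by
      by_cases hy : y ∈ U
      · refine ⟨δ ⟨y, hy⟩ / 2, half_pos (hδ.pos _), fun u _ hu => ?_⟩
        have h1 := hδ.le_add ⟨y, hy⟩ u
        have h2 : dist (⟨y, hy⟩ : U) u = dist y u := rfl
        linarith
      · refine ⟨ρ / 3, by positivity, fun u hu hyu => (hy (hb ?_)).elim⟩
        have := dist_triangle y u x
        have h2 : dist (u : X) x = dist u x := rfl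
        rw [Metric.mem_ball]
        linarith)
    (fun y y' r r' hr hle _ u hu hyu => by
      have h1 := dist_triangle y y' u
      have h2 := hr u hu (by linarith)
      linarith [dist_nonneg (x := y) (y := y')])
  obtain ⟨g, hg, hgA⟩ := (isStrongZSet_iff.1 h).2 _
    (hκ.min (IsControl.const (by positivity : 0 < ρ / 3)))
  have hgU : ∀ y : Metric.closedBall x (ρ / 3), g y.1 ∈ U := fun y => hb <| by
    have h1 := (hg y.1.1).trans_le (min_le_right _ _)
    have h2 : dist y.1.1 x.1 ≤ ρ / 3 := y.2
    have h3 := dist_triangle_left (g y.1.1) x.1 y.1.1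
    simp only [ContinuousMap.id_apply] at h1
    rw [Metric.mem_ball]
    linarith
  refine ⟨⟨fun y => ⟨g y.1, hgU y⟩, by fun_prop⟩, fun y => ?_, disjoint_left.2 fun a ha hcl => ?_⟩
  · exact ((hg y.1.1).trans_le (min_le_left _ _)).trans_le
      (hQ y.1.1 y.1 y.2 (by rw [dist_self]; exact hκ.pos _))
  · refine disjoint_left.1 hgA ha (closure_mono ?_
      (image_closure_subset_closure_image continuous_subtype_val (mem_image_of_mem _ hcl)))
    rintro _ ⟨_, ⟨y, rfl⟩, rfl⟩
    exact ⟨y.1.1, rfl⟩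

theorem isStrongZSet_of_locally (R : ConvexRetract X E) (hA : IsClosed A)
    (h : ∀ a ∈ A, ∃ U : Set X, IsOpen U ∧ a ∈ U ∧ IsStrongZSet ((↑) ⁻¹' A : Set U)) :
    IsStrongZSet A := by
  refine isStrongZSet_of_inclusion R hA fun a ha => ?_
  obtain ⟨U, hU, haU, hs⟩ := h a ha
  obtain ⟨ρ, hρ, hb⟩ := Metric.isOpen_iff.1 hU a haU
  have hFU : Metric.closedBall a (ρ / 3) ⊆ U :=
    (Metric.closedBall_subset_ball (by linarith)).trans hb
  refine ⟨ρ / 3, by positivity, fun δ hδ => ?_⟩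
  have hδU : IsControl fun u : U => min (δ u) (ρ / 3) :=
    ⟨fun u => lt_min (hδ.pos _) (by positivity),
      fun u v => (hδ.min (IsControl.const (by positivity : 0 < ρ / 3))).le_add u v⟩
  obtain ⟨g, hg, hgA⟩ := (isStrongZSet_iff.1 hs).2 _ hδU
  have hg' : ∀ u : U, dist (u : X) (g u) < min (δ u) (ρ / 3) := fun u => hg u
  refine ⟨⟨fun y => g ⟨y, hFU y.2⟩, by fun_prop⟩,
    fun y => (hg' ⟨y, hFU y.2⟩).trans_le (min_le_left _ _), disjoint_left.2 fun z hz hcl => ?_⟩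
  have hzU : z ∈ U := hb <| by
    have : z ∈ Metric.closedBall a (2 * ρ / 3) := by
      refine closure_minimal ?_ Metric.isClosed_closedBall hcl
      rintro _ ⟨y, rfl⟩
      have h1 := (hg' ⟨y, hFU y.2⟩).trans_le (min_le_right _ _)
      have h2 : dist y.1 a ≤ ρ / 3 := y.2
      have h3 := dist_triangle_left (g ⟨y, hFU y.2⟩ : X) a y.1
      simp only [ContinuousMap.coe_mk, Metric.mem_closedBall]
      linarith
    exact Metric.closedBall_subset_ball (by linarith) this
  refine disjoint_left.1 hgA (show (⟨z, hzU⟩ : U) ∈ ((↑) ⁻¹' A : Set U) from hz) ?_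
  rw [Topology.IsInducing.subtypeVal.closure_eq_preimage_closure_image]
  refine closure_mono ?_ hcl
  rintro _ ⟨y, rfl⟩
  exact ⟨_, ⟨⟨y, hFU y.2⟩, rfl⟩, rfl⟩

end Local

section ConeAverage

variable {E : Type*} [NormedAddCommGroup E] [NormedSpace ℝ E] {ι : Type*} [Fintype ι]

/-- A convex combination of `v₀` and the points `v j`: the total weight of `w` is completed to `1`
by giving weight to `v₀` if it is smaller than `1`, and normalized to `1` if it is larger. -/
noncomputable def coneAverage (v : ι → E) (v₀ : E) (w : ι → unitInterval) : E :=
  (max 1 (∑ j, (w j : ℝ)))⁻¹ • (∑ j, (w j : ℝ) • v j + max (1 - ∑ j, (w j : ℝ)) 0 • v₀)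

theorem continuous_coneAverage (v : ι → E) (v₀ : E) : Continuous (coneAverage v v₀) := by
  unfold coneAverage
  refine Continuous.smul (Continuous.inv₀ (by fun_prop) fun w => ?_) (by fun_prop)
  exact (zero_lt_one.trans_le (le_max_left _ _)).ne'

theorem coneAverage_of_sum_eq_one (v : ι → E) (v₀ : E) {w : ι → unitInterval}
    (hw : ∑ j, (w j : ℝ) = 1) : coneAverage v v₀ w = ∑ j, (w j : ℝ) • v j := by
  simp [coneAverage, hw]

theorem coneAverage_mem {v : ι → E} {v₀ : E} {s : Set E} (hs : Convex ℝ s) (hv : ∀ j, v j ∈ s)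
    (hv₀ : v₀ ∈ s) (w : ι → unitInterval) : coneAverage v v₀ w ∈ s := by
  set σ := ∑ j, (w j : ℝ)
  have hm : 0 < max 1 σ := zero_lt_one.trans_le (le_max_left _ _)
  have : coneAverage v v₀ w = ∑ j : Option ι, ((max 1 σ)⁻¹ *
      (j.elim (max (1 - σ) 0) fun j => (w j : ℝ))) • (j.elim v₀ v) := by
    rw [Fintype.sum_option]
    simp only [Option.elim, coneAverage, smul_add, Finset.smul_sum]
    rw [add_comm]
    simp [σ, mul_smul]
  rw [this]
  have hsum : ∑ j : Option ι, (j.elim (max (1 - σ) 0) fun j => (w j : ℝ)) = max 1 σ := by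
    rw [Fintype.sum_option]
    simp only [Option.elim]
    rcases le_total σ 1 with h | h
    · rw [max_eq_left (by linarith), max_eq_left h]; ring
    · rw [max_eq_right (by linarith), max_eq_right h]; ring
  refine hs.sum_mem (fun j _ => mul_nonneg (inv_nonneg.2 hm.le) ?_) ?_ fun j _ => ?_
  · cases j with
    | none => exact le_max_right _ _
    | some j => exact (w j).2.1
  · rw [← Finset.mul_sum, hsum, inv_mul_cancel₀ hm.ne']
  · cases j with
    | none => exact hv₀
    | some j => exact hv j

end ConeAverage

section LocallyCompact

variable {X : Type*} [MetricSpace X] {E : Type*} [NormedAddCommGroup E] [NormedSpace ℝ E]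

theorem ConvexRetract.convex_ball (R : ConvexRetract X E) (e : E) (ρ : ℝ) :
    Convex ℝ (R.C ∩ Metric.ball e ρ) := R.convex_C.inter (_root_.convex_ball e ρ)

theorem ConvexRetract.convex_closedBall (R : ConvexRetract X E) (e : E) (ρ : ℝ) :
    Convex ℝ (R.C ∩ Metric.closedBall e ρ) := R.convex_C.inter (_root_.convex_closedBall e ρ)

theorem IsZSet.canAvoid_finite_cube {A : Set X} (h : IsZSet A) {ι : Type*} [Finite ι]
    (f : C(ι → unitInterval, X)) : CanAvoid A f := by
  classical
  obtain ⟨m, ⟨e⟩⟩ := Finite.exists_equiv_fin ι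
  refine h.canAvoid ⟨fun z n => if hn : n < m then z (e.symm ⟨n, hn⟩) else 0, ?_⟩
    ⟨fun q j => q (e j), by fun_prop⟩ (fun z => ?_) f
  · refine continuous_pi fun n => ?_
    by_cases hn : n < m
    · simpa [hn] using continuous_apply _
    · simpa [hn] using continuous_const
  · funext j
    simp

/-- Locally compact spaces: small compact subsets are mapped to finite-dimensional cubes by
partitions of unity, and the cubes are mapped back to `X` by averaging. -/
theorem IsZSet.isStrongZSet [LocallyCompactSpace X] (R : ConvexRetract X E) {A : Set X}
    (h : IsZSet A) : IsStrongZSet A := by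
  classical
  refine isStrongZSet_of_inclusion R h.1 fun a _ => ?_
  obtain ⟨R₀, hR₀, -, hR⟩ := R.exists_radius a one_pos
  obtain ⟨K, hK, haK⟩ := exists_compact_mem_nhds a
  obtain ⟨ρ, hρ, hρK⟩ := Metric.nhds_basis_closedBall.mem_iff.1 haK
  set F := Metric.closedBall a (min ρ R₀)
  have hF : IsCompact F := hK.of_isClosed_subset Metric.isClosed_closedBall
    ((Metric.closedBall_subset_closedBall (min_le_left _ _)).trans hρK)
  have := isCompact_iff_compactSpace.1 hF
  refine ⟨min ρ R₀, lt_min hρ hR₀, fun δ hδ => ?_⟩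
  obtain ⟨δ', hδ', -, hrc⟩ := R.exists_control (hδ.div (c := 4) (by norm_num))
  obtain ⟨t, ht⟩ := isCompact_univ.elim_nhds_subcover
    (fun x : F => Metric.ball x (δ' x / 2)) fun x _ => Metric.ball_mem_nhds x (half_pos (hδ'.pos x))
  obtain ⟨l, hl⟩ := PartitionOfUnity.exists_isSubordinate (s := (univ : Set F)) isClosed_univ
    (fun x : t => Metric.ball x.1 (δ' x.1 / 2)) (fun _ => Metric.isOpen_ball) (fun x _ => by
      obtain ⟨y, hy, hxy⟩ := mem_iUnion₂.1 (ht.2 (mem_univ x))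
      exact mem_iUnion.2 ⟨⟨y, hy⟩, hxy⟩)
  let p : C(F, t → unitInterval) := ⟨fun x j => ⟨l j x, l.nonneg j x, l.le_one j x⟩, by fun_prop⟩
  let avg : (t → unitInterval) → E := coneAverage (fun j : t => R.emb j.1) (R.emb a)
  have havg : ∀ w, avg w ∈ R.C ∩ Metric.closedBall (R.emb a) R₀ := fun w =>
    coneAverage_mem (R.convex_closedBall _ _) (fun j => ⟨R.emb_mem_C _, by
      rw [Metric.mem_closedBall, R.isometry_emb.dist_eq]
      exact j.1.2.trans (min_le_right _ _)⟩) ⟨R.emb_mem_C _, by simpa using hR₀.le⟩ w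
  let q : C(t → unitInterval, X) := ⟨fun w => R.r (avg w), R.continuous_r_comp
    (continuous_coneAverage _ _) fun w => (hR _ (havg w).1 (havg w).2).1⟩
  obtain ⟨g, hg, hgA⟩ := (h.canAvoid_finite_cube q).comp p _ (hδ.div (c := 4) (by norm_num))
  refine ⟨g, fun x => ?_, hgA⟩
  have h1 : avg (p x) ∈ R.C ∩ Metric.ball (R.emb x) (δ' x) := by
    have hsum : ∑ j, ((p x j : unitInterval) : ℝ) = 1 := by
      rw [← l.sum_eq_one (mem_univ x), finsum_eq_sum_of_fintype]
      rfl
    simp only [avg]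
    rw [coneAverage_of_sum_eq_one _ _ hsum, ← finsum_eq_sum_of_fintype]
    refine (R.convex_ball _ _).finsum_mem (fun j => l.nonneg j x)
      (by rw [finsum_eq_sum_of_fintype]; exact hsum) fun j hj => ⟨R.emb_mem_C _, ?_⟩
    have h2 : dist x j.1 < δ' j.1 / 2 := hl j (subset_tsupport _ hj)
    have h3 := hδ'.le_add j.1 x
    rw [Metric.mem_ball, R.isometry_emb.dist_eq]
    have h4 : dist (j.1 : X) x = dist x j.1 := dist_comm (j.1 : X) x
    linarith [hδ'.pos j.1]
  have h2 := (hrc x _ h1.1 h1.2).2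
  have h3 : dist (q (p x)) (g x) < δ (q (p x)) / 4 := hg x
  have h4 := hδ.le_add (q (p x)) x
  have h5 := dist_triangle_left x.1 (g x) (q (p x))
  change dist (q (p x)) x < δ x / 4 at h2
  change dist x.1 (g x) < δ x
  linarith [hδ.pos x]

end LocallyCompact

end StrongZ

namespace StrongZ

/-! ### Realizations of simplicial complexes -/

section Realization

variable {T : Type u}

/-- The Hilbert space `ℓ²(T)` which contains the realizations of complexes with vertices in `T`. -/
abbrev Hilb (T : Type u) : Type u := lp (fun _ : T => ℝ) 2

open Classical in
/-- The vertex `t`, as a point of `ℓ²(T)`. -/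
noncomputable def vertex (t : T) : Hilb T := lp.single 2 t (1 : ℝ)

open Classical in
theorem vertex_apply (t s : T) : vertex t s = if s = t then 1 else 0 := by
  rw [vertex, lp.single_apply, Pi.single_apply]

theorem continuous_coord (t : T) : Continuous fun x : Hilb T => x t :=
  (lp.lipschitzWith_one_eval (E := fun _ : T => ℝ) 2 t).continuous

open Classical in
theorem sum_smul_vertex_apply (σ : Finset T) (w : T → ℝ) (s : T) :
    (∑ t ∈ σ, w t • vertex t : Hilb T) s = if s ∈ σ then w s else 0 := by
  rw [lp.coeFn_sum, Finset.sum_apply]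
  simp [lp.coeFn_smul, vertex_apply]

theorem mem_cell_iff {σ : Finset T} {x : Hilb T} :
    x ∈ cell σ ↔ (∀ t, 0 ≤ x t) ∧ (∀ t ∉ σ, x t = 0) ∧ ∑ t ∈ σ, x t = 1 := by
  classical
  constructor
  · have hconv : Convex ℝ {x : Hilb T | (∀ t, 0 ≤ x t) ∧ (∀ t ∉ σ, x t = 0) ∧ ∑ t ∈ σ, x t = 1} := by
      rintro x ⟨h1, h2, h3⟩ y ⟨h1', h2', h3'⟩ a b ha hb hab
      refine ⟨fun t => ?_, fun t ht => ?_, ?_⟩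
      · exact add_nonneg (mul_nonneg ha (h1 t)) (mul_nonneg hb (h1' t))
      · change a * x t + b * y t = 0
        rw [h2 t ht, h2' t ht]; simp
      · change ∑ t ∈ σ, (a * x t + b * y t) = 1
        rw [Finset.sum_add_distrib, ← Finset.mul_sum, ← Finset.mul_sum, h3, h3']
        simpa using hab
    refine fun hx => convexHull_min ?_ hconv hx
    rintro _ ⟨t, ht, rfl⟩
    change vertex t ∈ _
    refine ⟨fun s => ?_, fun s hs => ?_, ?_⟩
    · rw [vertex_apply]; split_ifs <;> norm_num
    · rw [vertex_apply, if_neg]; rintro rfl; exact hs ht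
    · simp only [vertex_apply]
      rw [Finset.sum_ite_eq' σ t, if_pos (by simpa using ht)]
  · rintro ⟨h1, h2, h3⟩
    have hx : x = ∑ t ∈ σ, x t • vertex t := by
      ext s
      rw [sum_smul_vertex_apply]
      split_ifs with h
      · rfl
      · exact h2 s h
    rw [hx]
    exact (convex_convexHull ℝ _).sum_mem (fun t _ => h1 t) h3 fun t ht =>
      subset_convexHull ℝ _ ⟨t, ht, rfl⟩

theorem eq_sum_of_mem_cell {σ : Finset T} {x : Hilb T} (hx : x ∈ cell σ) :
    x = ∑ t ∈ σ, x t • vertex t := by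
  classical
  ext s
  rw [sum_smul_vertex_apply]
  split_ifs with h
  · rfl
  · exact (mem_cell_iff.1 hx).2.1 s h

theorem isCompact_cell (σ : Finset T) : IsCompact (cell σ) :=
  (σ.finite_toSet.image _).isCompact_convexHull ℝ

theorem convex_cell (σ : Finset T) : Convex ℝ (cell σ) := convex_convexHull ℝ _

instance (σ : Finset T) : CompactSpace (cell σ) := isCompact_iff_compactSpace.1 (isCompact_cell σ)

open Classical in
/-- The vertices spanning the smallest cell which contains a given point of the cell `σ`. -/
theorem mem_cell_filter {σ : Finset T} {x : Hilb T} (hx : x ∈ cell σ) :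
    x ∈ cell (σ.filter fun t => x t ≠ 0) ∧ (σ.filter fun t => x t ≠ 0).Nonempty := by
  rw [mem_cell_iff] at hx
  have hsum : ∑ t ∈ σ.filter fun t => x t ≠ 0, x t = 1 := by
    rw [Finset.sum_filter_ne_zero, hx.2.2]
  refine ⟨mem_cell_iff.2 ⟨hx.1, fun t ht => ?_, hsum⟩, ?_⟩
  · by_contra h
    by_cases hσ : t ∈ σ
    · exact ht (Finset.mem_filter.2 ⟨hσ, h⟩)
    · exact h (hx.2.1 t hσ)
  · rw [Finset.nonempty_iff_ne_empty]
    intro h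
    rw [h] at hsum
    simp at hsum

variable {K : PreAbstractSimplicialComplex T}

theorem mem_realization_iff {x : Hilb T} : x ∈ realization K ↔ ∃ σ ∈ K.faces, x ∈ cell σ := by
  simp [realization]

theorem faces_nonempty {σ : Finset T} (hσ : σ ∈ K.faces) : σ.Nonempty :=
  (K.isRelLowerSet_faces hσ).1

theorem mem_faces_of_subset {σ τ : Finset T} (hσ : σ ∈ K.faces) (h : τ ⊆ σ) (hτ : τ.Nonempty) :
    τ ∈ K.faces :=
  (K.isRelLowerSet_faces hσ).2 h hτ

namespace WeakRealization

/-- The underlying point of `ℓ²(T)`. -/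
def val (x : WeakRealization K) : Hilb T := Subtype.val (p := (· ∈ realization K)) x

theorem val_injective : Function.Injective (val : WeakRealization K → Hilb T) :=
  Subtype.val_injective

theorem val_mem (x : WeakRealization K) : x.val ∈ realization K :=
  Subtype.property (p := (· ∈ realization K)) x

/-- The point of the realization with given underlying point. -/
def mk (x : Hilb T) (hx : x ∈ realization K) : WeakRealization K := (⟨x, hx⟩ : realization K)

theorem continuous_iff {Z : Type*} [TopologicalSpace Z] {f : WeakRealization K → Z} :
    Continuous f ↔ ∀ σ : K.faces, Continuous (f ∘ cellInclusion K σ) := by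
  rw [continuous_iSup_dom]
  exact forall_congr' fun σ => continuous_coinduced_dom

theorem continuous_cellInclusion (σ : K.faces) : Continuous (cellInclusion K σ) :=
  continuous_iff.1 continuous_id σ

theorem continuous_val : Continuous (val : WeakRealization K → Hilb T) :=
  continuous_iff.2 fun _ => continuous_subtype_val

/-- A map into the realization is continuous for the weak topology if it is continuous for the
metric topology and locally takes its values in a finite subcomplex. -/
theorem continuous_of_val {Y : Type*} [TopologicalSpace Y] {p : Y → WeakRealization K}
    (hp : Continuous fun y => (p y).val)
    (h : ∀ y₀, ∃ σ : Finset T, ∀ᶠ y in 𝓝 y₀, ∃ τ ∈ K.faces, τ ⊆ σ ∧ (p y).val ∈ cell τ) :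
    Continuous p := by
  rw [continuous_iff_continuousAt]
  intro y₀
  obtain ⟨σ, hσ⟩ := h y₀
  obtain ⟨N, hN, hNo, hyN⟩ := eventually_nhds_iff.1 hσ
  have key : ContinuousOn p N := by
    rw [continuousOn_iff_continuous_domRestrict]
    let ι := {τ : K.faces // τ.1 ⊆ σ}
    have : Finite ι := Finite.of_injective
      (fun τ : ι => (⟨τ.1.1, Finset.mem_powerset.2 τ.2⟩ : σ.powerset)) fun τ τ' h =>
        Subtype.ext (Subtype.ext (Subtype.mk.inj h))
    refine (locallyFinite_of_finite
      (fun τ : ι => {y : N | (p y).val ∈ cell τ.1.1})).continuous ?_ ?_ ?_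
    · refine eq_univ_of_forall fun y => ?_
      obtain ⟨τ, hτ, hτσ, hy⟩ := hN y y.2
      exact mem_iUnion.2 ⟨⟨⟨τ, hτ⟩, hτσ⟩, hy⟩
    · exact fun τ => (isCompact_cell _).isClosed.preimage (hp.comp continuous_subtype_val)
    · intro τ
      rw [continuousOn_iff_continuous_domRestrict]
      have : ({y : N | (p y).val ∈ cell τ.1.1}).domRestrict (N.domRestrict p)
          = cellInclusion K τ.1 ∘ fun y => ⟨(p y.1).val, y.2⟩ := rfl
      rw [this]
      refine (continuous_cellInclusion _).comp (Continuous.subtype_mk ?_ _)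
      exact hp.comp (continuous_subtype_val.comp continuous_subtype_val)
  exact key.continuousAt (hNo.mem_nhds hyN)

end WeakRealization

/-- Locally finite barycentric coordinates define a map into the realization with the weak
topology. -/
theorem exists_map_weakRealization {Y : Type*} [TopologicalSpace Y] (w : T → Y → ℝ)
    (hc : ∀ t, Continuous (w t)) (hlf : LocallyFinite fun t => Function.support (w t))
    (h0 : ∀ t y, 0 ≤ w t y) (h1 : ∀ y, ∑ᶠ t, w t y = 1)
    (hK : ∀ y, ∀ σ : Finset T, (∀ t, t ∈ σ ↔ w t y ≠ 0) → σ ∈ K.faces) :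
    ∃ p : C(Y, WeakRealization K), ∀ y t, (p y).val t = w t y := by
  classical
  let q : Y → Hilb T := fun y => ∑ᶠ t, w t y • vertex t
  have hq : Continuous q := by
    refine continuous_finsum (fun t => (hc t).smul continuous_const) (hlf.subset fun t y hy => ?_)
    simp only [Function.mem_support] at hy ⊢
    exact left_ne_zero_of_smul hy
  have hfin : ∀ y (σ : Finset T), (∀ t, w t y ≠ 0 → t ∈ σ) →
      q y = ∑ t ∈ σ, w t y • vertex t := fun y σ hσ =>
    finsum_eq_sum_of_support_subset _ fun t ht => hσ t (left_ne_zero_of_smul ht)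
  have hpf : ∀ y, {t | w t y ≠ 0}.Finite := fun y => hlf.point_finite y
  have hqc : ∀ y t, q y t = w t y := fun y t => by
    rw [hfin y (hpf y).toFinset (fun t ht => by simpa using ht), sum_smul_vertex_apply]
    by_cases h : w t y = 0 <;> simp [h]
  have hcell : ∀ y, q y ∈ cell (hpf y).toFinset := fun y => by
    refine mem_cell_iff.2 ⟨fun t => hqc y t ▸ h0 t y, fun t ht => ?_, ?_⟩
    · rw [hqc]; simpa using ht
    · simp_rw [hqc]
      rw [← h1 y, finsum_eq_sum_of_support_subset _ (s := (hpf y).toFinset)]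
      intro t ht
      simpa using ht
  have hface : ∀ y, (hpf y).toFinset ∈ K.faces := fun y => hK y _ fun t => by simp
  refine ⟨⟨fun y => .mk (q y) (mem_realization_iff.2 ⟨_, hface y, hcell y⟩),
    WeakRealization.continuous_of_val hq fun y₀ => ?_⟩, hqc⟩
  obtain ⟨N, hN, hNf⟩ := hlf y₀
  refine ⟨hNf.toFinset, Filter.mem_of_superset hN fun y hy => ⟨_, hface y, fun t ht => ?_, hcell y⟩⟩
  exact hNf.mem_toFinset.2 ⟨y, by simpa using ht, hy⟩

section Barycenter

variable {E : Type*} [NormedAddCommGroup E] [NormedSpace ℝ E]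

/-- The affine map on realizations which sends the vertex `t` to `v t`. -/
noncomputable def barycenter (v : T → E) (x : Hilb T) : E := ∑ᶠ t, x t • v t

theorem barycenter_eq_sum (v : T → E) {σ : Finset T} {x : Hilb T} (hx : x ∈ cell σ) :
    barycenter v x = ∑ t ∈ σ, x t • v t :=
  finsum_eq_sum_of_support_subset _ fun t ht => by
    by_contra h
    exact left_ne_zero_of_smul ht ((mem_cell_iff.1 hx).2.1 t h)

theorem continuous_barycenter_weak (v : T → E) :
    Continuous fun x : WeakRealization K => barycenter v x.val := by
  refine WeakRealization.continuous_iff.2 fun σ => ?_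
  have : (fun x : WeakRealization K => barycenter v x.val) ∘ cellInclusion K σ =
      fun x : cell σ.1 => ∑ t ∈ σ.1, x.1 t • v t :=
    funext fun x => barycenter_eq_sum v x.2
  rw [this]
  exact continuous_finsetSum _ fun t _ =>
    ((continuous_coord t).comp continuous_subtype_val).smul continuous_const

theorem finsum_coord {x : Hilb T} (hx : x ∈ realization K) : ∑ᶠ t, x t = 1 := by
  obtain ⟨σ, -, hx⟩ := mem_realization_iff.1 hx
  rw [← (mem_cell_iff.1 hx).2.2]
  exact finsum_eq_sum_of_support_subset _ fun t ht => by
    by_contra h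
    exact ht ((mem_cell_iff.1 hx).2.1 t h)

theorem coord_nonneg {x : Hilb T} (hx : x ∈ realization K) (t : T) : 0 ≤ x t := by
  obtain ⟨σ, -, hx⟩ := mem_realization_iff.1 hx
  exact (mem_cell_iff.1 hx).1 t

theorem barycenter_mem {v : T → E} {x : Hilb T} (hx : x ∈ realization K) {s : Set E}
    (hs : Convex ℝ s) (hv : ∀ t, x t ≠ 0 → v t ∈ s) : barycenter v x ∈ s :=
  hs.finsum_mem (coord_nonneg hx) (finsum_coord hx) hv

end Barycenter

/-- The subcomplex of the faces with at most `k` vertices. -/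
def skeleton (K : PreAbstractSimplicialComplex T) (k : ℕ) : PreAbstractSimplicialComplex T where
  faces := {σ | σ ∈ K.faces ∧ σ.card ≤ k}
  isRelLowerSet_faces := fun _ hσ => ⟨faces_nonempty hσ.1, fun _ h hne =>
    ⟨mem_faces_of_subset hσ.1 h hne, (Finset.card_le_card h).trans hσ.2⟩⟩

theorem realization_skeleton_subset (k : ℕ) : realization (skeleton K k) ⊆ realization K :=
  fun _ hx => by
    obtain ⟨σ, hσ, hx⟩ := mem_realization_iff.1 hx
    exact mem_realization_iff.2 ⟨σ, hσ.1, hx⟩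

/-- The inclusion of a skeleton. -/
def skeletonInclusion (K : PreAbstractSimplicialComplex T) (k : ℕ) :
    C(WeakRealization (skeleton K k), WeakRealization K) :=
  ⟨fun x => .mk x.val (realization_skeleton_subset k x.val_mem),
    WeakRealization.continuous_iff.2 fun σ =>
      (WeakRealization.continuous_cellInclusion (K := K) ⟨σ.1, σ.2.1⟩)⟩

/-- The cell `σ` with `k + 1` vertices is a retract of the cube of dimension `k`. -/
theorem exists_cell_retract {σ : Finset T} {k : ℕ} (hσ : σ.card = k + 1) :
    ∃ (s : C(cell σ, Cube k)) (π : C(Cube k, cell σ)), ∀ x, π (s x) = x := by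
  classical
  let e : Fin (k + 1) ≃ σ := (finCongr hσ.symm).trans σ.equivFin.symm
  let Z : Cube k → ℝ := fun z => max 1 (∑ i, (z i : ℝ))
  have hZ : ∀ z, 0 < Z z := fun z => zero_lt_one.trans_le (le_max_left _ _)
  let c : Cube k → Fin (k + 1) → ℝ := fun z =>
    Fin.cons (1 - ∑ i, (z i : ℝ) / Z z) fun i => (z i : ℝ) / Z z
  let P : Cube k → Hilb T := fun z => ∑ i, c z i • vertex (e i : T)
  have hcc : ∀ i, Continuous fun z => c z i := by
    have hi : ∀ i : Fin k, Continuous fun z : Cube k => (z i : ℝ) / Z z := fun i =>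
      Continuous.div (by fun_prop) (by fun_prop) fun z => (hZ z).ne'
    intro i
    refine Fin.cases ?_ (fun i => ?_) i
    · simp only [c, Fin.cons_zero]
      exact continuous_const.sub (continuous_finsetSum _ fun i _ => hi i)
    · simpa only [c, Fin.cons_succ] using hi i
  have hP : ∀ z, P z ∈ cell σ := fun z => by
    refine (convex_cell σ).sum_mem (fun i _ => ?_) ?_ fun i _ =>
      subset_convexHull ℝ _ ⟨e i, (e i).2, rfl⟩
    · refine Fin.cases ?_ (fun i => ?_) i
      · simp only [c, Fin.cons_zero]
        rw [← Finset.sum_div, sub_nonneg, div_le_one (hZ z)]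
        exact le_max_right _ _
      · simp only [c, Fin.cons_succ]
        exact div_nonneg (z i).2.1 (hZ z).le
    · rw [Fin.sum_univ_succ]
      simp [c]
  have hle : ∀ (x : cell σ) (t : T), x.1 t ≤ 1 := fun x t => by
    obtain ⟨h0, h1, h2⟩ := mem_cell_iff.1 x.2
    by_cases ht : t ∈ σ
    · rw [← h2]
      exact Finset.single_le_sum (f := fun t => x.1 t) (fun t _ => h0 t) ht
    · rw [h1 t ht]; exact zero_le_one
  refine ⟨⟨fun x i => ⟨x.1 (e i.succ), (mem_cell_iff.1 x.2).1 _, hle x _⟩, ?_⟩,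
    ⟨fun z => ⟨P z, hP z⟩, ?_⟩, fun x => Subtype.ext ?_⟩
  · exact continuous_pi fun i => Continuous.subtype_mk
      ((continuous_coord _).comp continuous_subtype_val) _
  · exact Continuous.subtype_mk (continuous_finsetSum _ fun i _ => (hcc i).smul continuous_const) _
  · have hsum : ∑ i, x.1 (e i) = 1 := by
      rw [← (mem_cell_iff.1 x.2).2.2, ← Finset.sum_coe_sort σ fun t => x.1 t]
      exact e.sum_comp fun t : σ => x.1 t
    have hx : x.1 = ∑ i, x.1 (e i) • vertex (e i : T) := by
      conv_lhs => rw [eq_sum_of_mem_cell x.2, ← Finset.sum_coe_sort σ fun t => x.1 t • vertex t]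
      exact (e.sum_comp fun t : σ => x.1 t • vertex (t : T)).symm
    have h0 := (mem_cell_iff.1 x.2).1 (e 0)
    rw [Fin.sum_univ_succ] at hsum
    have hZ1 : Z (fun i => ⟨x.1 (e i.succ), (mem_cell_iff.1 x.2).1 _, hle x _⟩) = 1 :=
      max_eq_left (by simp only; linarith)
    change ∑ i, c (fun i => ⟨x.1 (e i.succ), (mem_cell_iff.1 x.2).1 _, hle x _⟩) i •
      vertex (e i : T) = x.1
    refine Eq.trans (Finset.sum_congr rfl fun i _ => ?_) hx.symm
    congr 1
    refine Fin.cases ?_ (fun i => ?_) i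
    · simp only [c, Fin.cons_zero, hZ1, div_one]
      linarith
    · simp only [c, Fin.cons_succ, hZ1, div_one]

end Realization

end StrongZ

namespace StrongZ

/-! ### Pushing maps of finite-dimensional complexes off `A` -/

section Collar

variable {T : Type u} {K : PreAbstractSimplicialComplex T}

/-- The smallest barycentric coordinate with respect to the vertices in `σ`. -/
noncomputable def minCoord (σ : Finset T) (hσ : σ.Nonempty) (x : Hilb T) : ℝ :=
  σ.inf' hσ fun t => x t

/-- The projection of the cell `σ` from its barycentre onto the boundary. -/
noncomputable def pushOut (σ : Finset T) (hσ : σ.Nonempty) (x : Hilb T) : Hilb T :=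
  (1 - σ.card * minCoord σ hσ x)⁻¹ • (x - minCoord σ hσ x • ∑ t ∈ σ, vertex t)

variable {σ : Finset T} (hσ : σ.Nonempty)

theorem continuous_minCoord : Continuous (minCoord σ hσ) :=
  Continuous.finset_inf'_apply hσ fun t _ => continuous_coord t

theorem minCoord_nonneg {x : Hilb T} (hx : x ∈ cell σ) : 0 ≤ minCoord σ hσ x :=
  Finset.le_inf' hσ _ fun t _ => (mem_cell_iff.1 hx).1 t

theorem pushOut_of_minCoord_eq_zero {x : Hilb T} (h : minCoord σ hσ x = 0) :
    pushOut σ hσ x = x := by simp [pushOut, h]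

open Classical in
theorem pushOut_apply (x : Hilb T) (t : T) : pushOut σ hσ x t =
    (1 - σ.card * minCoord σ hσ x)⁻¹ * (x t - if t ∈ σ then minCoord σ hσ x else 0) := by
  have h := sum_smul_vertex_apply σ (fun _ => minCoord σ hσ x) t
  rw [← Finset.smul_sum] at h
  rw [pushOut, lp.coeFn_smul, Pi.smul_apply, lp.coeFn_sub, Pi.sub_apply, h, smul_eq_mul]

theorem pushOut_mem_cell {x : Hilb T} (hx : x ∈ cell σ) (h : σ.card * minCoord σ hσ x ≤ 1 / 2) :
    pushOut σ hσ x ∈ cell σ := by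
  classical
  have hpos : 0 < 1 - σ.card * minCoord σ hσ x := by linarith
  have hx' := mem_cell_iff.1 hx
  refine mem_cell_iff.2 ⟨fun t => ?_, fun t ht => ?_, ?_⟩
  · rw [pushOut_apply]
    refine mul_nonneg (inv_nonneg.2 hpos.le) ?_
    split_ifs with ht
    · exact sub_nonneg.2 (Finset.inf'_le _ ht)
    · simpa using hx'.1 t
  · rw [pushOut_apply, if_neg ht, hx'.2.1 t ht]; simp
  · simp_rw [pushOut_apply]
    rw [← Finset.mul_sum, Finset.sum_sub_distrib, hx'.2.2, Finset.sum_ite_mem, Finset.inter_self,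
      Finset.sum_const, nsmul_eq_mul, inv_mul_cancel₀ hpos.ne']

theorem exists_pushOut_apply_eq_zero (x : Hilb T) : ∃ t ∈ σ, pushOut σ hσ x t = 0 := by
  classical
  obtain ⟨t, ht, h⟩ := Finset.exists_mem_eq_inf' hσ fun t => x t
  refine ⟨t, ht, ?_⟩
  rw [pushOut_apply, if_pos ht, minCoord, h, sub_self, mul_zero]

theorem exists_skeleton_face {k : ℕ} (hσK : σ ∈ K.faces) (hk : σ.card = k + 1) {x : Hilb T}
    (hx : x ∈ cell σ) (h0 : ∃ t ∈ σ, x t = 0) :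
    ∃ τ ∈ (skeleton K k).faces, τ ⊆ σ ∧ x ∈ cell τ := by
  classical
  obtain ⟨h1, h2⟩ := mem_cell_filter hx
  refine ⟨_, ⟨mem_faces_of_subset hσK (Finset.filter_subset _ _) h2, ?_⟩, Finset.filter_subset _ _,
    h1⟩
  obtain ⟨t, ht, h0⟩ := h0
  have : (σ.filter fun t => x t ≠ 0).card < σ.card :=
    Finset.card_lt_card (Finset.filter_ssubset.2 ⟨t, ht, by simpa using h0⟩)
  omega

theorem minCoord_eq_zero {k : ℕ} (hk : σ.card = k + 1) {x : Hilb T} (hx : x ∈ cell σ)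
    (hx' : x ∈ realization (skeleton K k)) : minCoord σ hσ x = 0 := by
  obtain ⟨τ, hτ, hxτ⟩ := mem_realization_iff.1 hx'
  obtain ⟨t, ht, htτ⟩ : ∃ t ∈ σ, t ∉ τ := by
    by_contra! h
    have h1 := Finset.card_le_card (show σ ⊆ τ from h)
    have h2 := hτ.2
    omega
  refine le_antisymm ?_ (minCoord_nonneg hσ hx)
  rw [← (mem_cell_iff.1 hxτ).2.1 t htτ]
  exact Finset.inf'_le _ ht

variable {X : Type*} [MetricSpace X]

/-- A closed collar `F` of the boundary of the cell `σ` with its projection `p` to the boundary,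
so thin that `h` is hardly changed by the projection where `β ≠ 0`.  The functions `β` and `γ`
vanish off the collar, and `β = 1` where `γ ≠ 0`, and `γ = 1` on the boundary. -/
theorem exists_collar {k : ℕ} (hσK : σ ∈ K.faces) (hk : σ.card = k + 1)
    (h : C(WeakRealization K, X)) {δ : X → ℝ} (hδ : IsControl δ) :
    ∃ (F : Set (cell σ)) (p : C(F, WeakRealization (skeleton K k))) (β γ : C(cell σ, ℝ)),
      IsClosed F ∧ (∀ y, β y ∈ Icc (0 : ℝ) 1) ∧ (∀ y, γ y ∈ Icc (0 : ℝ) 1) ∧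
      (∀ y ∉ F, β y = 0) ∧ (∀ y ∉ F, γ y = 0) ∧ (∀ y, γ y ≠ 0 → β y = 1) ∧
      (∀ y : F, β y ≠ 0 → dist (h (cellInclusion K ⟨σ, hσK⟩ y))
        (h (skeletonInclusion K k (p y))) < δ (h (cellInclusion K ⟨σ, hσK⟩ y))) ∧
      ∀ (y : cell σ) (hy : y.1 ∈ realization (skeleton K k)),
        ∃ hF : y ∈ F, p ⟨y, hF⟩ = .mk y.1 hy ∧ γ y = 1 := by
  classical
  have hσ : σ.Nonempty := faces_nonempty hσK
  let m : C(cell σ, ℝ) := ⟨fun y => minCoord σ hσ y.1,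
    (continuous_minCoord hσ).comp continuous_subtype_val⟩
  have hm0 : ∀ y, 0 ≤ m y := fun y => minCoord_nonneg hσ y.2
  let F : Set (cell σ) := {y | σ.card * m y ≤ 1 / 2}
  have hF : IsClosed F := isClosed_le (by fun_prop) continuous_const
  have hpush : ∀ y : F, ∃ τ ∈ (skeleton K k).faces, τ ⊆ σ ∧ pushOut σ hσ y.1.1 ∈ cell τ := fun y =>
    exists_skeleton_face hσK hk (pushOut_mem_cell hσ y.1.2 y.2) (exists_pushOut_apply_eq_zero hσ _)
  have hpc : Continuous fun y : F => pushOut σ hσ y.1.1 := by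
    have h1 : Continuous fun y : F => minCoord σ hσ y.1.1 :=
      m.continuous.comp continuous_subtype_val
    have h2 : Continuous fun y : F => (y.1.1 : Hilb T) :=
      continuous_subtype_val.comp continuous_subtype_val
    have h3 : Continuous fun y : F => 1 - (σ.card : ℝ) * minCoord σ hσ y.1.1 :=
      continuous_const.sub (continuous_const.mul h1)
    refine (h3.inv₀ fun y => ?_).smul (h2.sub (h1.smul continuous_const))
    have : σ.card * minCoord σ hσ y.1.1 ≤ 1 / 2 := y.2
    linarith
  let p : C(F, WeakRealization (skeleton K k)) :=
    ⟨fun y => .mk (pushOut σ hσ y.1.1) (mem_realization_iff.2 (by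
      obtain ⟨τ, h1, -, h2⟩ := hpush y
      exact ⟨τ, h1, h2⟩)), WeakRealization.continuous_of_val hpc fun _ =>
        ⟨σ, Eventually.of_forall hpush⟩⟩
  have hp0 : ∀ (y : F) (hy : y.1.1 ∈ realization (skeleton K k)), m y = 0 → p y = .mk y.1.1 hy :=
    fun y hy h0 => WeakRealization.val_injective (pushOut_of_minCoord_eq_zero hσ h0)
  let d : C(F, ℝ) := ⟨fun y => δ (h (cellInclusion K ⟨σ, hσK⟩ y)) -
      dist (h (cellInclusion K ⟨σ, hσK⟩ y)) (h (skeletonInclusion K k (p y))), by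
    have h1 := hδ.continuous
    have h2 := WeakRealization.continuous_cellInclusion (K := K) ⟨σ, hσK⟩
    have h3 : Continuous fun y : F => h (cellInclusion K ⟨σ, hσK⟩ y) := by fun_prop
    fun_prop⟩
  have : CompactSpace F := isCompact_iff_compactSpace.1 hF.isCompact
  obtain ⟨μ, hμ, hμ2, hμd⟩ : ∃ μ : ℝ, 0 < μ ∧ (σ.card : ℝ) * (2 * μ) ≤ 1 / 2 ∧
      ∀ y : F, m y < 2 * μ → 0 < d y := by
    have hcard : (0 : ℝ) < σ.card := Nat.cast_pos.2 hσ.card_pos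
    have hD : IsCompact {y : F | d y ≤ 0} :=
      (isClosed_le d.continuous continuous_const).isCompact
    obtain ⟨c, hc, hcm⟩ : ∃ c : ℝ, 0 < c ∧ ∀ y : F, d y ≤ 0 → c ≤ m y := by
      rcases {y : F | d y ≤ 0}.eq_empty_or_nonempty with hE | hE
      · exact ⟨1, one_pos, fun y hy => (hE.subset (show y ∈ {y : F | d y ≤ 0} from hy)).elim⟩
      · obtain ⟨y₀, hy₀, hmin⟩ := hD.exists_isMinOn hE
          (m.continuous.comp continuous_subtype_val).continuousOn
        refine ⟨m y₀, lt_of_le_of_ne (hm0 _) fun h0 => ?_, fun y hy => hmin hy⟩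
        have h1 : d y₀ ≤ 0 := hy₀
        have h2 : h (skeletonInclusion K k (p y₀)) = h (cellInclusion K ⟨σ, hσK⟩ y₀) :=
          congrArg h (WeakRealization.val_injective (pushOut_of_minCoord_eq_zero hσ h0.symm))
        simp only [d, ContinuousMap.coe_mk] at h1
        rw [h2, dist_self, sub_zero] at h1
        exact (hδ.pos _).not_ge h1
    refine ⟨min (c / 2) (1 / (4 * σ.card)), by positivity, ?_, fun y hy => ?_⟩
    · calc (σ.card : ℝ) * (2 * min (c / 2) (1 / (4 * σ.card)))
          ≤ σ.card * (2 * (1 / (4 * σ.card))) := by gcongr; exact min_le_right _ _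
        _ = 1 / 2 := by field_simp; norm_num
    · by_contra! hd
      have h1 := hcm y hd
      have h2 := min_le_left (c / 2) (1 / (4 * (σ.card : ℝ)))
      linarith
  have hnF : ∀ y ∉ F, 2 * μ < m y := fun y hy => by
    have h1 : 1 / 2 < σ.card * m y := not_le.1 hy
    exact lt_of_mul_lt_mul_left (hμ2.trans_lt h1) (Nat.cast_nonneg _)
  refine ⟨F, p, ⟨fun y => clamp (2 - m y / μ), by fun_prop⟩, ⟨fun y => clamp (1 - m y / μ), by fun_prop⟩,
    hF, fun y => ⟨clamp_nonneg _, clamp_le_one _⟩, fun y => ⟨clamp_nonneg _, clamp_le_one _⟩,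
    fun y hy => clamp_of_le ?_, fun y hy => clamp_of_le ?_, fun y hy => clamp_of_ge ?_,
    fun y hy => ?_, fun y hy => ?_⟩
  · have := hnF y hy
    rw [sub_nonpos, le_div_iff₀ hμ]; linarith
  · have := hnF y hy
    rw [sub_nonpos, le_div_iff₀ hμ]; linarith
  · have : 0 < 1 - m y / μ := by
      by_contra! h0
      exact hy (clamp_of_le h0)
    linarith
  · have h1 : 0 < 2 - m y / μ := by
      by_contra! h0
      exact hy (clamp_of_le h0)
    rw [sub_pos, div_lt_iff₀ hμ] at h1
    exact sub_pos.1 (hμd y h1)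
  · have h0 : m y = 0 := minCoord_eq_zero hσ hk y.2 hy
    refine ⟨?_, hp0 ⟨y, _⟩ hy h0, clamp_of_ge (by simp [h0])⟩
    change σ.card * m y ≤ 1 / 2
    rw [h0]; norm_num

end Collar

section Complex

variable {T : Type u} {X : Type v} [MetricSpace X] {E : Type w} [NormedAddCommGroup E]
  [NormedSpace ℝ E] {A : Set X}

/-- A map on the skeleton and compatible maps on the cells with `k + 1` vertices define a map on a
complex whose faces have at most `k + 1` vertices. -/
theorem exists_glue {K : PreAbstractSimplicialComplex T} {k : ℕ}
    (hK : ∀ σ ∈ K.faces, σ.card ≤ k + 1) (g : C(WeakRealization (skeleton K k), X))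
    {P : Set (Finset T)} (hP : ∀ σ, σ ∈ P ↔ σ ∈ K.faces ∧ σ.card = k + 1)
    (G : ∀ σ : P, C(cell (σ : Finset T), X))
    (hG : ∀ (σ : P) (y : cell (σ : Finset T)) (hy : y.1 ∈ realization (skeleton K k)),
      G σ y = g (WeakRealization.mk (K := skeleton K k) y.1 hy)) :
    ∃ f : C(WeakRealization K, X), (∀ x, f (skeletonInclusion K k x) = g x) ∧
      (∀ (σ : P) (y : cell (σ : Finset T)),
        f (cellInclusion K ⟨σ.1, ((hP σ.1).1 σ.2).1⟩ y) = G σ y) ∧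
      ∀ x, (∃ x', x = skeletonInclusion K k x') ∨ ∃ (σ : P) (y : cell (σ : Finset T)),
        x = cellInclusion K ⟨σ.1, ((hP σ.1).1 σ.2).1⟩ y := by
  classical
  have hex : ∀ x : WeakRealization K, x.val ∉ realization (skeleton K k) →
      ∃ σ : P, x.val ∈ cell σ.1 := fun x hx => by
    obtain ⟨σ, hσ, hxσ⟩ := mem_realization_iff.1 x.val_mem
    refine ⟨⟨σ, (hP σ).2 ⟨hσ, (hK σ hσ).antisymm ?_⟩⟩, hxσ⟩
    by_contra! hlt
    exact hx (mem_realization_iff.2 ⟨σ, ⟨hσ, Nat.lt_succ_iff.1 hlt⟩, hxσ⟩)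
  have hsupp : ∀ (x : Hilb T), x ∉ realization (skeleton K k) → ∀ σ : P, x ∈ cell σ.1 →
      ∀ t, t ∈ σ.1 ↔ x t ≠ 0 := fun x hx σ hσ t => by
    refine ⟨fun ht h0 => hx ?_, fun h0 => ?_⟩
    · obtain ⟨τ, hτ, -, hxτ⟩ := exists_skeleton_face ((hP _).1 σ.2).1 ((hP _).1 σ.2).2 hσ ⟨t, ht, h0⟩
      exact mem_realization_iff.2 ⟨τ, hτ, hxτ⟩
    · by_contra ht
      exact h0 ((mem_cell_iff.1 hσ).2.1 t ht)
  let f : WeakRealization K → X := fun x =>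
    if hx : x.val ∈ realization (skeleton K k) then g (.mk x.val hx)
    else G (hex x hx).choose ⟨x.val, (hex x hx).choose_spec⟩
  have hf1 : ∀ x, f (skeletonInclusion K k x) = g x := fun x => dif_pos x.val_mem
  have hf2 : ∀ (σ : P) (y : cell σ.1), f (cellInclusion K ⟨σ.1, ((hP σ.1).1 σ.2).1⟩ y) = G σ y := fun σ y => by
    by_cases hy : y.1 ∈ realization (skeleton K k)
    · rw [hG σ y hy]; exact dif_pos hy
    · have key : ∀ σ' : P, ∀ h' : y.1 ∈ cell σ'.1, G σ' ⟨y.1, h'⟩ = G σ y := fun σ' h' => by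
        have : σ' = σ := Subtype.ext (Finset.ext fun t =>
          (hsupp y.1 hy σ' h' t).trans (hsupp y.1 hy σ y.2 t).symm)
        subst this
        rfl
      exact (dif_neg hy).trans (key _ _)
  refine ⟨⟨f, WeakRealization.continuous_iff.2 fun σ => ?_⟩, hf1, hf2, fun x => ?_⟩
  · rcases (hK σ.1 σ.2).lt_or_eq with h | h
    · have : f ∘ cellInclusion K σ = g ∘ cellInclusion (skeleton K k)
          ⟨σ.1, σ.2, Nat.lt_succ_iff.1 h⟩ := funext fun y => hf1 (cellInclusion (skeleton K k)
          ⟨σ.1, σ.2, Nat.lt_succ_iff.1 h⟩ y)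
      rw [this]
      exact g.continuous.comp (WeakRealization.continuous_cellInclusion _)
    · have : f ∘ cellInclusion K σ = G ⟨σ.1, (hP _).2 ⟨σ.2, h⟩⟩ := funext fun y =>
        hf2 ⟨σ.1, (hP _).2 ⟨σ.2, h⟩⟩ y
      rw [this]
      exact (G _).continuous
  · by_cases hx : x.val ∈ realization (skeleton K k)
    · exact Or.inl ⟨.mk x.val hx, rfl⟩
    · obtain ⟨σ, hσ⟩ := hex x hx
      exact Or.inr ⟨σ, ⟨x.val, hσ⟩, rfl⟩

theorem canAvoid_of_isEmpty {D : Type*} [TopologicalSpace D] [IsEmpty D] (f : C(D, X)) :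
    CanAvoid A f := fun δ _ => ⟨f, fun z => isEmptyElim z, by simp [range_eq_empty]⟩

/-- Maps of complexes whose faces have at most `k` vertices are pushed off `A` skeleton by
skeleton.  In each step, the given map on the cells of the next dimension is first modified in
collars so as to agree there with the map already obtained on the boundaries; it is then
approximated, simultaneously on all these cells, by a map which avoids `A`, and the collars are
used again to interpolate between this map and the map on the boundaries. -/
theorem canAvoid_weakRealization (R : ConvexRetract X E) (hA : IsClosed A) {B : Set X} (k : ℕ)
    (H : ∀ j < k, ∀ (P : Set (Finset T)) (g : P → C(Cube j, X)), (∀ s z, g s z ∈ B) →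
      FamCanAvoid A g) (K : PreAbstractSimplicialComplex T) (hK : ∀ σ ∈ K.faces, σ.card ≤ k)
    (h : C(WeakRealization K, X)) {θ : X → ℝ} (hθ : IsControl θ)
    (hB : ∀ z y, dist (h z) y < θ (h z) → y ∈ B) : CanAvoid A h := by
  induction k generalizing K with
  | zero =>
    have : IsEmpty (WeakRealization K) := ⟨fun x => by
      obtain ⟨σ, hσ, -⟩ := mem_realization_iff.1 x.val_mem
      have := hK σ hσ
      have := (faces_nonempty hσ).card_pos
      omega⟩
    exact canAvoid_of_isEmpty h
  | succ k ih =>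
    intro δ hδ
    obtain ⟨δ₃, hδ₃, hδ₃δ, hR₃⟩ := R.exists_control hδ
    have hδ₂ : IsControl fun x => min (δ₃ x / 4) (θ x) := (hδ₃.div (by norm_num)).min hθ
    obtain ⟨δ₁, hδ₁, hδ₁₂, hR₁⟩ := R.exists_control hδ₂
    have hq : IsControl fun x => δ₁ x / 4 := hδ₁.div (by norm_num)
    obtain ⟨g, hg, hgA⟩ := ih (fun j hj => H j (hj.trans k.lt_succ_self)) (skeleton K k)
      (fun σ hσ => hσ.2) (h.comp (skeletonInclusion K k)) (fun z y => hB _ y) _ hq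
    obtain ⟨η, hη, hηA⟩ := exists_control_avoiding hA isClosed_closure hgA
    obtain ⟨η', hη', hη'η, hR'⟩ := R.exists_control hη
    let P : Set (Finset T) := {σ | σ ∈ K.faces ∧ σ.card = k + 1}
    choose F p β γ hF hβ hγ hβF hγF hβγ hcol hbd using fun σ : P =>
      exists_collar σ.2.1 σ.2.2 h hq
    let hc : ∀ σ : P, C(cell σ.1, X) := fun σ =>
      h.comp ⟨cellInclusion K ⟨σ.1, σ.2.1⟩, WeakRealization.continuous_cellInclusion _⟩
    have hclose : ∀ (σ : P) (y : F σ), β σ y ≠ 0 → dist (hc σ y) (g (p σ y)) < δ₁ (hc σ y) := by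
      intro σ y hy
      have h1 : dist (hc σ y) (h (skeletonInclusion K k (p σ y))) < δ₁ (hc σ y) / 4 := hcol σ y hy
      have h2 : dist (h (skeletonInclusion K k (p σ y))) (g (p σ y)) <
        δ₁ (h (skeletonInclusion K k (p σ y))) / 4 := hg (p σ y)
      have h3 := hδ₁.le_add (h (skeletonInclusion K k (p σ y))) (hc σ y)
      have h4 := dist_triangle (hc σ y) (h (skeletonInclusion K k (p σ y))) (g (p σ y))
      rw [dist_comm _ (hc σ y)] at h3
      linarith [hδ₁.pos (hc σ y)]
    -- the maps on the cells, modified in the collars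
    have hb : ∀ (σ : P) (y : F σ),
        R.emb (hc σ y) + β σ y • (R.emb (g (p σ y)) - R.emb (hc σ y)) ∈ R.S ∧
        dist (R.r (R.emb (hc σ y) + β σ y • (R.emb (g (p σ y)) - R.emb (hc σ y)))) (hc σ y) <
          min (δ₃ (hc σ y) / 4) (θ (hc σ y)) := by
      intro σ y
      refine hR₁ _ _ (R.add_smul_sub_mem (R.emb_mem_C _) (R.emb_mem_C _) (hβ σ y).1 (hβ σ y).2) ?_
      by_cases hy : β σ y = 0
      · rw [hy, zero_smul, add_zero, dist_self]; exact hδ₁.pos _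
      · refine (ConvexRetract.dist_add_smul_sub_le _ _ (hβ σ y).1 (hβ σ y).2).trans_lt ?_
        rw [R.isometry_emb.dist_eq]
        exact hclose σ y hy
    choose g₁ hg₁F hg₁n using fun σ : P =>
      R.exists_blend (hc σ) (hF σ) (g.comp (p σ)) (β σ) (hβF σ) fun y => (hb σ y).1
    have hg₁ : ∀ σ y, dist (hc σ y) (g₁ σ y) < min (δ₃ (hc σ y) / 4) (θ (hc σ y)) := by
      intro σ y
      by_cases hy : y ∈ F σ
      · rw [dist_comm, hg₁F σ ⟨y, hy⟩]; exact (hb σ ⟨y, hy⟩).2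
      · rw [hg₁n σ y hy, dist_self]; exact hδ₂.pos _
    have hg₁' : ∀ (σ : P) (y : F σ), β σ y = 1 → g₁ σ y = g (p σ y) := fun σ y hy => by
      rw [hg₁F σ y, hy, one_smul, add_sub_cancel, R.r_emb]; rfl
    choose s π hsπ using fun σ : P => exists_cell_retract σ.2.2
    obtain ⟨g₂, hg₂, hg₂A⟩ := H k k.lt_succ_self P (fun σ => (g₁ σ).comp (π σ))
      (fun σ z => hB _ _ ((hg₁ σ (π σ z)).trans_le (min_le_right _ _)))
      _ ((hδ₃.div (c := 4) (by norm_num)).min hη')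
    let g₃ : ∀ σ : P, C(cell σ.1, X) := fun σ => (g₂ σ).comp (s σ)
    have hg₃ : ∀ σ y, dist (g₁ σ y) (g₃ σ y) < min (δ₃ (g₁ σ y) / 4) (η' (g₁ σ y)) := fun σ y => by
      have := hg₂ σ (s σ y)
      simp only [ContinuousMap.comp_apply, hsπ] at this
      exact this
    have hg₃c : ∀ σ y, dist (g₃ σ y) (hc σ y) < δ₃ (hc σ y) := fun σ y => by
      have h1 := (hg₁ σ y).trans_le (min_le_left _ _)
      have h2 := (hg₃ σ y).trans_le (min_le_left _ _)
      have h3 := hδ₃.le_add (g₁ σ y) (hc σ y)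
      have h4 := dist_triangle_left (g₃ σ y) (hc σ y) (g₁ σ y)
      rw [dist_comm (g₁ σ y) (hc σ y)] at h3 h4
      linarith [hδ₃.pos (hc σ y)]
    have hpc : ∀ (σ : P) (y : F σ), γ σ y ≠ 0 → dist (g (p σ y)) (hc σ y) < δ₃ (hc σ y) :=
      fun σ y hy => by
        have h1 := hclose σ y (by rw [hβγ σ y hy]; exact one_ne_zero)
        have h2 := (hδ₁₂ (hc σ y)).trans (min_le_left _ _)
        rw [dist_comm]
        linarith [hδ₃.pos (hc σ y)]
    have hb₂ : ∀ (σ : P) (y : F σ),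
        R.emb (g₃ σ y) + γ σ y • (R.emb (g (p σ y)) - R.emb (g₃ σ y)) ∈ R.S ∧
        dist (R.r (R.emb (g₃ σ y) + γ σ y • (R.emb (g (p σ y)) - R.emb (g₃ σ y)))) (hc σ y) <
          δ (hc σ y) := by
      intro σ y
      have h1 : R.emb (g₃ σ y) ∈ R.C ∩ Metric.ball (R.emb (hc σ y)) (δ₃ (hc σ y)) :=
        ⟨R.emb_mem_C _, by rw [Metric.mem_ball, R.isometry_emb.dist_eq]; exact hg₃c σ y⟩
      have h2 : R.emb (g₃ σ y) + γ σ y • (R.emb (g (p σ y)) - R.emb (g₃ σ y)) ∈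
          R.C ∩ Metric.ball (R.emb (hc σ y)) (δ₃ (hc σ y)) := by
        by_cases hy : γ σ y = 0
        · rw [hy, zero_smul, add_zero]; exact h1
        · exact (R.convex_ball _ _).add_smul_sub_mem h1 ⟨R.emb_mem_C _, by
            rw [Metric.mem_ball, R.isometry_emb.dist_eq]; exact hpc σ y hy⟩ (hγ σ y)
      exact hR₃ _ _ h2.1 h2.2
    choose g₄ hg₄F hg₄n using fun σ : P =>
      R.exists_blend (g₃ σ) (hF σ) (g.comp (p σ)) (γ σ) (hγF σ) fun y => (hb₂ σ y).1
    have hg₄ : ∀ σ y, dist (hc σ y) (g₄ σ y) < δ (hc σ y) := by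
      intro σ y
      by_cases hy : y ∈ F σ
      · rw [dist_comm, hg₄F σ ⟨y, hy⟩]; exact (hb₂ σ ⟨y, hy⟩).2
      · rw [hg₄n σ y hy, dist_comm]; exact (hg₃c σ y).trans_le (hδ₃δ _)
    have hg₄A : ∀ σ y, (∃ u ∈ closure (range g), dist u (g₄ σ y) < η u) ∨
        g₄ σ y ∈ ⋃ σ, range (g₂ σ) := by
      intro σ y
      by_cases hy : y ∈ F σ
      · by_cases hy0 : γ σ y = 0
        · refine Or.inr (mem_iUnion.2 ⟨σ, s σ y, ?_⟩)
          rw [hg₄F σ ⟨y, hy⟩, hy0, zero_smul, add_zero, R.r_emb]; rfl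
        · refine Or.inl ⟨g (p σ ⟨y, hy⟩), subset_closure ⟨_, rfl⟩, ?_⟩
          have h1 := (hg₃ σ y).trans_le (min_le_right _ _)
          rw [hg₁' σ ⟨y, hy⟩ (hβγ σ y hy0), dist_comm] at h1
          have h2 := (R.convex_ball (R.emb (g (p σ ⟨y, hy⟩))) (η' (g (p σ ⟨y, hy⟩)))).add_smul_sub_mem
            (x := R.emb (g₃ σ y)) (y := R.emb (g (p σ ⟨y, hy⟩))) ⟨R.emb_mem_C _, by
              rw [Metric.mem_ball, R.isometry_emb.dist_eq]; exact h1⟩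
            ⟨R.emb_mem_C _, Metric.mem_ball_self (hη'.pos _)⟩ (hγ σ y)
          rw [dist_comm, hg₄F σ ⟨y, hy⟩]
          exact (hR' _ _ h2.1 h2.2).2
      · exact Or.inr (mem_iUnion.2 ⟨σ, s σ y, (hg₄n σ y hy).symm⟩)
    obtain ⟨f, hf1, hf2, hf3⟩ := exists_glue hK g (P := P) (fun _ => Iff.rfl) g₄ fun σ y hy => by
      obtain ⟨hyF, hpy, hγ1⟩ := hbd σ y hy
      rw [hg₄F σ ⟨y, hyF⟩, hγ1, one_smul, add_sub_cancel, R.r_emb, ContinuousMap.comp_apply, hpy]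
    refine ⟨f, fun x => ?_, ?_⟩
    · rcases hf3 x with ⟨x', rfl⟩ | ⟨σ, y, rfl⟩
      · rw [hf1]
        have h1 : dist (h (skeletonInclusion K k x')) (g x') <
          δ₁ (h (skeletonInclusion K k x')) / 4 := hg x'
        have h2 := (hδ₁₂ (h (skeletonInclusion K k x'))).trans (min_le_left _ _)
        have h3 := hδ₃δ (h (skeletonInclusion K k x'))
        have h4 := hδ₃.pos (h (skeletonInclusion K k x'))
        have h5 := hδ₁.pos (h (skeletonInclusion K k x'))
        linarith
      · rw [hf2]; exact hg₄ σ y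
    · have hsub : range f ⊆ {v | ∃ u ∈ closure (range g), dist u v < η u} ∪ ⋃ σ, range (g₂ σ) := by
        rintro _ ⟨x, rfl⟩
        rcases hf3 x with ⟨x', rfl⟩ | ⟨σ, y, rfl⟩
        · rw [hf1]
          exact Or.inl ⟨g x', subset_closure ⟨_, rfl⟩, by rw [dist_self]; exact hη.pos _⟩
        · rw [hf2]; exact hg₄A σ y
      refine Disjoint.mono_right (closure_mono hsub) ?_
      rw [closure_union]
      exact disjoint_union_right.2 ⟨hηA _ fun v hv => hv, hg₂A⟩

end Complex

end StrongZ

namespace StrongZ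

/-! ### Factoring maps through nerves of covers -/

section Nerve

variable {S : Type u} {Y : Type*}

/-- The nerve of an indexed family of sets. -/
def nerve (W : S → Set Y) : PreAbstractSimplicialComplex S where
  faces := {σ | σ.Nonempty ∧ ∃ y, ∀ s ∈ σ, y ∈ W s}
  isRelLowerSet_faces := fun _ hσ =>
    ⟨hσ.1, fun _ hρ hne => ⟨hne, hσ.2.imp fun _ hy s hs => hy s (hρ hs)⟩⟩

theorem card_le_of_mem_nerve {W : S → Set Y} {k : ℕ} (hk : ∀ y, {s | y ∈ W s}.encard ≤ k)
    {σ : Finset S} (hσ : σ ∈ (nerve W).faces) : σ.card ≤ k := by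
  obtain ⟨-, y, hy⟩ := hσ
  have h1 := (encard_le_encard (show (σ : Set S) ⊆ {s | y ∈ W s} from hy)).trans (hk y)
  rw [encard_coe_eq_coe_finsetCard] at h1
  exact_mod_cast h1

variable {X : Type v} [MetricSpace X] {E : Type w} [NormedAddCommGroup E] [NormedSpace ℝ E]

theorem ConvexRetract.exists_vertices [Nonempty Y] (R : ConvexRetract X E) (f : Y → X)
    {W : S → Set Y} {ε : X → ℝ}
    (hW : ∀ s, ∀ y ∈ W s, ∀ y' ∈ W s, dist (f y) (f y') < ε (f y)) :
    ∃ v : S → E, (∀ s, ∀ y ∈ W s, v s ∈ R.C ∩ Metric.ball (R.emb (f y)) (ε (f y))) ∧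
      ∀ s, v s ∈ R.emb '' range f := by
  have h : ∀ s, ∃ e, (∀ y ∈ W s, e ∈ R.C ∩ Metric.ball (R.emb (f y)) (ε (f y))) ∧
      e ∈ R.emb '' range f := fun s => by
    rcases (W s).eq_empty_or_nonempty with h | ⟨y₀, hy₀⟩
    · exact ⟨_, fun y hy => (h.subset hy).elim, _, ⟨Classical.arbitrary Y, rfl⟩, rfl⟩
    · refine ⟨R.emb (f y₀), fun y hy => ⟨R.emb_mem_C _, ?_⟩, _, ⟨_, rfl⟩, rfl⟩
      rw [Metric.mem_ball, R.isometry_emb.dist_eq, dist_comm]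
      exact hW s y hy _ hy₀
  choose v h1 h2 using h
  exact ⟨v, h1, h2⟩

theorem ConvexRetract.barycenter_mem_ball (R : ConvexRetract X E) {f : Y → X} {W : S → Set Y}
    {ε : X → ℝ} {v : S → E}
    (hv : ∀ s, ∀ y ∈ W s, v s ∈ R.C ∩ Metric.ball (R.emb (f y)) (ε (f y)))
    {x : Hilb S} (hx : x ∈ realization (nerve W)) {y : Y} (hy : ∀ s, x s ≠ 0 → y ∈ W s) :
    barycenter v x ∈ R.C ∩ Metric.ball (R.emb (f y)) (ε (f y)) :=
  barycenter_mem hx (R.convex_ball _ _) fun s hs => hv s y (hy s hs)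

theorem exists_forall_coord_mem {W : S → Set Y} {x : Hilb S} (hx : x ∈ realization (nerve W)) :
    ∃ y, ∀ s, x s ≠ 0 → y ∈ W s := by
  obtain ⟨σ, ⟨-, y, hy⟩, hσ⟩ := mem_realization_iff.1 hx
  refine ⟨y, fun s hs => hy s ?_⟩
  by_contra h
  exact hs ((mem_cell_iff.1 hσ).2.1 s h)

variable [TopologicalSpace Y]

theorem exists_nerve_map [NormalSpace Y] [ParacompactSpace Y] {W : S → Set Y}
    (hW : ∀ s, IsOpen (W s)) (hcov : ⋃ s, W s = univ) :
    ∃ p : C(Y, WeakRealization (nerve W)), ∀ y s, (p y).val s ≠ 0 → y ∈ W s := by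
  obtain ⟨χ, hχ⟩ := PartitionOfUnity.exists_isSubordinate isClosed_univ W hW hcov.ge
  have hsupp : ∀ y s, χ s y ≠ 0 → y ∈ W s := fun y s h => hχ s (subset_tsupport _ h)
  obtain ⟨p, hp⟩ := exists_map_weakRealization (K := nerve W) (fun s y => χ s y)
    (fun s => (χ s).continuous) χ.locallyFinite χ.nonneg (fun y => χ.sum_eq_one (mem_univ y))
    fun y σ hσ => ⟨by
      obtain ⟨s, hs⟩ := χ.exists_pos (mem_univ y)
      exact ⟨s, (hσ s).2 hs.ne'⟩, y, fun s hs => hsupp y s ((hσ s).1 hs)⟩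
  exact ⟨p, fun y s h => hsupp y s (hp y s ▸ h)⟩

/-- A map which, for arbitrarily fine covers of its domain of finite order, factors
approximately through complexes of bounded dimension is pushed off `A` if families of maps of
cubes can be pushed off `A`. -/
theorem canAvoid_of_covers [NormalSpace Y] [ParacompactSpace Y] {A : Set X}
    (R : ConvexRetract X E) (hA : IsClosed A) (f : C(Y, X)) {θ : X → ℝ} (hθ : IsControl θ)
    {B : Set X} (hB : ∀ y x, dist (f y) x < θ (f y) → x ∈ B)
    (H : ∀ ε : X → ℝ, IsControl ε → ∃ (S : Type u) (k : ℕ) (W : S → Set Y),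
      (∀ s, IsOpen (W s)) ∧ ⋃ s, W s = univ ∧ (∀ y, {s | y ∈ W s}.encard ≤ k) ∧
      (∀ s, ∀ y ∈ W s, ∀ y' ∈ W s, dist (f y) (f y') < ε (f y)) ∧
      ∀ j < k, ∀ (P : Set (Finset S)) (g : P → C(Cube j, X)), (∀ s z, g s z ∈ B) →
        FamCanAvoid A g) : CanAvoid A f := by
  rcases isEmpty_or_nonempty Y with hY | hY
  · exact canAvoid_of_isEmpty f
  intro δ hδ
  obtain ⟨ε, hε, -, hR⟩ := R.exists_control ((hδ.min hθ).div (c := 4) (by norm_num))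
  obtain ⟨S, k, W, hWo, hWc, hWk, hWε, hfam⟩ := H ε hε
  obtain ⟨p, hp⟩ := exists_nerve_map hWo hWc
  obtain ⟨v, hv, -⟩ := R.exists_vertices f hWε
  have hclose : ∀ (x : WeakRealization (nerve W)) (y : Y), (∀ s, x.val s ≠ 0 → y ∈ W s) →
      barycenter v x.val ∈ R.S ∧
        dist (R.r (barycenter v x.val)) (f y) < min (δ (f y)) (θ (f y)) / 4 := fun x y hy => by
    have h1 := R.barycenter_mem_ball hv x.val_mem hy
    exact hR _ _ h1.1 h1.2
  let h : C(WeakRealization (nerve W), X) := ⟨fun x => R.r (barycenter v x.val),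
    R.continuous_r_comp (continuous_barycenter_weak v) fun x => by
      obtain ⟨y, hy⟩ := exists_forall_coord_mem x.val_mem
      exact (hclose x y hy).1⟩
  have hav : CanAvoid A h := canAvoid_weakRealization R hA k hfam (nerve W)
    (fun σ hσ => card_le_of_mem_nerve hWk hσ) h (hθ.div (c := 2) (by norm_num)) fun z x hx => by
      obtain ⟨y, hy⟩ := exists_forall_coord_mem z.val_mem
      have h1 : dist (h z) (f y) < min (δ (f y)) (θ (f y)) / 4 := (hclose z y hy).2
      have h2 := min_le_right (δ (f y)) (θ (f y))
      have h3 := hθ.le_add (h z) (f y)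
      have h4 := dist_triangle_left (f y) x (h z)
      refine hB y x ?_
      linarith [hθ.pos (f y)]
  obtain ⟨g, hg, hgA⟩ := hav _ (hδ.div (c := 4) (by norm_num))
  refine ⟨g.comp p, fun y => ?_, hgA.mono_right (closure_mono (range_comp_subset_range p g))⟩
  have h1 : dist (h (p y)) (f y) < min (δ (f y)) (θ (f y)) / 4 := (hclose (p y) y (hp y)).2
  have h2 := min_le_left (δ (f y)) (θ (f y))
  have h3 := hδ.le_add (h (p y)) (f y)
  have h4 : dist (h (p y)) (g (p y)) < δ (h (p y)) / 4 := hg (p y)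
  have h5 := dist_triangle_left (f y) (g (p y)) (h (p y))
  change dist (f y) (g (p y)) < _
  linarith [hδ.pos (f y)]

end Nerve

/-! ### Invariants of closed subsets -/

section Invariants

variable {X : Type u} [TopologicalSpace X]

/-- An open cover of a closed subset `G` of `F`, extended to an open cover of `F`. -/
theorem exists_cov_of_subset {F G : Set X} (hG : IsClosed G) (hGF : G ⊆ F) {𝒰 : Set (Set G)}
    (h𝒰 : 𝒰 ∈ Cov G) : ∃ 𝒰' ∈ Cov F, ∀ U' ∈ 𝒰', ((Set.inclusion hGF) ⁻¹' U' = ∅ ∨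
      (Set.inclusion hGF) ⁻¹' U' ∈ 𝒰) := by
  refine ⟨{U' | IsOpen U' ∧ ((Set.inclusion hGF) ⁻¹' U' = ∅ ∨ (Set.inclusion hGF) ⁻¹' U' ∈ 𝒰)},
    ⟨fun U hU => hU.1, eq_univ_of_forall fun x => ?_⟩, fun U hU => hU.2⟩
  by_cases hx : x.1 ∈ G
  · obtain ⟨U, hU, hxU⟩ : (⟨x.1, hx⟩ : G) ∈ ⋃₀ 𝒰 := h𝒰.2 ▸ mem_univ _
    obtain ⟨O, hO, rfl⟩ := isOpen_induced_iff.1 (h𝒰.1 U hU)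
    exact ⟨(Subtype.val : F → X) ⁻¹' O, ⟨hO.preimage continuous_subtype_val, Or.inr hU⟩, hxU⟩
  · refine ⟨(Subtype.val : F → X) ⁻¹' Gᶜ, ⟨hG.isOpen_compl.preimage continuous_subtype_val, Or.inl ?_⟩, hx⟩
    exact eq_empty_of_forall_notMem fun y hy => hy y.2

theorem cov_preimage {Z : Type*} [TopologicalSpace Z] {Y : Type*} [TopologicalSpace Y]
    {i : Z → Y} (hi : Continuous i) {𝒱 : Set (Set Y)} (h𝒱 : 𝒱 ∈ Cov Y) :
    (fun V => i ⁻¹' V) '' 𝒱 ∈ Cov Z := by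
  refine ⟨?_, eq_univ_of_forall fun z => ?_⟩
  · rintro _ ⟨V, hV, rfl⟩
    exact (h𝒱.1 V hV).preimage hi
  · obtain ⟨V, hV, hz⟩ : i z ∈ ⋃₀ 𝒱 := h𝒱.2 ▸ mem_univ _
    exact ⟨_, ⟨V, hV, rfl⟩, hz⟩

theorem IsFDT.mono {F G : Set X} (hF : IsFDT F) (hG : IsClosed G) (hGF : G ⊆ F) : IsFDT G := by
  intro 𝒰 h𝒰
  obtain ⟨𝒰', h𝒰', hsub⟩ := exists_cov_of_subset hG hGF h𝒰
  obtain ⟨𝒱, h𝒱, href, k, hk⟩ := hF 𝒰' h𝒰'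
  have hc := cov_preimage (continuous_inclusion hGF) h𝒱
  refine ⟨((fun V => Set.inclusion hGF ⁻¹' V) '' 𝒱) \ {∅}, ⟨fun U hU => hc.1 U hU.1,
    eq_univ_of_forall fun x => ?_⟩, ?_, k, fun x => ?_⟩
  · obtain ⟨V, hV, hx⟩ : x ∈ ⋃₀ ((fun V => Set.inclusion hGF ⁻¹' V) '' 𝒱) := hc.2 ▸ mem_univ _
    refine ⟨V, ⟨hV, ?_⟩, hx⟩
    rintro rfl
    exact hx
  · rintro _ ⟨⟨V, hV, rfl⟩, hne⟩
    obtain ⟨U', hU', hVU⟩ := href V hV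
    rcases hsub U' hU' with h | h
    · exact (hne (subset_empty_iff.1 ((preimage_mono hVU).trans h.subset))).elim
    · exact ⟨_, h, preimage_mono hVU⟩
  · refine le_trans (encard_le_encard ?_) ((encard_image_le (fun V => Set.inclusion hGF ⁻¹' V)
      {V | V ∈ 𝒱 ∧ Set.inclusion hGF x ∈ V}).trans (hk (Set.inclusion hGF x)))
    rintro _ ⟨⟨⟨V, hV, rfl⟩, -⟩, hx⟩
    exact ⟨V, ⟨hV, hx⟩, rfl⟩

theorem comp_mem (X : Type u) [TopologicalSpace X] :
    ℵ₀ ≤ comp X ∧ ∀ 𝒰 ∈ Cov X, ∃ 𝒱 ⊆ 𝒰, 𝒱 ∈ Cov X ∧ #𝒱 < comp X :=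
  csInf_mem (s := {κ | ℵ₀ ≤ κ ∧ ∀ 𝒰 ∈ Cov X, ∃ 𝒱 ⊆ 𝒰, 𝒱 ∈ Cov X ∧ #𝒱 < κ})
    ⟨max ℵ₀ (Order.succ #(Set X)), le_max_left _ _, fun 𝒰 h𝒰 => ⟨𝒰, Subset.rfl, h𝒰,
      ((Cardinal.mk_set_le 𝒰).trans_lt (Order.lt_succ _)).trans_le (le_max_right _ _)⟩⟩

theorem compL_mem (X : Type u) [TopologicalSpace X] :
    ℵ₀ ≤ compL X ∧ ∀ x : X, ∃ F ∈ 𝓝 x, comp F ≤ compL X :=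
  csInf_mem (s := {κ | ℵ₀ ≤ κ ∧ ∀ x : X, ∃ F ∈ 𝓝 x, comp F ≤ κ})
    ⟨comp (univ : Set X), (comp_mem _).1, fun _ => ⟨univ, univ_mem, le_rfl⟩⟩

theorem exists_subcover_of_comp_le {F G : Set X} {κ : Cardinal.{u}} (hF : comp F ≤ κ)
    (hG : IsClosed G) (hGF : G ⊆ F) {𝒰 : Set (Set G)} (h𝒰 : 𝒰 ∈ Cov G) :
    ∃ 𝒱 ⊆ 𝒰, 𝒱 ∈ Cov G ∧ #𝒱 < κ := by
  obtain ⟨𝒰', h𝒰', hsub⟩ := exists_cov_of_subset hG hGF h𝒰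
  obtain ⟨𝒱, h𝒱𝒰, h𝒱, hcard⟩ := (comp_mem F).2 𝒰' h𝒰'
  have hc := cov_preimage (continuous_inclusion hGF) h𝒱
  refine ⟨((fun V => Set.inclusion hGF ⁻¹' V) '' 𝒱) ∩ 𝒰, inter_subset_right,
    ⟨fun U hU => h𝒰.1 U hU.2, eq_univ_of_forall fun x => ?_⟩, ?_⟩
  · obtain ⟨_, ⟨V, hV, rfl⟩, hx⟩ : x ∈ ⋃₀ ((fun V => Set.inclusion hGF ⁻¹' V) '' 𝒱) :=
      hc.2 ▸ mem_univ _
    rcases hsub V (h𝒱𝒰 hV) with h | h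
    · exact (h.subset hx).elim
    · exact ⟨_, ⟨⟨V, hV, rfl⟩, h⟩, hx⟩
  · exact ((Cardinal.mk_le_mk_of_subset inter_subset_left).trans Cardinal.mk_image_le).trans_lt
      (hcard.trans_le hF)

end Invariants

end StrongZ

namespace StrongZ

/-! ### Families of maps of cubes -/

section CubeCovers

/-- The cubes `I^n` have covers of order `2 ^ n` by small translates of a cube. -/
theorem coveringDimLE_cube (n : ℕ) : CoveringDimLE (Cube n) (2 ^ n - 1) := by
  classical
  intro 𝒰 h𝒰 _
  obtain ⟨r, hr, hU⟩ := lebesgue_number_lemma_of_metric_sUnion isCompact_univ h𝒰.1 h𝒰.2.ge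
  obtain ⟨N, hN⟩ := exists_nat_gt (2 / r)
  have hN0 : (0 : ℝ) < N := (div_pos two_pos hr).trans hN
  let W : (Fin n → ℕ) → Set (Cube n) := fun k => {z | ∀ i, |N * (z i : ℝ) - k i| < 1}
  have hWo : ∀ k, IsOpen (W k) := fun k => by
    have : W k = ⋂ i, {z : Cube n | |N * (z i : ℝ) - k i| < 1} := by
      ext z; simp [W]
    rw [this]
    exact isOpen_iInter_of_finite fun i => isOpen_lt (by fun_prop) continuous_const
  have hmem : ∀ z : Cube n, z ∈ W fun i => ⌊N * (z i : ℝ)⌋₊ := fun z i => by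
    have h1 := Nat.floor_le (mul_nonneg hN0.le (z i).2.1)
    have h2 := Nat.lt_floor_add_one (N * (z i : ℝ))
    rw [abs_lt]; constructor <;> linarith
  refine ⟨range W, ⟨by rintro _ ⟨k, rfl⟩; exact hWo k,
    eq_univ_of_forall fun z => ⟨_, ⟨_, rfl⟩, hmem z⟩⟩, ?_, fun z => ?_⟩
  · rintro _ ⟨k, rfl⟩
    rcases (W k).eq_empty_or_nonempty with h | ⟨z, hz⟩
    · rw [h]
      obtain ⟨U, hU, -⟩ := hU (fun _ => 0) (mem_univ _)
      exact ⟨U, hU, empty_subset _⟩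
    · obtain ⟨U, hU, hzU⟩ := hU z (mem_univ _)
      refine ⟨U, hU, fun y hy => hzU ?_⟩
      rw [Metric.mem_ball]
      refine (dist_pi_le_iff (r := 2 / N) (by positivity)).2 (fun i => ?_) |>.trans_lt ?_
      · have h1 := abs_lt.1 (hz i)
        have h2 := abs_lt.1 (hy i)
        rw [Subtype.dist_eq, Real.dist_eq, abs_le, le_div_iff₀ hN0, neg_le, ← neg_sub, neg_neg,
          le_div_iff₀ hN0]
        constructor <;> linarith
      · rw [div_lt_iff₀ hN0]; rw [div_lt_iff₀ hr] at hN; linarith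
  · have h1 : {V | V ∈ range W ∧ z ∈ V} ⊆ W '' (Fintype.piFinset fun i : Fin n =>
        ({⌊N * (z i : ℝ)⌋₊, ⌊N * (z i : ℝ)⌋₊ + 1} : Finset ℕ)) := by
      rintro _ ⟨⟨k, rfl⟩, hz⟩
      refine ⟨k, Finset.mem_coe.2 (Fintype.mem_piFinset.2 fun i => ?_), rfl⟩
      have h1 := abs_lt.1 (hz i)
      have h2 := Nat.floor_le (mul_nonneg hN0.le (z i).2.1)
      have h3 := Nat.lt_floor_add_one (N * (z i : ℝ))
      have h4 : k i < ⌊N * (z i : ℝ)⌋₊ + 2 := by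
        have : (k i : ℝ) < ((⌊N * (z i : ℝ)⌋₊ + 2 : ℕ) : ℝ) := by push_cast; linarith
        exact_mod_cast this
      have h5 : ⌊N * (z i : ℝ)⌋₊ < k i + 1 := by
        have : (⌊N * (z i : ℝ)⌋₊ : ℝ) < ((k i + 1 : ℕ) : ℝ) := by push_cast; linarith
        exact_mod_cast this
      rw [Finset.mem_insert, Finset.mem_singleton]
      omega
    refine (encard_le_encard h1).trans ((encard_image_le _ _).trans ?_)
    rw [encard_coe_eq_coe_finsetCard, Fintype.card_piFinset]
    norm_cast
    rw [Nat.sub_add_cancel Nat.one_le_two_pow]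
    refine (Finset.prod_le_pow_card _ _ 2 fun i _ => Finset.card_le_two).trans ?_
    simp

variable {X : Type*} [MetricSpace X]

theorem exists_finite_small_cover {Z : Type*} [TopologicalSpace Z] [CompactSpace Z] {d : ℕ}
    (hd : CoveringDimLE X d ∨ CoveringDimLE Z d) (f : C(Z, X)) {ε : X → ℝ} (hε : IsControl ε) :
    ∃ (N : ℕ) (W : Fin N → Set Z), (∀ i, IsOpen (W i)) ∧ ⋃ i, W i = univ ∧
      (∀ z, {i | z ∈ W i}.encard ≤ (d + 1 : ℕ)) ∧
      ∀ i, ∀ z ∈ W i, ∀ z' ∈ W i, dist (f z) (f z') < ε (f z) := by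
  classical
  suffices h : ∃ 𝒱 ∈ Cov Z, (∀ z, {V | V ∈ 𝒱 ∧ z ∈ V}.encard ≤ (d + 1 : ℕ)) ∧
      ∀ V ∈ 𝒱, ∀ z ∈ V, ∀ z' ∈ V, dist (f z) (f z') < ε (f z) by
    obtain ⟨𝒱, h𝒱, hord, hs⟩ := h
    obtain ⟨t, ht⟩ := isCompact_univ.elim_finite_subcover (fun V : 𝒱 => V.1)
      (fun V => h𝒱.1 V V.2) (by rw [← sUnion_eq_iUnion, h𝒱.2])
    let e := t.equivFin
    refine ⟨t.card, fun i => (e.symm i).1.1, fun i => h𝒱.1 _ (e.symm i).1.2,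
      eq_univ_of_forall fun z => ?_, fun z => le_trans ?_ (hord z), fun i => hs _ (e.symm i).1.2⟩
    · obtain ⟨V, hV, hz⟩ := mem_iUnion₂.1 (ht (mem_univ z))
      exact mem_iUnion.2 ⟨e ⟨V, hV⟩, by simpa using hz⟩
    · have hinj : Function.Injective fun i => (e.symm i).1.1 :=
        Subtype.val_injective.comp (Subtype.val_injective.comp e.symm.injective)
      rw [← hinj.encard_image]
      refine encard_le_encard ?_
      rintro _ ⟨i, hi, rfl⟩
      exact ⟨(e.symm i).1.2, hi⟩
  obtain ⟨𝒰, h𝒰, hs⟩ := exists_cov_of_control hε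
  obtain ⟨t, ht𝒰, htf, ht⟩ : ∃ t ⊆ 𝒰, t.Finite ∧ range f ⊆ ⋃₀ t := by
    obtain ⟨t, ht⟩ := (isCompact_range f.continuous).elim_finite_subcover (fun U : 𝒰 => U.1)
      (fun U => h𝒰.1 U U.2) (by rw [← sUnion_eq_iUnion, h𝒰.2]; exact subset_univ _)
    refine ⟨Subtype.val '' (t : Set 𝒰), by rintro _ ⟨U, -, rfl⟩; exact U.2,
      t.finite_toSet.image _, fun x hx => ?_⟩
    obtain ⟨U, hU, hxU⟩ := mem_iUnion₂.1 (ht hx)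
    exact ⟨U, ⟨U, hU, rfl⟩, hxU⟩
  rcases hd with hd | hd
  · obtain ⟨𝒱, h𝒱, href, hord⟩ := hd (insert (range f)ᶜ t) ⟨by
      rintro U (rfl | hU)
      · exact (isCompact_range f.continuous).isClosed.isOpen_compl
      · exact h𝒰.1 U (ht𝒰 hU), by
      rw [sUnion_insert, eq_univ_iff_forall]
      intro x
      by_cases hx : x ∈ range f
      · exact Or.inr (ht hx)
      · exact Or.inl hx⟩ (htf.insert _)
    have hc := cov_preimage f.continuous h𝒱
    refine ⟨_, hc, fun z => le_trans (encard_le_encard ?_) ((encard_image_le (fun V => f ⁻¹' V)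
      {V | V ∈ 𝒱 ∧ f z ∈ V}).trans (hord (f z))), ?_⟩
    · rintro _ ⟨⟨V, hV, rfl⟩, hz⟩
      exact ⟨V, ⟨hV, hz⟩, rfl⟩
    · rintro _ ⟨V, hV, rfl⟩ z hz z' hz'
      obtain ⟨U, rfl | hU, hVU⟩ := href V hV
      · exact (hVU hz ⟨z, rfl⟩).elim
      · exact hs U (ht𝒰 hU) _ (hVU hz) _ (hVU hz')
  · obtain ⟨𝒱, h𝒱, href, hord⟩ := hd ((fun U => f ⁻¹' U) '' t) ⟨by
      rintro _ ⟨U, hU, rfl⟩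
      exact (h𝒰.1 U (ht𝒰 hU)).preimage f.continuous, eq_univ_of_forall fun z => by
      obtain ⟨U, hU, hz⟩ := ht ⟨z, rfl⟩
      exact ⟨_, ⟨U, hU, rfl⟩, hz⟩⟩ (htf.image _)
    refine ⟨𝒱, h𝒱, hord, fun V hV z hz z' hz' => ?_⟩
    obtain ⟨_, ⟨U, hU, rfl⟩, hVU⟩ := href V hV
    exact hs U (ht𝒰 hU) _ (hVU hz) _ (hVU hz')

end CubeCovers

section CubeFamilies

variable {X : Type u} [MetricSpace X] {E : Type w} [NormedAddCommGroup E] [NormedSpace ℝ E]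
  {A : Set X}

/-- Locally at the points of `A`, families of fewer than `θ` maps of the cube `I^j` can be pushed
off `A`. -/
def LocallyAvoids (A : Set X) (θ : Cardinal.{u}) (j : ℕ) : Prop :=
  ∀ a ∈ A, ∃ ρ > 0, ∀ S : Type u, #S < θ → ∀ g : S → C(Cube j, X),
    (∀ s z, g s z ∈ Metric.closedBall a ρ) → FamCanAvoid A g

theorem mk_finset_lt {S : Type u} {κ : Cardinal.{u}} (hκ : ℵ₀ ≤ κ) (hS : #S < κ) :
    #(Finset S) < κ := by
  rcases finite_or_infinite S with h | h
  · exact (Cardinal.lt_aleph0_of_finite _).trans_le hκ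
  · rwa [Cardinal.mk_finset_of_infinite]

theorem famCanAvoid_of_prod {Z S : Type*} [TopologicalSpace Z] [TopologicalSpace S]
    {f : C(Z × S, X)} (hf : CanAvoid A f) :
    FamCanAvoid A fun s => f.comp ((ContinuousMap.id Z).prodMk (ContinuousMap.const Z s)) :=
  fun δ hδ => by
    obtain ⟨g, hg, hgA⟩ := hf δ hδ
    refine ⟨fun s => g.comp ((ContinuousMap.id Z).prodMk (ContinuousMap.const Z s)),
      fun s z => hg (z, s), hgA.mono_right (closure_mono (iUnion_subset fun s => ?_))⟩
    rintro _ ⟨z, rfl⟩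
    exact ⟨_, rfl⟩

theorem canAvoid_cube_prod (R : ConvexRetract X E) (hA : IsClosed A) {θ : Cardinal.{u}}
    (hθ : θ.IsRegular) {n d : ℕ} (hd : CoveringDimLE X d ∨ CoveringDimLE (Cube n) d)
    (H : ∀ j ≤ d, LocallyAvoids A θ j) {S : Type u} [TopologicalSpace S] [DiscreteTopology S]
    (hS : #S < θ) (f : C(Cube n × S, X)) : CanAvoid A f := by
  refine canAvoid_of_restrict_closedBall R hA (fun a ha => ?_) f
  choose! ρ hρ hH using fun j hj => H j hj a ha
  obtain ⟨ρ₀, hρ₀, hρ₀ρ⟩ : ∃ ρ₀ > 0, ∀ j ≤ d, ρ₀ ≤ ρ j := by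
    refine ⟨(Finset.range (d + 1)).inf' Finset.nonempty_range_add_one ρ, ?_, fun j hj => Finset.inf'_le _ (by
      simpa [Nat.lt_succ_iff] using hj)⟩
    rw [gt_iff_lt, Finset.lt_inf'_iff]
    exact fun j hj => hρ j (Nat.lt_succ_iff.1 (Finset.mem_range.1 hj))
  refine ⟨ρ₀ / 2, half_pos hρ₀, fun f => ?_⟩
  have : MetrizableSpace (f ⁻¹' Metric.closedBall a (ρ₀ / 2)) := inferInstance
  let := metrizableSpaceMetric (f ⁻¹' Metric.closedBall a (ρ₀ / 2))
  refine canAvoid_of_covers R hA _ (IsControl.const (half_pos hρ₀)) (B := Metric.closedBall a ρ₀)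
    (fun y x hx => ?_) fun ε hε => ?_
  · have h1 : dist (f y) a ≤ ρ₀ / 2 := y.2
    have h2 : dist (f y) x < ρ₀ / 2 := hx
    have h3 := dist_triangle_left x a (f y)
    rw [Metric.mem_closedBall]; linarith
  choose N W hWo hWc hWk hWs using fun s : S => exists_finite_small_cover hd
    (f.comp ((ContinuousMap.id _).prodMk (ContinuousMap.const _ s))) hε
  refine ⟨Σ s : S, ULift.{u} (Fin (N s)), d + 1,
    fun i => {y | y.1.2 = i.1 ∧ y.1.1 ∈ W i.1 i.2.down}, ?_, ?_, ?_, ?_, ?_⟩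
  · rintro ⟨s, i⟩
    have h1 : IsOpen {p : Cube n × S | p.2 = s ∧ p.1 ∈ W s i.down} :=
      ((isOpen_discrete {s}).preimage continuous_snd).inter
        ((hWo s i.down).preimage continuous_fst)
    exact h1.preimage continuous_subtype_val
  · refine eq_univ_of_forall fun y => ?_
    obtain ⟨i, hi⟩ := mem_iUnion.1 ((hWc y.1.2).symm ▸ mem_univ y.1.1)
    exact mem_iUnion.2 ⟨⟨y.1.2, ⟨i⟩⟩, rfl, hi⟩
  · intro y
    refine le_trans ?_ (hWk y.1.2 y.1.1)
    have hinj : Function.Injective fun i : Fin (N y.1.2) =>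
        (⟨y.1.2, ⟨i⟩⟩ : Σ s : S, ULift.{u} (Fin (N s))) := fun i j h => by simpa using h
    rw [← hinj.encard_image]
    refine encard_le_encard ?_
    rintro ⟨s, ⟨i⟩⟩ ⟨h1, h2⟩
    dsimp only at h1 h2
    subst h1
    exact ⟨i, h2, rfl⟩
  · rintro ⟨s, ⟨i⟩⟩ ⟨⟨z, s₁⟩, hz⟩ ⟨h1, h2⟩ ⟨⟨z', s₂⟩, hz'⟩ ⟨h3, h4⟩
    dsimp only at h1 h2 h3 h4
    subst h1 h3
    exact hWs _ i z h2 z' h4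
  · intro j hj P g hg
    refine hH j (Nat.lt_succ_iff.1 hj) P ((Cardinal.mk_set_le P).trans_lt
      (mk_finset_lt hθ.aleph0_le ?_)) g fun s z =>
        Metric.closedBall_subset_closedBall (hρ₀ρ j (Nat.lt_succ_iff.1 hj)) (hg s z)
    rw [Cardinal.mk_sigma]
    exact Cardinal.sum_lt_of_isRegular hθ hS fun s =>
      (Cardinal.lt_aleph0_of_finite _).trans_le hθ.aleph0_le

/-- The families of fewer than `κ` maps of cubes can be pushed off `A`. -/
def AvoidsCubes (A : Set X) (κ : Cardinal.{u}) : Prop :=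
  ∀ (n : ℕ) (S : Type u), #S < κ → ∀ g : S → C(Cube n, X), FamCanAvoid A g

theorem famCanAvoid_cube (R : ConvexRetract X E) (hA : IsClosed A) {θ : Cardinal.{u}}
    (hθ : θ.IsRegular) {n d : ℕ} (hd : CoveringDimLE X d ∨ CoveringDimLE (Cube n) d)
    (H : ∀ j ≤ d, LocallyAvoids A θ j) {S : Type u} (hS : #S < θ) (g : S → C(Cube n, X)) :
    FamCanAvoid A g := by
  let : TopologicalSpace S := ⊥
  have : DiscreteTopology S := ⟨rfl⟩
  exact famCanAvoid_of_prod (canAvoid_cube_prod R hA hθ hd H hS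
    ⟨fun p => g p.2 p.1, continuous_prod_of_discrete_right.2 fun s => (g s).continuous⟩)

/-- A small closed ball has arbitrarily fine covers of finite order with fewer than `compL X` members.
Their nerves have finite dimension and fewer than `compL X` simplices. -/
theorem isStrongZSet_of_avoidsCubes (R : ConvexRetract X E) (hA : IsClosed A)
    (hX : LocallyFDT X) (H : AvoidsCubes A (compL X)) : IsStrongZSet A := by
  refine isStrongZSet_of_inclusion R hA fun a _ => ?_
  obtain ⟨F, hF, hFDT⟩ := hX a
  obtain ⟨G, hG, hGκ⟩ := (compL_mem X).2 a
  obtain ⟨ρ, hρ, hρF⟩ := Metric.nhds_basis_closedBall.mem_iff.1 (inter_mem hF hG)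
  have hB : IsClosed (Metric.closedBall a ρ) := Metric.isClosed_closedBall
  refine ⟨ρ, hρ, canAvoid_of_covers R hA _ (IsControl.const one_pos) (B := univ)
    (fun _ _ _ => mem_univ _) fun ε hε => ?_⟩
  obtain ⟨𝒰, h𝒰, hs⟩ := exists_cov_of_control hε
  obtain ⟨𝒱, h𝒱, href, k, hk⟩ := hFDT.mono hB (hρF.trans inter_subset_left) _
    (cov_preimage (continuous_subtype_val (p := (· ∈ Metric.closedBall a ρ))) h𝒰)
  obtain ⟨𝒲, h𝒲𝒱, h𝒲, hcard⟩ := exists_subcover_of_comp_le hGκ hB (hρF.trans inter_subset_right) h𝒱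
  refine ⟨𝒲, k, fun W => W.1, fun W => h𝒲.1 _ W.2, by rw [← sUnion_eq_iUnion, h𝒲.2], fun y => ?_,
    ?_, fun j _ P g _ => H j P ((Cardinal.mk_set_le P).trans_lt
      (mk_finset_lt (compL_mem X).1 hcard)) g⟩
  · refine le_trans ?_ (hk y)
    rw [← Subtype.val_injective.encard_image]
    refine encard_le_encard ?_
    rintro _ ⟨W, hW, rfl⟩
    exact ⟨h𝒲𝒱 W.2, hW⟩
  · intro W y hy y' hy'
    obtain ⟨_, ⟨U, hU, rfl⟩, hWU⟩ := href W.1 (h𝒲𝒱 W.2)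
    exact hs U hU _ (hWU hy) _ (hWU hy')

theorem exists_cube_retract {j n : ℕ} (h : j ≤ n) :
    ∃ (i : C(Cube j, Cube n)) (p : C(Cube n, Cube j)), ∀ z, p (i z) = z := by
  refine ⟨⟨fun z i => if hi : i.1 < j then z ⟨i, hi⟩ else 0, continuous_pi fun i => ?_⟩,
    ⟨fun z i => z (Fin.castLE h i), by fun_prop⟩, fun z => funext fun i => by simp⟩
  split_ifs <;> fun_prop

theorem SMAP.exists_famCanAvoid {T : Type u} [TopologicalSpace T] [DiscreteTopology T] {n : ℕ}
    (h : SMAP (smallMaps (Cube n × T) Aᶜ)) (a : X) {j : ℕ} (hj : j ≤ n) :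
    ∃ ρ > 0, ∀ S : Type u, #S ≤ #T → ∀ g : S → C(Cube j, X),
      (∀ s z, g s z ∈ Metric.closedBall a ρ) → FamCanAvoid A g := by
  obtain ⟨ρ, hρ, h⟩ := h.exists_canAvoid a
  obtain ⟨i, p, hip⟩ := exists_cube_retract hj
  refine ⟨ρ, hρ, fun S hS g hg δ hδ => ?_⟩
  rcases isEmpty_or_nonempty S with hE | hE
  · exact ⟨g, fun s => hE.elim s, by simp⟩
  obtain ⟨e⟩ : Nonempty (S ↪ T) := hS
  obtain ⟨f', hf', hA'⟩ := h ⟨fun q => g (Function.invFun e q.2) (p q.1),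
    continuous_prod_of_discrete_right.2 fun t =>
      ((g (Function.invFun e t)).comp p).continuous⟩
    (fun q => hg _ _) δ hδ
  refine ⟨fun s => f'.comp (i.prodMk (ContinuousMap.const _ (e s))), fun s z => ?_,
    hA'.mono_right (closure_mono (iUnion_subset fun s => ?_))⟩
  · have := hf' (i z, e s)
    simp only [ContinuousMap.coe_mk, hip, Function.leftInverse_invFun e.injective s] at this
    exact this
  · rintro _ ⟨z, rfl⟩
    exact ⟨_, rfl⟩

theorem locallyAvoids_succ {T : Type u} [TopologicalSpace T] [DiscreteTopology T] {n : ℕ}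
    (h : SMAP (smallMaps (Cube n × T) Aᶜ)) {j : ℕ} (hj : j ≤ n) :
    LocallyAvoids A (Order.succ #T) j := fun a _ => by
  obtain ⟨ρ, hρ, h⟩ := h.exists_famCanAvoid a hj
  exact ⟨ρ, hρ, fun S hS => h S (Order.lt_succ_iff.1 hS)⟩

theorem locallyAvoids_aleph0 {n : ℕ} (h : SMAP (smallMaps (Cube n × PUnit.{u + 1}) Aᶜ)) {j : ℕ}
    (hj : j ≤ n) : LocallyAvoids A ℵ₀ j := fun a _ => by
  obtain ⟨ρ, hρ, h⟩ := h.exists_famCanAvoid a hj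
  refine ⟨ρ, hρ, fun S hS g hg => ?_⟩
  have := Cardinal.lt_aleph0_iff_finite.1 hS
  refine famCanAvoid_of_locallyFinite (locallyFinite_of_finite _) fun s δ hδ => ?_
  obtain ⟨g', hg', hA'⟩ := h PUnit.{u + 1} le_rfl (fun _ => g s) (fun _ => hg s) δ hδ
  exact ⟨g' default, hg' default, hA'.mono_right
    (closure_mono (subset_iUnion (fun i => range (g' i)) default))⟩

/-- A family of maps of `n`-cubes is treated as a map of one space of covering dimension at most `d`,
or into one, so that only cubes of dimension at most `d` are needed. A finite family is treated one
map at a time, an infinite one with the regular cardinal that succeeds its own. -/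
theorem famCanAvoid_cube_of_smap (R : ConvexRetract X E) (hA : IsClosed A) {κ : Cardinal.{u}}
    (hκ : ℵ₀ ≤ κ) {n d m : ℕ} (hd : CoveringDimLE X d ∨ CoveringDimLE (Cube n) d) (hdm : d ≤ m)
    (h : ∀ (T : Type u) [TopologicalSpace T] [DiscreteTopology T], #T < κ →
      SMAP (smallMaps (Cube m × T) Aᶜ)) {S : Type u} (hS : #S < κ) (g : S → C(Cube n, X)) :
    FamCanAvoid A g := by
  rcases lt_or_ge #S ℵ₀ with hS' | hS'
  · exact famCanAvoid_cube R hA Cardinal.isRegular_aleph0 hd (fun j hj =>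
      locallyAvoids_aleph0 (h PUnit ((Cardinal.lt_aleph0_of_finite _).trans_le hκ)) (hj.trans hdm))
      hS' g
  · let : TopologicalSpace S := ⊥
    have : DiscreteTopology S := ⟨rfl⟩
    exact famCanAvoid_cube R hA (Cardinal.isRegular_succ hS') hd (fun j hj =>
      locallyAvoids_succ (h S hS) (hj.trans hdm)) (Order.lt_succ _) g

theorem coveringDim_cases (X : Type u) [TopologicalSpace X] [Nonempty X] :
    (∃ d : ℕ, coveringDim X = d ∧ CoveringDimLE X d) ∨ coveringDim X = ⊤ := by
  rw [coveringDim, if_neg (not_isEmpty_of_nonempty X)]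
  rcases {d : ℕ∞ | ∃ n : ℕ, d = n ∧ CoveringDimLE X n}.eq_empty_or_nonempty with h | h
  · right; rw [h, sInf_empty]; rfl
  · obtain ⟨n, hn, hX⟩ := csInf_mem h
    exact Or.inl ⟨n, by rw [hn]; rfl, hX⟩

theorem isStrongZSet_of_smap_cube_prod (R : ConvexRetract X E) (hA : IsClosed A)
    (hX : LocallyFDT X) (h : ∀ n : ℕ, 1 ≤ n → (n : WithBot ℕ∞) ≤ max 1 (coveringDim X) →
      ∀ (T : Type u) [TopologicalSpace T] [DiscreteTopology T], #T < compL X →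
        SMAP (smallMaps (Cube n × T) Aᶜ)) : IsStrongZSet A := by
  rcases isEmpty_or_nonempty X with hE | hE
  · exact isStrongZSet_of_isEmpty A
  refine isStrongZSet_of_avoidsCubes R hA hX fun n S hS g => ?_
  rcases coveringDim_cases X with ⟨d, hd, hdX⟩ | hd
  · refine famCanAvoid_cube_of_smap R hA (compL_mem X).1 (Or.inl hdX) (le_max_right 1 d)
      (h (max 1 d) (le_max_left _ _) ?_) hS g
    rw [hd]
    exact_mod_cast le_rfl
  · refine famCanAvoid_cube_of_smap R hA (compL_mem X).1 (Or.inr (coveringDimLE_cube n))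
      (le_max_right 1 _) (h _ (le_max_left _ _) ?_) hS g
    rw [hd]
    exact le_max_of_le_right le_top

end CubeFamilies

end StrongZ

namespace StrongZ

/-! ### The telescope -/

section Telescope

variable {X : Type*} [MetricSpace X] {E : Type*} [NormedAddCommGroup E] [NormedSpace ℝ E]
  {A : Set X}

/-- A map `f` is pushed off `A` although it factors only piecewise, over the sets `|φ - n| ≤ 1`,
through test spaces `M n`.  The maps `h n` of the test spaces, once pushed off `A`, are joined by
straight-line homotopies parametrized by the further test spaces `K n`, and these have to be pushed
off `A` as well. -/
theorem canAvoid_of_telescope (R : ConvexRetract X E) (hA : IsClosed A) {M K : ℕ → Type*}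
    [∀ n, TopologicalSpace (M n)] [∀ n, TopologicalSpace (K n)] (a : X) {ρ R₀ : ℝ} (hR₀ : 0 < R₀)
    (hR₀ρ : R₀ ≤ ρ) (hR : ∀ e ∈ R.C, dist e (R.emb a) ≤ R₀ → e ∈ R.S ∧ dist (R.r e) a ≤ ρ)
    (HM : ∀ g : ∀ n, C(M n, X), (∀ n z, g n z ∈ Metric.closedBall a ρ) → FamCanAvoid A g)
    (HK : ∀ g : ∀ n, C(K n, X), (∀ n z, g n z ∈ Metric.closedBall a ρ) → FamCanAvoid A g)
    (p₀ : ∀ n, C(K n, M n)) (p₁ : ∀ n, C(K n, M (n + 1))) (s : ∀ n, C(K n, unitInterval))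
    {Y : Type*} [TopologicalSpace Y] (f : C(Y, X))
    (H : ∀ ε : X → ℝ, IsControl ε → ∃ (φ : C(Y, ℝ)) (h : ∀ n, C(M n, X)) (p : ∀ n, C(Y, M n))
      (P : ∀ n, C(Y × unitInterval, K n)), (∀ y, 0 ≤ φ y) ∧
      (∀ n z, h n z ∈ Metric.closedBall a (R₀ / 2)) ∧ (∀ n q, p₀ n (P n q) = p n q.1) ∧
      (∀ n q, p₁ n (P n q) = p (n + 1) q.1) ∧ (∀ n q, s n (P n q) = q.2) ∧
      ∀ (n : ℕ) y, |φ y - n| ≤ 1 → dist (h n (p n y)) (f y) < ε (f y)) : CanAvoid A f := by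
  intro δ hδ
  obtain ⟨δ₁, hδ₁, -, hR₁⟩ := R.exists_control hδ
  obtain ⟨δ₂, hδ₂, hδ₂₁, hR₂⟩ := R.exists_control (hδ₁.div (c := 4) (by norm_num))
  obtain ⟨φ, h, p, P, hφ, hh, hP₀, hP₁, hPs, hhp⟩ := H _ (hδ₂.div (c := 4) (by norm_num))
  obtain ⟨h', hh', hA'⟩ := HM h (fun n z => Metric.closedBall_subset_closedBall (by linarith)
    (hh n z)) _ ((hδ₂.div (c := 8) (by norm_num)).min (IsControl.const (half_pos hR₀)))
  have hball : ∀ n z, R.emb (h' n z) ∈ R.C ∩ Metric.closedBall (R.emb a) R₀ := fun n z => by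
    refine ⟨R.emb_mem_C _, ?_⟩
    rw [Metric.mem_closedBall, R.isometry_emb.dist_eq]
    have h1 : dist (h n z) a ≤ R₀ / 2 := hh n z
    have h2 := (hh' n z).trans_le (min_le_right _ _)
    have h3 := dist_triangle_left (h' n z) a (h n z)
    linarith
  have hp' : ∀ (n : ℕ) y, |φ y - n| ≤ 1 → dist (h' n (p n y)) (f y) < δ₂ (f y) := fun n y hy => by
    have h1 := hhp n y hy
    have h2 := (hh' n (p n y)).trans_le (min_le_left _ _)
    have h3 := hδ₂.le_add (h n (p n y)) (f y)
    have h4 := dist_triangle_left (h' n (p n y)) (f y) (h n (p n y))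
    linarith [hδ₂.pos (f y)]
  -- the homotopies from `h' n` to `h' (n + 1)`
  have hseg : ∀ n k, R.emb (h' n (p₀ n k)) + (s n k : ℝ) •
      (R.emb (h' (n + 1) (p₁ n k)) - R.emb (h' n (p₀ n k))) ∈
        R.C ∩ Metric.closedBall (R.emb a) R₀ := fun n k =>
    (R.convex_closedBall _ _).add_smul_sub_mem (hball _ _) (hball _ _) (s n k).2
  let c : ∀ n, C(K n, X) := fun n => ⟨fun k => R.r (R.emb (h' n (p₀ n k)) + (s n k : ℝ) •
      (R.emb (h' (n + 1) (p₁ n k)) - R.emb (h' n (p₀ n k)))), R.continuous_r_comp (by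
        have h1 := R.continuous_emb.comp ((h' n).comp (p₀ n)).continuous
        have h2 := R.continuous_emb.comp ((h' (n + 1)).comp (p₁ n)).continuous
        have h3 := continuous_subtype_val.comp (s n).continuous
        exact h1.add (h3.smul (h2.sub h1)))
      fun k => (hR _ (hseg n k).1 (hseg n k).2).1⟩
  obtain ⟨η, hη, hηA⟩ := exists_control_avoiding hA isClosed_closure hA'
  obtain ⟨η', hη', -, hR'⟩ := R.exists_control hη
  obtain ⟨c', hc', hcA'⟩ := HK c (fun n k => (hR _ (hseg n k).1 (hseg n k).2).2) _
    ((hδ₁.div (c := 8) (by norm_num)).min hη')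
  have hcP : ∀ (n : ℕ) y t, n ≤ φ y → φ y ≤ n + 1 →
      dist (c' n (P n (y, t))) (f y) < δ₁ (f y) := fun n y t h0 h1 => by
    have h2 : ∀ m : ℕ, |φ y - m| ≤ 1 → R.emb (h' m (p m y)) ∈
        R.C ∩ Metric.ball (R.emb (f y)) (δ₂ (f y)) := fun m hm =>
      ⟨R.emb_mem_C _, by rw [Metric.mem_ball, R.isometry_emb.dist_eq]; exact hp' m y hm⟩
    have h3 := (R.convex_ball _ _).add_smul_sub_mem
      (h2 n (abs_le.2 ⟨by linarith, by linarith⟩))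
      (h2 (n + 1) (abs_le.2 ⟨by push_cast; linarith, by push_cast; linarith⟩)) t.2
    have h4 : dist (c n (P n (y, t))) (f y) < δ₁ (f y) / 4 := by
      have := (hR₂ _ _ h3.1 h3.2).2
      simp only [c, ContinuousMap.coe_mk, hP₀, hP₁, hPs]
      exact this
    have h5 := (hc' n (P n (y, t))).trans_le (min_le_left _ _)
    have h6 := hδ₁.le_add (c n (P n (y, t))) (f y)
    have h7 := dist_triangle_left (c' n (P n (y, t))) (f y) (c n (P n (y, t)))
    linarith [hδ₁.pos (f y)]
  let α : ℕ → C(Y, ℝ) := fun n => ⟨fun y => clamp (1 - 3 * |φ y - n|), by fun_prop⟩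
  let γ : ℕ → C(Y, ℝ) := fun n =>
    ⟨fun y => min (clamp (3 * (φ y - n))) (clamp (3 * (n + 1 - φ y))), by fun_prop⟩
  let σ : ℕ → C(Y, unitInterval) := fun n =>
    ⟨fun y => ⟨clamp (3 * (φ y - n) - 1), clamp_nonneg _, clamp_le_one _⟩, by fun_prop⟩
  let G : Y → E := fun y => ∑ᶠ n, (α n y • R.emb (h' n (p n y)) +
    γ n y • R.emb (c' n (P n (y, σ n y))))
  have hzero : ∀ (n : ℕ) y, (φ y ≤ n - 1 ∨ n + 1 ≤ φ y) → α n y = 0 ∧ γ n y = 0 := fun n y hy => by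
    constructor
    · refine clamp_of_le ?_
      rcases hy with hy | hy
      · rw [abs_of_nonpos] <;> linarith
      · rw [abs_of_nonneg] <;> linarith
    · rcases hy with hy | hy
      · have : clamp (3 * (φ y - n)) = 0 := clamp_of_le (by linarith)
        exact (congrArg (min · _) this).trans (min_eq_left (clamp_nonneg _))
      · have : clamp (3 * (n + 1 - φ y)) = 0 := clamp_of_le (by linarith)
        exact (congrArg (min _) this).trans (min_eq_right (clamp_nonneg _))
  have hGc : Continuous G := by
    refine continuous_finsum (fun n => ?_) fun y => ⟨{y' | φ y' < φ y + 1},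
      (isOpen_lt φ.continuous continuous_const).mem_nhds (by simp), ?_⟩
    · have h1 := R.continuous_emb.comp ((h' n).comp (p n)).continuous
      have h2 : Continuous fun y => R.emb (c' n (P n (y, σ n y))) :=
        R.continuous_emb.comp ((c' n).comp ((P n).comp
          ((ContinuousMap.id Y).prodMk (σ n)))).continuous
      exact ((α n).continuous.smul h1).add ((γ n).continuous.smul h2)
    · refine (finite_Iic ⌊φ y + 2⌋₊).subset ?_
      rintro n ⟨y', hy', hlt⟩
      have hlt : φ y' < φ y + 1 := hlt
      refine Nat.le_floor ?_
      by_contra! hn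
      obtain ⟨h1, h2⟩ := hzero n y' (Or.inl (by linarith))
      exact hy' (by simp only [h1, h2, zero_smul, add_zero])
  have hG : ∀ y, ∃ (n m : ℕ) (t : ℝ), t ∈ Icc (0 : ℝ) 1 ∧ |φ y - m| ≤ 1 ∧ n ≤ φ y ∧ φ y ≤ n + 1 ∧
      G y = R.emb (h' m (p m y)) +
        t • (R.emb (c' n (P n (y, σ n y))) - R.emb (h' m (p m y))) ∧
      (t = 1 ∨ c n (P n (y, σ n y)) = h' m (p m y)) := fun y => by
    obtain ⟨n, hn0, hn1⟩ : ∃ n : ℕ, n ≤ φ y ∧ φ y < n + 1 :=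
      ⟨⌊φ y⌋₊, Nat.floor_le (hφ y), Nat.lt_floor_add_one _⟩
    have hγ1 : γ (n + 1) y = 0 := by
      have : clamp (3 * (φ y - (n + 1 : ℕ))) = 0 := clamp_of_le (by push_cast; linarith)
      exact (congrArg (min · _) this).trans (min_eq_left (clamp_nonneg _))
    have hGy : G y = α n y • R.emb (h' n (p n y)) + γ n y • R.emb (c' n (P n (y, σ n y))) +
        α (n + 1) y • R.emb (h' (n + 1) (p (n + 1) y)) := by
      refine (finsum_eq_sum_of_support_subset (s := {n, n + 1}) _ fun m hm => ?_).trans ?_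
      · by_contra hmn
        obtain ⟨h1, h2⟩ := hzero m y (by
          simp only [Finset.coe_insert, Finset.coe_singleton, mem_insert_iff, mem_singleton_iff,
            not_or] at hmn
          rcases lt_or_gt_of_ne hmn.1 with h | h
          · right
            have : (m : ℝ) + 1 ≤ n := by exact_mod_cast h
            linarith
          · left
            have : (n : ℝ) + 2 ≤ m := by exact_mod_cast (show n + 2 ≤ m by omega)
            linarith)
        exact hm (by simp only [h1, h2, zero_smul, add_zero])
      · rw [Finset.sum_pair (by omega), hγ1, zero_smul, add_zero]
    have hαn : α n y = clamp (1 - 3 * (φ y - n)) := by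
      change clamp (1 - 3 * |φ y - n|) = _
      rw [abs_of_nonneg (by linarith)]
    have hαn1 : α (n + 1) y = clamp (3 * (φ y - n) - 2) := by
      change clamp (1 - 3 * |φ y - (n + 1 : ℕ)|) = _
      rw [abs_of_nonpos (by push_cast; linarith)]
      congr 1; push_cast; ring
    have hγn : γ n y = min (clamp (3 * (φ y - n))) (clamp (3 * (n + 1 - φ y))) := rfl
    have hc0 : ∀ q, c n q = R.r (R.emb (h' n (p₀ n q)) + (s n q : ℝ) •
      (R.emb (h' (n + 1) (p₁ n q)) - R.emb (h' n (p₀ n q)))) := fun q => rfl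
    rcases le_total (φ y - n) (1 / 3) with h1 | h1
    · have hσ : σ n y = 0 := Subtype.ext (clamp_of_le (by linarith))
      refine ⟨n, n, 3 * (φ y - n), ⟨by linarith, by linarith⟩, abs_le.2 ⟨by linarith, by linarith⟩,
        hn0, hn1.le, ?_, Or.inr ?_⟩
      · rw [hGy, hαn, hαn1, hγn, clamp_of_mem (by linarith) (by linarith),
          clamp_of_le (t := 3 * (φ y - n) - 2) (by linarith),
          clamp_of_mem (t := 3 * (φ y - n)) (by linarith) (by linarith),
          clamp_of_ge (by linarith), min_eq_left (by linarith)]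
        module
      · rw [hc0, hPs, hP₀, hσ]
        simp [R.r_emb]
    rcases le_total (φ y - n) (2 / 3) with h2 | h2
    · refine ⟨n, n, 1, ⟨zero_le_one, le_rfl⟩, abs_le.2 ⟨by linarith, by linarith⟩,
        hn0, hn1.le, ?_, Or.inl rfl⟩
      rw [hGy, hαn, hαn1, hγn, clamp_of_le (t := 1 - 3 * (φ y - n)) (by linarith),
        clamp_of_le (t := 3 * (φ y - n) - 2) (by linarith),
        clamp_of_ge (t := 3 * (φ y - n)) (by linarith), clamp_of_ge (by linarith), min_self]
      module
    · have hσ : σ n y = 1 := Subtype.ext (clamp_of_ge (by linarith))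
      refine ⟨n, n + 1, 3 * (n + 1 - φ y), ⟨by linarith, by linarith⟩,
        abs_le.2 ⟨by push_cast; linarith, by push_cast; linarith⟩, hn0, hn1.le, ?_, Or.inr ?_⟩
      · rw [hGy, hαn, hαn1, hγn, clamp_of_le (t := 1 - 3 * (φ y - n)) (by linarith),
          clamp_of_mem (t := 3 * (φ y - n) - 2) (by linarith) (by linarith),
          clamp_of_ge (t := 3 * (φ y - n)) (by linarith),
          clamp_of_mem (by linarith) (by linarith), min_eq_right (by linarith)]
        module
      · rw [hc0, hPs, hP₀, hP₁, hσ]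
        simp [R.r_emb]
  have hGS : ∀ y, G y ∈ R.S ∧ dist (R.r (G y)) (f y) < δ (f y) := fun y => by
    obtain ⟨n, m, t, ht, hm, hn0, hn1, hGy, -⟩ := hG y
    have h1 := (R.convex_ball (R.emb (f y)) (δ₁ (f y))).add_smul_sub_mem
      (x := R.emb (h' m (p m y))) (y := R.emb (c' n (P n (y, σ n y))))
      ⟨R.emb_mem_C _, by
        rw [Metric.mem_ball, R.isometry_emb.dist_eq]
        have := hδ₂₁ (f y)
        linarith [hp' m y hm, hδ₁.pos (f y)]⟩
      ⟨R.emb_mem_C _, by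
        rw [Metric.mem_ball, R.isometry_emb.dist_eq]; exact hcP n y _ hn0 hn1⟩ ht
    rw [hGy]
    exact hR₁ _ _ h1.1 h1.2
  refine ⟨⟨fun y => R.r (G y), R.continuous_r_comp hGc fun y => (hGS y).1⟩,
    fun y => (dist_comm _ _).trans_lt (hGS y).2, ?_⟩
  have hsub : (range fun y => R.r (G y)) ⊆
      {v | ∃ u ∈ closure (⋃ n, range (h' n)), dist u v < η u} ∪ ⋃ n, range (c' n) := by
    rintro _ ⟨y, rfl⟩
    obtain ⟨n, m, t, ht, hm, hn0, hn1, hGy, rfl | hx⟩ := hG y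
    · refine Or.inr (mem_iUnion.2 ⟨n, P n (y, σ n y), ?_⟩)
      dsimp only
      rw [hGy, one_smul, add_sub_cancel, R.r_emb]
    · refine Or.inl ⟨h' m (p m y), subset_closure (mem_iUnion.2 ⟨m, _, rfl⟩), ?_⟩
      have h1 := (hc' n (P n (y, σ n y))).trans_le (min_le_right _ _)
      rw [hx, dist_comm] at h1
      have h2 := (R.convex_ball (R.emb (h' m (p m y))) (η' (h' m (p m y)))).add_smul_sub_mem
        (x := R.emb (h' m (p m y))) (y := R.emb (c' n (P n (y, σ n y))))
        ⟨R.emb_mem_C _, Metric.mem_ball_self (hη'.pos _)⟩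
        ⟨R.emb_mem_C _, by rw [Metric.mem_ball, R.isometry_emb.dist_eq]; exact h1⟩ ht
      dsimp only
      rw [dist_comm, hGy]
      exact (hR' _ _ h2.1 h2.2).2
  refine Disjoint.mono_right (closure_mono hsub) ?_
  rw [closure_union]
  exact disjoint_union_right.2 ⟨hηA _ fun v hv => hv, hcA'⟩

end Telescope

end StrongZ

namespace StrongZ

/-! ### Sequences of cubes -/

section CubeSequences

variable {X : Type*} [MetricSpace X] {E : Type*} [NormedAddCommGroup E] [NormedSpace ℝ E]
  {A : Set X}

/-- Locally at the points of `A`, sequences of maps of the cubes `I^1, I^2, …` can be pushed off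
`A`. -/
def AvoidsCubeSequences (A : Set X) : Prop :=
  ∀ a ∈ A, ∃ ρ > 0, ∀ g : ∀ n : ℕ, C(Cube (n + 1), X),
    (∀ n z, g n z ∈ Metric.closedBall a ρ) → FamCanAvoid A g

theorem famCanAvoid_of_sigma {S : Type*} {Z : S → Type*} [∀ s, TopologicalSpace (Z s)]
    {f : C(Σ s, Z s, X)} (hf : CanAvoid A f) :
    FamCanAvoid A fun s => f.comp (ContinuousMap.sigmaMk s) := fun δ hδ => by
  obtain ⟨g, hg, hgA⟩ := hf δ hδ
  refine ⟨fun s => g.comp (ContinuousMap.sigmaMk s), fun s z => hg ⟨s, z⟩,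
    hgA.mono_right (closure_mono (iUnion_subset fun s => ?_))⟩
  rintro _ ⟨z, rfl⟩
  exact ⟨_, rfl⟩

theorem SMAP.exists_famCanAvoid_sigma {S : Type*} {Z : S → Type*} [∀ s, TopologicalSpace (Z s)]
    (h : SMAP (smallMaps (Σ s, Z s) Aᶜ)) (a : X) :
    ∃ ρ > 0, ∀ g : ∀ s, C(Z s, X), (∀ s z, g s z ∈ Metric.closedBall a ρ) → FamCanAvoid A g := by
  obtain ⟨ρ, hρ, h⟩ := h.exists_canAvoid a
  exact ⟨ρ, hρ, fun g hg => famCanAvoid_of_sigma (f := ⟨fun x => g x.1 x.2,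
    continuous_sigma fun s => (g s).continuous⟩) (h _ fun x => hg x.1 x.2)⟩

theorem avoidsCubeSequences_of_cubeSum (h : SMAP (smallMaps CubeSum Aᶜ)) :
    AvoidsCubeSequences A := fun a _ => h.exists_famCanAvoid_sigma a

/-- Families of maps can be pushed off `A` if their domains are retracts of distinct members of a
family of spaces for which this holds. -/
theorem famCanAvoid_of_retracts {S S' : Type*} {Z : S → Type*} {Z' : S' → Type*}
    [∀ s, TopologicalSpace (Z s)] [∀ s, TopologicalSpace (Z' s)] {B : Set X}
    (h : ∀ g : ∀ s, C(Z s, X), (∀ s z, g s z ∈ B) → FamCanAvoid A g) {m : S' → S}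
    (hm : Function.Injective m) (i : ∀ s, C(Z' s, Z (m s))) (p : ∀ s, C(Z (m s), Z' s))
    (hip : ∀ s z, p s (i s z) = z) {b : X} (hb : b ∈ B) (g : ∀ s, C(Z' s, X))
    (hg : ∀ s z, g s z ∈ B) : FamCanAvoid A g := by
  classical
  have hG : ∀ s, ∃ G : C(Z s, X), (∀ z, G z ∈ B) ∧
      ∀ s' (hs : m s' = s) z, G (hs ▸ i s' z) = g s' z := fun s => by
    by_cases hs : ∃ s', m s' = s
    · obtain ⟨s', rfl⟩ := hs
      refine ⟨(g s').comp (p s'), fun z => hg _ _, fun t ht z => ?_⟩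
      obtain rfl := hm ht
      exact congrArg (g t) (hip t z)
    · exact ⟨.const _ b, fun _ => hb, fun s' hs' => (hs ⟨s', hs'⟩).elim⟩
  choose G hGB hGg using hG
  intro δ hδ
  obtain ⟨G', hG', hA'⟩ := h G hGB δ hδ
  refine ⟨fun s => (G' (m s)).comp (i s), fun s z => ?_,
    hA'.mono_right (closure_mono (iUnion_subset fun s => ?_))⟩
  · have h1 := hG' (m s) (i s z)
    rwa [show G (m s) (i s z) = g s z from hGg (m s) s rfl z] at h1
  · rintro _ ⟨z, rfl⟩
    exact mem_iUnion.2 ⟨m s, _, rfl⟩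

theorem exists_cube_prod_retract (k l n : ℕ) (h : k + l + 1 = n) :
    ∃ (i : C(Cube k × Cube l × unitInterval, Cube n)) (p : C(Cube n, Cube k × Cube l × unitInterval)),
      ∀ z, p (i z) = z := by
  let e : Fin k ⊕ Fin l ⊕ Fin 1 ≃ Fin n := Fintype.equivFinOfCardEq (by simp; omega)
  refine ⟨⟨fun z j => Sum.elim z.1 (Sum.elim z.2.1 fun _ => z.2.2) (e.symm j),
    continuous_pi fun j => ?_⟩, ⟨fun z => (fun j => z (e (.inl j)), fun j => z (e (.inr (.inl j))),
      z (e (.inr (.inr 0)))), by fun_prop⟩, fun z => by simp⟩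
  rcases e.symm j with j | j | j <;> simp only [Sum.elim_inl, Sum.elim_inr] <;> fun_prop

/-- The telescope is applied to a small closed ball, which is separable. Where the partition of unity
subordinate to a countable cover involves only the first indices, the inclusion of the ball factors
approximately through a cube. -/
theorem isStrongZSet_of_avoidsCubeSequences (R : ConvexRetract X E) (hA : IsClosed A)
    (hX : LocallySeparable X) (H : AvoidsCubeSequences A) : IsStrongZSet A := by
  refine isStrongZSet_of_inclusion R hA fun a ha => ?_
  obtain ⟨ρ, hρ, H⟩ := H a ha
  obtain ⟨R₀, hR₀, hR₀ρ, hR⟩ := R.exists_radius a hρ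
  obtain ⟨R₁, hR₁, hR₁₀, hR'⟩ := R.exists_radius a (half_pos hR₀)
  obtain ⟨G, hG, hGs⟩ := hX a
  obtain ⟨ρ', hρ', hρ'G⟩ := Metric.nhds_basis_closedBall.mem_iff.1 hG
  have haρ : a ∈ Metric.closedBall a ρ := Metric.mem_closedBall_self hρ.le
  refine ⟨min ρ' R₁, lt_min hρ' hR₁, ?_⟩
  set F := Metric.closedBall a (min ρ' R₁) with hFdef
  have hFs : SeparableSpace F := ((TopologicalSpace.IsSeparable.of_subtype G).mono
    ((Metric.closedBall_subset_closedBall (min_le_left _ _)).trans hρ'G)).separableSpace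
  have : SecondCountableTopology F := UniformSpace.secondCountable_of_separable F
  have hne : Nonempty F := ⟨⟨a, Metric.mem_closedBall_self (lt_min hρ' hR₁).le⟩⟩
  choose i p hip using fun n : ℕ => exists_cube_prod_retract (n + 2) (n + 1 + 2) (2 * n + 5 + 1)
    (by ring)
  refine canAvoid_of_telescope R hA (M := fun n => Cube (n + 2))
    (K := fun n => Cube (n + 2) × Cube (n + 1 + 2) × unitInterval) a hR₀ hR₀ρ hR
    (famCanAvoid_of_retracts H (m := fun n => n + 1) (add_left_injective 1)
      (fun n => ContinuousMap.id _) (fun n => ContinuousMap.id _) (fun _ _ => rfl) haρ)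
    (famCanAvoid_of_retracts H (m := fun n => 2 * n + 5) (fun m n h => by
      dsimp only at h; omega) i p hip haρ)
    (fun n => ⟨fun k => k.1, by fun_prop⟩) (fun n => ⟨fun k => k.2.1, by fun_prop⟩)
    (fun n => ⟨fun k => k.2.2, by fun_prop⟩) (inclusion F) fun ε hε => ?_
  obtain ⟨ε', hε', -, hRε⟩ := R.exists_control hε
  obtain ⟨𝒰, h𝒰, hs⟩ := exists_cov_of_control hε'
  -- a countable cover by small sets, a partition of unity, and a bound `N` for the indices
  obtain ⟨W, hWo, hWc, hW⟩ : ∃ W : ℕ → Set F, (∀ n, IsOpen (W n)) ∧ ⋃ n, W n = univ ∧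
      ∀ n, ∀ y ∈ W n, ∀ y' ∈ W n, dist (inclusion F y) (inclusion F y') < ε' (inclusion F y) := by
    choose U hU hyU using fun y : F => (h𝒰.2.symm ▸ mem_univ y.1 : y.1 ∈ ⋃₀ 𝒰)
    have hUo : ∀ y, IsOpen ((↑) ⁻¹' U y : Set F) := fun y =>
      (h𝒰.1 _ (hU y)).preimage continuous_subtype_val
    obtain ⟨t, htc, ht⟩ := TopologicalSpace.countable_cover_nhds fun y => (hUo y).mem_nhds (hyU y)
    have htn : t.Nonempty := by
      obtain ⟨y⟩ := hne
      obtain ⟨z, hz, -⟩ := mem_iUnion₂.1 (ht.symm ▸ mem_univ y)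
      exact ⟨z, hz⟩
    obtain ⟨e, rfl⟩ := htc.exists_eq_range htn
    exact ⟨fun n => (↑) ⁻¹' U (e n), fun n => hUo _, by rwa [biUnion_range] at ht,
      fun n y hy y' hy' => hs _ (hU (e n)) _ hy _ hy'⟩
  obtain ⟨χ, hχ⟩ := PartitionOfUnity.exists_isSubordinate isClosed_univ W hWo hWc.ge
  obtain ⟨v, hv, hvF⟩ := R.exists_vertices (inclusion F) hW
  have hlf : LocallyFinite fun n => tsupport (χ n) := χ.locallyFinite.closure
  let N : F → ℕ := fun y => (hlf.point_finite y).toFinset.sup id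
  have hN : ∀ y n, χ n y ≠ 0 → n ≤ N y := fun y n hn =>
    Finset.le_sup (f := id) ((hlf.point_finite y).mem_toFinset.2 (subset_tsupport _ hn))
  obtain ⟨φ, hφ⟩ := exists_continuous_index (N := N) fun y => by
    filter_upwards [hlf.eventually_subset (fun n => isClosed_tsupport _) y] with y' hy'
    exact Finset.sup_mono (Set.Finite.toFinset_subset_toFinset.2 hy')
  have hvC : ∀ n, v n ∈ R.C ∩ Metric.closedBall (R.emb a) R₁ := fun n => by
    obtain ⟨_, ⟨y, rfl⟩, hy⟩ := hvF n
    rw [← hy]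
    refine ⟨R.emb_mem_C _, ?_⟩
    rw [Metric.mem_closedBall, R.isometry_emb.dist_eq]
    exact (Metric.mem_closedBall.1 y.2).trans (min_le_right _ _)
  have hcone : ∀ n (w : Cube (n + 2)), coneAverage (fun j : Fin (n + 2) => v j) (R.emb a) w ∈
      R.C ∩ Metric.closedBall (R.emb a) R₁ := fun n w =>
    coneAverage_mem (v := fun j : Fin (n + 2) => v j) (R.convex_closedBall _ _) (fun j => hvC j)
      ⟨R.emb_mem_C _, Metric.mem_closedBall_self hR₁.le⟩ w
  let p : ∀ n, C(F, Cube (n + 2)) := fun n =>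
    ⟨fun y j => ⟨χ j y, χ.nonneg _ _, χ.le_one _ _⟩, by fun_prop⟩
  refine ⟨φ, fun n => ⟨fun w => R.r (coneAverage (fun j : Fin (n + 2) => v j) (R.emb a) w),
    R.continuous_r_comp (continuous_coneAverage _ _) fun w =>
      (hR' _ (hcone n w).1 (hcone n w).2).1⟩, p,
    fun n => ⟨fun q => (p n q.1, p (n + 1) q.1, q.2), by fun_prop⟩,
    fun y => (Nat.cast_nonneg _).trans (hφ y),
    fun n w => (hR' _ (hcone n w).1 (hcone n w).2).2, fun _ _ => rfl, fun _ _ => rfl,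
    fun _ _ => rfl, fun n y hy => ?_⟩
  have hNn : ∀ k, χ k y ≠ 0 → k < n + 2 := fun k hk => by
    have h1 : (N y : ℝ) ≤ n + 1 := (hφ y).trans (by linarith [(abs_le.1 hy).2])
    have h2 : N y ≤ n + 1 := by exact_mod_cast h1
    have := hN y k hk
    omega
  have hsum : ∑ j : Fin (n + 2), (p n y j : ℝ) = 1 := by
    rw [← χ.sum_eq_one (mem_univ y), finsum_eq_sum_of_support_subset (s := Finset.range (n + 2)) _
      fun k hk => by simpa using hNn k hk, Finset.sum_range]
    rfl
  have hmem : coneAverage (fun j : Fin (n + 2) => v j) (R.emb a) (p n y) ∈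
      R.C ∩ Metric.ball (R.emb y) (ε' y) := by
    rw [coneAverage_of_sum_eq_one _ _ hsum, ← finsum_eq_sum_of_fintype]
    refine (R.convex_ball _ _).finsum_mem (fun j => (p n y j).2.1)
      (by rw [finsum_eq_sum_of_fintype]; exact hsum) fun j hj => hv j y (hχ j (subset_tsupport _ hj))
  exact (hRε _ _ hmem.1 hmem.2).2

/-- Sequences of maps of cubes into a small ball extend to the Hilbert cube without the point `q`,
where the cubes are embedded as a discrete family of closed sets converging to `q`. -/
theorem avoidsCubeSequences_of_punctured (R : ConvexRetract X E) {q : HilbertCube}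
    (h : SMAP (smallMaps {z : HilbertCube // z ≠ q} Aᶜ)) : AvoidsCubeSequences A := by
  intro a _
  obtain ⟨ρ, hρ, H⟩ := h.exists_canAvoid a
  obtain ⟨R₀, hR₀, hR₀ρ, hR⟩ := R.exists_radius a hρ
  refine ⟨R₀, hR₀, fun g hg => ?_⟩
  let far : ℕ → unitInterval := fun n => if (q n : ℝ) ≤ 1 / 2 then 1 else 0
  have hfar : ∀ n, 1 / 2 ≤ |(far n : ℝ) - q n| := fun n => by
    simp only [far]
    split_ifs with h
    · rw [abs_of_nonneg] <;> simp <;> linarith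
    · rw [abs_of_nonpos] <;> simp <;> linarith
  -- the copy of `I^(n+1)`: its points agree with `q` up to the `n`-th coordinate, which is far
  -- from that of `q`
  let i : ∀ n, C(Cube (n + 1), {z : HilbertCube // z ≠ q}) := fun n =>
    ⟨fun x => ⟨fun k => if k < n then q k else if k = n then far n else
      if hk : k - (n + 1) < n + 1 then x ⟨k - (n + 1), hk⟩ else 0, fun h => by
        have h1 := hfar n
        have h2 := congrFun h n
        simp only [lt_irrefl, if_false, if_true] at h2
        rw [h2, sub_self, abs_zero] at h1
        linarith⟩, by
      refine Continuous.subtype_mk (continuous_pi fun k => ?_) _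
      split_ifs <;> fun_prop⟩
  let π : ∀ n, C({z : HilbertCube // z ≠ q}, Cube (n + 1)) := fun n =>
    ⟨fun z j => z.1 (n + 1 + j), continuous_pi fun j =>
      (continuous_apply _).comp continuous_subtype_val⟩
  have hπ : ∀ n x, π n (i n x) = x := fun n x => funext fun j => by
    change (if n + 1 + (j : ℕ) < n then _ else if n + 1 + (j : ℕ) = n then _ else
      if hk : n + 1 + (j : ℕ) - (n + 1) < n + 1 then x ⟨n + 1 + (j : ℕ) - (n + 1), hk⟩ else 0) = x j
    rw [if_neg (by omega), if_neg (by omega), dif_pos (by omega)]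
    congr 1
    exact Fin.ext (by simp)
  have hcoord : ∀ k, Continuous fun z : {z : HilbertCube // z ≠ q} => (z.1 k : ℝ) := fun k =>
    continuous_subtype_val.comp ((continuous_apply k).comp continuous_subtype_val)
  let ψ : ℕ → {z : HilbertCube // z ≠ q} → ℝ := fun n z =>
    clamp (4 * |(z.1 n : ℝ) - q n| - 1) *
      ∏ j ∈ Finset.range n, clamp (1 - (n + 4) * |(z.1 j : ℝ) - q j|)
  have hψc : ∀ n, Continuous (ψ n) := fun n => by
    have h1 := hcoord n
    refine Continuous.mul (by fun_prop) (continuous_finsetProd _ fun j _ => ?_)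
    have h2 := hcoord j
    fun_prop
  have hψ01 : ∀ n z, ψ n z ∈ Icc (0 : ℝ) 1 := fun n z =>
    ⟨mul_nonneg (clamp_nonneg _) (Finset.prod_nonneg fun _ _ => clamp_nonneg _),
      mul_le_one₀ (clamp_le_one _) (Finset.prod_nonneg fun _ _ => clamp_nonneg _)
        (Finset.prod_le_one (fun _ _ => clamp_nonneg _) fun _ _ => clamp_le_one _)⟩
  have hψ1 : ∀ n x, ψ n (i n x) = 1 := fun n x => by
    have h1 : ((i n x).1 n : ℝ) = far n := by simp [i]
    have h2 : ∀ j < n, ((i n x).1 j : ℝ) = q j := fun j hj => by simp [i, hj]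
    simp only [ψ]
    rw [h1, clamp_of_ge (by linarith [hfar n]), one_mul]
    refine Finset.prod_eq_one fun j hj => ?_
    rw [h2 j (Finset.mem_range.1 hj)]
    simp [clamp]
  have hψn : ∀ n z, ψ n z ≠ 0 → 1 / 4 < |(z.1 n : ℝ) - q n| ∧
      ∀ j < n, (n + 4) * |(z.1 j : ℝ) - q j| < 1 := fun n z hz => by
    constructor
    · by_contra! hle
      exact hz (by simp only [ψ]; rw [clamp_of_le (by linarith), zero_mul])
    · intro j hj
      by_contra! hle
      refine hz ?_
      simp only [ψ]
      rw [Finset.prod_eq_zero (Finset.mem_range.2 hj) (clamp_of_le (by linarith)), mul_zero]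
  have hdisj : ∀ z m n, ψ m z ≠ 0 → ψ n z ≠ 0 → m = n := by
    have : ∀ z m n, ψ m z ≠ 0 → ψ n z ≠ 0 → ¬ m < n := fun z m n hm hn hlt => by
      have h1 := (hψn m z hm).1
      have h2 := (hψn n z hn).2 m hlt
      have h3 : (0 : ℝ) ≤ n := Nat.cast_nonneg n
      nlinarith
    exact fun z m n hm hn => le_antisymm (not_lt.1 (this z n m hn hm)) (not_lt.1 (this z m n hm hn))
  let G : {z : HilbertCube // z ≠ q} → E := fun z =>
    R.emb a + ∑ᶠ n, ψ n z • (R.emb (g n (π n z)) - R.emb a)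
  have hGc : Continuous G := by
    refine continuous_const.add (continuous_finsum (fun n => ?_) fun z => ?_)
    · exact (hψc n).smul ((R.continuous_emb.comp ((g n).comp (π n)).continuous).sub
        continuous_const)
    · obtain ⟨j, hj⟩ : ∃ j, z.1 j ≠ q j := by
        by_contra! hall
        exact z.2 (funext hall)
      have hj : 0 < |(z.1 j : ℝ) - q j| := abs_pos.2 (sub_ne_zero.2 fun h => hj (Subtype.ext h))
      have hcj := hcoord j
      refine ⟨{z' | |(z.1 j : ℝ) - q j| / 2 < |(z'.1 j : ℝ) - q j|},
        (isOpen_lt continuous_const (by fun_prop)).mem_nhds (half_lt_self hj), ?_⟩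
      refine (finite_Iic (max j ⌊2 / |(z.1 j : ℝ) - q j|⌋₊)).subset ?_
      rintro n ⟨z', hn, hz'⟩
      have hz' : |(z.1 j : ℝ) - q j| / 2 < |(z'.1 j : ℝ) - q j| := hz'
      have hn : ψ n z' ≠ 0 := fun h => hn (by simp only [h, zero_smul])
      rcases le_or_gt n j with hnj | hnj
      · exact hnj.trans (le_max_left _ _)
      · refine (Nat.le_floor ?_).trans (le_max_right _ _)
        have h1 := (hψn n z' hn).2 j hnj
        rw [le_div_iff₀ hj]
        have h3 : (0 : ℝ) ≤ n := Nat.cast_nonneg n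
        nlinarith
  have hG : ∀ z, G z ∈ R.C ∩ Metric.closedBall (R.emb a) R₀ := fun z => by
    have ha : R.emb a ∈ R.C ∩ Metric.closedBall (R.emb a) R₀ :=
      ⟨R.emb_mem_C _, Metric.mem_closedBall_self hR₀.le⟩
    by_cases hz : ∃ n, ψ n z ≠ 0
    · obtain ⟨n, hn⟩ := hz
      have : G z = R.emb a + ψ n z • (R.emb (g n (π n z)) - R.emb a) := by
        refine congrArg (R.emb a + ·) (finsum_eq_single _ n fun m hm => ?_)
        have : ψ m z = 0 := by
          by_contra hm'
          exact hm (hdisj z m n hm' hn)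
        rw [this, zero_smul]
      rw [this]
      refine (R.convex_closedBall _ _).add_smul_sub_mem ha ⟨R.emb_mem_C _, ?_⟩ (hψ01 n z)
      rw [Metric.mem_closedBall, R.isometry_emb.dist_eq]
      exact hg n _
    · push Not at hz
      have : G z = R.emb a := by simp [G, hz]
      rwa [this]
  have hGi : ∀ n x, R.r (G (i n x)) = g n x := fun n x => by
    have : G (i n x) = R.emb (g n x) := by
      have h1 : G (i n x) = R.emb a + ψ n (i n x) • (R.emb (g n (π n (i n x))) - R.emb a) := by
        refine congrArg (R.emb a + ·) (finsum_eq_single _ n fun m hm => ?_)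
        have : ψ m (i n x) = 0 := by
          by_contra hm'
          exact hm (hdisj _ m n hm' (by rw [hψ1]; exact one_ne_zero))
        rw [this, zero_smul]
      rw [h1, hψ1, hπ, one_smul, add_sub_cancel]
    rw [this, R.r_emb]
  intro δ hδ
  obtain ⟨f, hf, hfA⟩ := H ⟨fun z => R.r (G z), R.continuous_r_comp hGc fun z =>
    (hR _ (hG z).1 (hG z).2).1⟩ (fun z => (hR _ (hG z).1 (hG z).2).2) δ hδ
  refine ⟨fun n => f.comp (i n), fun n x => ?_,
    hfA.mono_right (closure_mono (iUnion_subset fun n => ?_))⟩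
  · have := hf (i n x)
    rwa [ContinuousMap.coe_mk, hGi] at this
  · rintro _ ⟨x, rfl⟩
    exact ⟨_, rfl⟩

theorem famCanAvoid_of_forall_close {S : Type*} {Z : S → Type*} [∀ s, TopologicalSpace (Z s)]
    {f : ∀ s, C(Z s, X)} (h : ∀ δ : X → ℝ, IsControl δ → ∃ g : ∀ s, C(Z s, X),
      (∀ s z, dist (f s z) (g s z) < δ (f s z)) ∧ FamCanAvoid A g) : FamCanAvoid A f :=
  fun δ hδ => by
    obtain ⟨g, hg, hgA⟩ := h _ (hδ.div (c := 4) (by norm_num))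
    obtain ⟨g', hg', hA'⟩ := hgA _ (hδ.div (c := 4) (by norm_num))
    refine ⟨g', fun s z => ?_, hA'⟩
    have h1 := hg s z
    have h2 := hg' s z
    have h3 := hδ.le_add (g s z) (f s z)
    have h4 := dist_triangle (f s z) (g s z) (g' s z)
    rw [dist_comm (g s z) (f s z)] at h3
    linarith [hδ.pos (f s z)]

theorem IsZSet.avoidsCubeSequences (hX : SDAP X) {B : Set X} (hB : IsZSet B) :
    AvoidsCubeSequences B := fun a _ => ⟨1, one_pos, fun g _ =>
  famCanAvoid_of_forall_close fun δ hδ => by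
    obtain ⟨f, hf, hfg⟩ := limitationDense_iff.1 hX
      ⟨fun x => g x.1 x.2, continuous_sigma fun n => (g n).continuous⟩ δ hδ
    exact ⟨fun n => f.comp (ContinuousMap.sigmaMk (X := fun n => Cube (n + 1)) n),
      fun n z => hfg ⟨n, z⟩,
      famCanAvoid_of_locallyFinite (DiscreteFamily.locallyFinite hf) fun n =>
        hB.canAvoid_finite_cube _⟩⟩

end CubeSequences

end StrongZ

namespace StrongZ

/-! ### Simplicial maps and the two topologies on a realization -/

section TwoTopologies

variable {T : Type u} {S : Type u} {K : PreAbstractSimplicialComplex T}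

theorem cell_mono {σ τ : Finset T} (h : σ ⊆ τ) : cell σ ⊆ cell τ :=
  convexHull_mono (image_mono (Finset.coe_subset.2 h))

theorem vertex_mem_cell {σ : Finset T} {t : T} (ht : t ∈ σ) : vertex t ∈ cell σ :=
  subset_convexHull ℝ _ ⟨t, ht, rfl⟩

section Barycenter

variable {E : Type*} [NormedAddCommGroup E] [NormedSpace ℝ E]

/-- Points of a realization which are close coordinatewise on one cell have close barycenters: as
the coordinates of both add up to `1`, those off the cell have a small sum. -/
theorem norm_barycenter_sub_le {v : T → E} {C : ℝ} (hv : ∀ t, ‖v t‖ ≤ C) {σ τ : Finset T}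
    {x x₀ : Hilb T} (hx : x ∈ cell τ) (hx₀ : x₀ ∈ cell σ) :
    ‖barycenter v x - barycenter v x₀‖ ≤ 2 * C * ∑ t ∈ σ, |x t - x₀ t| := by
  classical
  obtain ⟨h0, h1, h2⟩ := mem_cell_iff.1 (cell_mono Finset.subset_union_right hx : x ∈ cell (σ ∪ τ))
  have hsum := Finset.sum_sdiff (f := fun t => x t)
    (Finset.subset_union_left (s₁ := σ) (s₂ := τ))
  have hbary := Finset.sum_sdiff (f := fun t => x t • v t)
    (Finset.subset_union_left (s₁ := σ) (s₂ := τ))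
  have hoff : ∑ t ∈ (σ ∪ τ) \ σ, x t ≤ ∑ t ∈ σ, |x t - x₀ t| := by
    have h3 : ∑ t ∈ (σ ∪ τ) \ σ, x t = ∑ t ∈ σ, (x₀ t - x t) := by
      rw [Finset.sum_sub_distrib, (mem_cell_iff.1 hx₀).2.2]; linarith
    rw [h3]
    exact Finset.sum_le_sum fun t _ => by rw [abs_sub_comm]; exact le_abs_self _
  have h4 : barycenter v x - barycenter v x₀ =
      ∑ t ∈ (σ ∪ τ) \ σ, x t • v t + ∑ t ∈ σ, (x t - x₀ t) • v t := by
    rw [barycenter_eq_sum v (cell_mono Finset.subset_union_right hx : x ∈ cell (σ ∪ τ)),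
      barycenter_eq_sum v hx₀, ← hbary, add_sub_assoc, ← Finset.sum_sub_distrib]
    simp_rw [sub_smul]
  have h5 : ‖∑ t ∈ (σ ∪ τ) \ σ, x t • v t‖ ≤ C * ∑ t ∈ (σ ∪ τ) \ σ, x t := by
    rw [Finset.mul_sum]
    refine norm_sum_le_of_le _ fun t _ => ?_
    rw [norm_smul, Real.norm_of_nonneg (h0 t), mul_comm]
    exact mul_le_mul_of_nonneg_right (hv t) (h0 t)
  have h6 : ‖∑ t ∈ σ, (x t - x₀ t) • v t‖ ≤ C * ∑ t ∈ σ, |x t - x₀ t| := by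
    rw [Finset.mul_sum]
    refine norm_sum_le_of_le _ fun t _ => ?_
    rw [norm_smul, Real.norm_eq_abs, mul_comm]
    exact mul_le_mul_of_nonneg_right (hv t) (abs_nonneg _)
  rcases σ.eq_empty_or_nonempty with rfl | ⟨t, -⟩
  · simp [cell] at hx₀
  have hC : 0 ≤ C := (norm_nonneg _).trans (hv t)
  rw [h4]
  refine (norm_add_le _ _).trans ?_
  have := mul_le_mul_of_nonneg_left hoff hC
  linarith

theorem continuous_barycenter_metric {v : T → E} {C : ℝ} (hv : ∀ t, ‖v t‖ ≤ C) :
    Continuous fun x : realization K => barycenter v x.1 := by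
  refine continuous_iff_continuousAt.2 fun x₀ => ?_
  obtain ⟨σ, -, hσ⟩ := mem_realization_iff.1 x₀.2
  refine tendsto_iff_norm_sub_tendsto_zero.2 (squeeze_zero (fun _ => norm_nonneg _)
    (g := fun x : realization K => 2 * C * ∑ t ∈ σ, |x.1 t - x₀.1 t|) (fun x => ?_) ?_)
  · obtain ⟨τ, -, hτ⟩ := mem_realization_iff.1 x.2
    exact norm_barycenter_sub_le hv hτ hσ
  · have h1 : Continuous fun x : realization K => 2 * C * ∑ t ∈ σ, |x.1 t - x₀.1 t| :=
      continuous_const.mul (continuous_finsetSum _ fun t _ =>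
        (((continuous_coord t).comp continuous_subtype_val).sub continuous_const).abs)
    simpa using h1.tendsto x₀

end Barycenter

/-- The realization of `K`, with the weak topology if `τ` is `true` and with the metric topology if
`τ` is `false`. -/
def TopRealization (_τ : Bool) (K : PreAbstractSimplicialComplex T) : Type u := realization K

noncomputable instance (τ : Bool) : TopologicalSpace (TopRealization τ K) :=
  match τ with
  | true => inferInstanceAs (TopologicalSpace (WeakRealization K))
  | false => inferInstanceAs (TopologicalSpace (MetricRealization K))

namespace TopRealization

variable {τ : Bool}

/-- The underlying point of `ℓ²(T)`. -/
def val (x : TopRealization τ K) : Hilb T := Subtype.val (p := (· ∈ realization K)) x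

theorem val_mem (x : TopRealization τ K) : x.val ∈ realization K := Subtype.property x

theorem val_injective : Function.Injective (val : TopRealization τ K → Hilb T) :=
  Subtype.val_injective

theorem continuous_val : Continuous (val : TopRealization τ K → Hilb T) := by
  cases τ
  · exact continuous_subtype_val
  · exact WeakRealization.continuous_val

/-- The weak topology is the finer one. -/
def ofWeak (τ : Bool) (K : PreAbstractSimplicialComplex T) :
    C(WeakRealization K, TopRealization τ K) where
  toFun x := (⟨x.val, x.val_mem⟩ : realization K)
  continuous_toFun := by
    cases τ
    · exact WeakRealization.continuous_val.subtype_mk fun x => x.val_mem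
    · exact continuous_id

theorem val_ofWeak (x : WeakRealization K) : (ofWeak τ K x).val = x.val := rfl

theorem continuous_barycenter {E : Type*} [NormedAddCommGroup E] [NormedSpace ℝ E] {v : T → E}
    {C : ℝ} (hv : ∀ t, ‖v t‖ ≤ C) : Continuous fun x : TopRealization τ K => barycenter v x.val := by
  cases τ
  · exact continuous_barycenter_metric hv
  · exact continuous_barycenter_weak v

end TopRealization

theorem norm_vertex_le (t : T) : ‖vertex t‖ ≤ 1 := by
  classical
  rw [vertex, lp.norm_single (by norm_num), norm_one]

/-- The simplicial map induced by a map of vertices. -/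
theorem TopRealization.exists_simplicialMap (τ : Bool) {L : PreAbstractSimplicialComplex S}
    (α : T → S) (hα : ∀ σ ∈ K.faces, ∃ ρ ∈ L.faces, ∀ t ∈ σ, α t ∈ ρ) :
    ∃ F : C(TopRealization τ K, TopRealization τ L), ∀ x s t, (∀ t', α t' = s ↔ t' = t) →
      (F x).val s = x.val t := by
  have hcell : ∀ σ ∈ K.faces, ∃ ρ ∈ L.faces, ∀ x ∈ cell σ,
      barycenter (fun t => vertex (α t)) x ∈ cell ρ := fun σ hσ => by
    obtain ⟨ρ, hρ, hσρ⟩ := hα σ hσ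
    refine ⟨ρ, hρ, fun x hx => barycenter_mem (mem_realization_iff.2 ⟨σ, hσ, hx⟩) (convex_cell ρ)
      fun t ht => vertex_mem_cell (hσρ t ?_)⟩
    by_contra h
    exact ht ((mem_cell_iff.1 hx).2.1 t h)
  have hmem : ∀ x : realization K, barycenter (fun t => vertex (α t)) x.1 ∈ realization L :=
    fun x => by
      obtain ⟨σ, hσ, hx⟩ := mem_realization_iff.1 x.2
      obtain ⟨ρ, hρ, h⟩ := hcell σ hσ
      exact mem_realization_iff.2 ⟨ρ, hρ, h _ hx⟩
  refine ⟨⟨fun x => (⟨barycenter (fun t => vertex (α t)) x.val, hmem x⟩ : realization L), ?_⟩,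
    fun x s t hst => ?_⟩
  · have hb := continuous_barycenter (τ := τ) (K := K) (fun t => norm_vertex_le (α t))
    cases τ
    · exact hb.subtype_mk _
    · refine WeakRealization.continuous_iff.2 fun σ => ?_
      obtain ⟨ρ, hρ, h⟩ := hcell σ.1 σ.2
      exact WeakRealization.continuous_of_val
        (hb.comp (WeakRealization.continuous_cellInclusion σ)) fun y₀ =>
          ⟨ρ, Eventually.of_forall fun y => ⟨ρ, hρ, Finset.Subset.rfl, h _ y.2⟩⟩
  · classical
    obtain ⟨σ, hσ, hx⟩ := mem_realization_iff.1 x.val_mem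
    change barycenter (fun t => vertex (α t)) x.val s = _
    rw [barycenter_eq_sum _ hx, lp.coeFn_sum, Finset.sum_apply]
    simp only [lp.coeFn_smul, Pi.smul_apply, vertex_apply, smul_eq_mul, mul_ite, mul_one, mul_zero]
    have h1 : ∀ t', (s = α t') = (t' = t) := fun t' => propext (eq_comm.trans (hst t'))
    simp only [h1, Finset.sum_ite_eq']
    split_ifs with h
    · rfl
    · exact ((mem_cell_iff.1 hx).2.1 t h).symm

/-- Points of a realization are determined by all their coordinates but one. -/
theorem ext_of_forall_ne {x y : Hilb T} (hx : x ∈ realization K) (hy : y ∈ realization K) (e : T)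
    (h : ∀ t ≠ e, x t = y t) : x = y := by
  classical
  obtain ⟨σ, -, hσ⟩ := mem_realization_iff.1 hx
  obtain ⟨ρ, -, hρ⟩ := mem_realization_iff.1 hy
  have h1 := (mem_cell_iff.1 (cell_mono (Finset.subset_union_left.trans
    (Finset.subset_insert e (σ ∪ ρ))) hσ)).2.2
  have h2 := (mem_cell_iff.1 (cell_mono (Finset.subset_union_right.trans
    (Finset.subset_insert e (σ ∪ ρ))) hρ)).2.2
  rw [← Finset.add_sum_erase _ _ (Finset.mem_insert_self e (σ ∪ ρ))] at h1 h2
  have h3 : ∑ t ∈ (insert e (σ ∪ ρ)).erase e, x t = ∑ t ∈ (insert e (σ ∪ ρ)).erase e, y t :=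
    Finset.sum_congr rfl fun t ht => h t (Finset.ne_of_mem_erase ht)
  ext t
  by_cases ht : t = e
  · subst ht; linarith
  · exact h t ht

/-- A map into `J_m` given by the barycentric coordinates with respect to the vertices other than
the distinguished one. -/
theorem exists_map_complexJ {Y : Type*} [TopologicalSpace Y] (m : ℕ) (w : S → Y → ℝ)
    (hc : ∀ s, Continuous (w s)) (hlf : LocallyFinite fun s => Function.support (w s))
    (h0 : ∀ s y, 0 ≤ w s y) (h1 : ∀ y (σ : Finset S), ∑ s ∈ σ, w s y ≤ 1)
    (hm : ∀ y (σ : Finset S), (∀ s ∈ σ, w s y ≠ 0) → σ.card ≤ m) :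
    ∃ p : C(Y, WeakRealization (complexJ (none : Option S) m)),
      ∀ y s, (p y).val (some s) = w s y := by
  classical
  have hpf : ∀ y, {s | w s y ≠ 0}.Finite := fun y => hlf.point_finite y
  have hsum : ∀ y, ∑ᶠ s, w s y = ∑ s ∈ (hpf y).toFinset, w s y := fun y =>
    finsum_eq_sum_of_support_subset _ fun s hs => by simpa using hs
  let W : Option S → Y → ℝ := fun t => t.elim (fun y => 1 - ∑ᶠ s, w s y) w
  suffices h : ∃ p : C(Y, WeakRealization (complexJ (none : Option S) m)),
      ∀ y t, (p y).val t = W t y from h.imp fun p hp y s => hp y (some s)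
  refine exists_map_weakRealization W
    (fun t => ?_) (fun y => ?_) (fun t y => ?_) (fun y => ?_) fun y σ hσ => ?_
  · cases t with
    | none => exact continuous_const.sub (continuous_finsum hc hlf)
    | some s => exact hc s
  · obtain ⟨N, hN, hf⟩ := hlf y
    refine ⟨N, hN, ((hf.image some).insert none).subset fun t ht => ?_⟩
    cases t with
    | none => exact Or.inl rfl
    | some s => exact Or.inr ⟨s, ht, rfl⟩
  · cases t with
    | none => exact sub_nonneg.2 ((hsum y).trans_le (h1 y _))
    | some s => exact h0 s y
  · rw [finsum_eq_sum_of_support_subset (s := Finset.insertNone (hpf y).toFinset),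
      Finset.sum_insertNone]
    · simp only [W, Option.elim, hsum]; ring
    · intro t ht
      cases t with
      | none => simp
      | some s => simpa [W] using ht
  · refine ⟨?_, (Finset.card_le_card (t := Finset.insertNone (Finset.eraseNone σ))
      fun t ht => ?_).trans ?_⟩
    · by_contra hne
      rw [Finset.not_nonempty_iff_eq_empty] at hne
      have hw : ∀ t, W t y = 0 := fun t => by
        by_contra h
        have := (hσ t).2 h
        simp [hne] at this
      have h2 : 1 - ∑ᶠ s, w s y = 0 := hw none
      have h3 : ∀ s, w s y = 0 := fun s => hw (some s)
      simp [h3] at h2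
    · cases t with
      | none => simp
      | some s => simpa using ht
    · rw [Finset.card_insertNone]
      exact Nat.add_le_add_right (hm y _ fun s hs => (hσ _).1 (Finset.mem_eraseNone.1 hs)) 1

end TwoTopologies

end StrongZ

namespace StrongZ

/-! ### Spaces covered by a family of compact sets -/

section CompactCover

variable {T : Type u}

theorem exists_cover_of_compact_cover [Infinite T] {Z : Type*} [TopologicalSpace Z]
    {C : T → Set Z} (hC : ∀ t, IsCompact (C t)) (hcov : ⋃ t, C t = univ) {𝒰 : Set (Set Z)}
    (h𝒰 : 𝒰 ∈ Cov Z) : ∃ W : T → Set Z, (∀ t, W t ∈ insert ∅ 𝒰) ∧ ⋃ t, W t = univ := by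
  have hfin : ∀ t, ∃ W : ℕ → Set Z, (∀ n, W n ∈ insert ∅ 𝒰) ∧ C t ⊆ ⋃ n, W n := fun t => by
    obtain ⟨s, hs⟩ := (hC t).elim_finite_subcover (fun U : 𝒰 => U.1) (fun U => h𝒰.1 U U.2)
      (by rw [← sUnion_eq_iUnion, h𝒰.2]; exact subset_univ _)
    obtain ⟨W, hW⟩ := ((s.finite_toSet.image Subtype.val).insert ∅).countable.exists_eq_range
      (insert_nonempty ∅ _)
    refine ⟨W, fun n => ?_, fun z hz => ?_⟩
    · rcases hW.symm.subset ⟨n, rfl⟩ with h | ⟨U, -, h⟩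
      · exact Or.inl h
      · exact Or.inr (h ▸ U.2)
    · obtain ⟨U, hU, hzU⟩ := mem_iUnion₂.1 (hs hz)
      obtain ⟨n, hn⟩ := hW.subset (Or.inr ⟨U, hU, rfl⟩)
      exact mem_iUnion.2 ⟨n, hn ▸ hzU⟩
  choose W hW𝒰 hW using hfin
  obtain ⟨e⟩ : Nonempty (T ≃ T × ℕ) := by
    rw [← Cardinal.eq, Cardinal.mk_prod]
    simp [Cardinal.mul_aleph0_eq (Cardinal.aleph0_le_mk T)]
  refine ⟨fun t => W (e t).1 (e t).2, fun t => hW𝒰 _ _, eq_univ_of_forall fun z => ?_⟩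
  obtain ⟨t, ht⟩ := mem_iUnion.1 (hcov.symm ▸ mem_univ z)
  obtain ⟨n, hn⟩ := mem_iUnion.1 (hW t ht)
  exact mem_iUnion.2 ⟨e.symm (t, n), by simpa using hn⟩

theorem exists_face_complexJ {S : Type u} {α : Option S → Option T} (hα : α none = none)
    {m m' : ℕ} (hm : m ≤ m') : ∀ σ ∈ (complexJ (none : Option S) m).faces,
      ∃ ρ ∈ (complexJ (none : Option T) m').faces, ∀ t ∈ σ, α t ∈ ρ := by
  classical
  rintro σ ⟨hσ, hcard⟩
  refine ⟨σ.image α, ⟨hσ.image α, ?_⟩, fun t ht => Finset.mem_image_of_mem α ht⟩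
  refine (Finset.card_le_card (t := (Finset.cons none (σ.erase none) (by simp)).image α)
    fun t ht => ?_).trans (Finset.card_image_le.trans (le_trans (Finset.card_le_card fun t ht => ?_)
      (hcard.trans (Nat.add_le_add_right hm 1))))
  · rcases (@Finset.mem_insert _ (_) _ _ _).1 ht with rfl | ht
    · exact Finset.mem_image.2 ⟨none, by simp, hα⟩
    · obtain ⟨s, hs, rfl⟩ := Finset.mem_image.1 ht
      refine Finset.mem_image.2 ⟨s, ?_, rfl⟩
      by_cases h : s = none <;> simp [h, hs]
  · rw [Finset.mem_cons, Finset.mem_erase] at ht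
    exact (@Finset.mem_insert _ (_) _ _ _).2 (ht.imp id And.right)

/-- The homothety with centre the vertex `e`, which enlarges the points whose barycentric
coordinates off `e` have a small sum `1 - x e`, does not leave convex sets. -/
theorem smul_barycenter_mem {F : Type*} [NormedAddCommGroup F] [NormedSpace ℝ F]
    {K : PreAbstractSimplicialComplex T} {x : Hilb T} (hx : x ∈ realization K) (e : T)
    {s : Set F} (hs : Convex ℝ s) {v : T → F} (hv : ∀ t, v t ∈ s) :
    v e + (max (1 / 3) (1 - x e))⁻¹ • (barycenter v x - v e) ∈ s := by
  classical
  obtain ⟨σ, -, hσ⟩ := mem_realization_iff.1 hx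
  have hσ' := cell_mono (Finset.subset_insert e σ) hσ
  obtain ⟨h0, -, h1⟩ := mem_cell_iff.1 hσ'
  have he := Finset.mem_insert_self e σ
  set m := (max (1 / 3) (1 - x e))⁻¹ with hm
  have hmax : 0 < max (1 / 3) (1 - x e) := lt_max_of_lt_left (by norm_num)
  have hm0 : 0 ≤ m := (inv_pos.2 hmax).le
  have hm1 : m * (1 - x e) ≤ 1 := by
    rw [hm, inv_mul_le_one₀ hmax]
    exact le_max_right _ _
  have h2 := hs.sum_mem (t := insert e σ) (w := fun t => m * x t + if t = e then 1 - m else 0)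
    (z := v) (fun t _ => ?_) ?_ fun t _ => hv t
  · convert h2 using 1
    rw [barycenter_eq_sum v hσ']
    simp only [add_smul, mul_smul, ite_smul, zero_smul]
    rw [Finset.sum_add_distrib, Finset.sum_ite_eq' _ e, if_pos he, ← Finset.smul_sum]
    module
  · dsimp only
    split_ifs with h
    · subst h; linarith
    · rw [add_zero]; exact mul_nonneg hm0 (h0 t)
  · rw [Finset.sum_add_distrib, Finset.sum_ite_eq' _ e, if_pos he, ← Finset.mul_sum, h1]
    ring

variable {X : Type v} [MetricSpace X] {E : Type w} [NormedAddCommGroup E] [NormedSpace ℝ E]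
  {A : Set X}

/-- Locally at `a`, sequences of maps of the realizations of `J_1, J_2, …`, with vertex set `T`
and one more vertex, can be pushed off `A`. -/
def AvoidsJSequences (τ : Bool) (A : Set X) (a : X) (T : Type u) : Prop :=
  ∃ ρ > 0, ∀ g : ∀ n, C(TopRealization τ (complexJ (none : Option T) (n + 1)), X),
    (∀ n z, g n z ∈ Metric.closedBall a ρ) → FamCanAvoid A g

/-- The telescope for spaces covered by an infinite family of compact sets.  The `n`-th test space
is the realization of `J_m` for `m = 2 * n + 4`; the vertices of `K n` are those of `M n` and of
`M (n + 1)`, and one more whose coordinate is the parameter of the homotopy.  Each of the three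
gets one third of the mass. -/
theorem canAvoid_of_compact_cover (R : ConvexRetract X E) (hA : IsClosed A) (τ : Bool) [Infinite T]
    (H : ∀ a ∈ A, AvoidsJSequences τ A a T)
    (H' : ∀ a ∈ A, AvoidsJSequences τ A a (T ⊕ T ⊕ PUnit.{u + 1}))
    {Y : Type*} [TopologicalSpace Y] [MetrizableSpace Y] {C : T → Set Y}
    (hC : ∀ t, IsCompact (C t)) (hcov : ⋃ t, C t = univ) (f : C(Y, X)) : CanAvoid A f := by
  classical
  refine canAvoid_of_restrict_closedBall R hA (fun a ha => ?_) f
  obtain ⟨ρ₁, hρ₁, H⟩ := H a ha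
  obtain ⟨ρ₂, hρ₂, H'⟩ := H' a ha
  obtain ⟨R₀, hR₀, hR₀ρ, hR⟩ := R.exists_radius a (lt_min hρ₁ hρ₂)
  obtain ⟨R₁, hR₁, hR₁₀, hR'⟩ := R.exists_radius a (half_pos hR₀)
  refine ⟨R₁, hR₁, fun f => ?_⟩
  have haρ : a ∈ Metric.closedBall a (min ρ₁ ρ₂) :=
    Metric.mem_closedBall_self (lt_min hρ₁ hρ₂).le
  set Y' := f ⁻¹' Metric.closedBall a R₁ with hY'
  have hY'c : IsClosed Y' := Metric.isClosed_closedBall.preimage f.continuous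
  rcases isEmpty_or_nonempty Y' with hE | hE
  · exact canAvoid_of_isEmpty _
  let : MetricSpace Y' := metrizableSpaceMetric Y'
  let α₀ : Option (T ⊕ T ⊕ PUnit.{u + 1}) → Option T := fun t =>
    t.elim none (Sum.elim some fun _ => none)
  let α₁ : Option (T ⊕ T ⊕ PUnit.{u + 1}) → Option T := fun t =>
    t.elim none (Sum.elim (fun _ => none) (Sum.elim some fun _ => none))
  choose p₀ hp₀ using fun n : ℕ => TopRealization.exists_simplicialMap τ α₀
    (exists_face_complexJ (α := α₀) rfl (le_refl (2 * n + 3 + 1)))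
  choose p₁ hp₁ using fun n : ℕ => TopRealization.exists_simplicialMap τ α₁
    (exists_face_complexJ (α := α₁) rfl (show 2 * n + 3 + 1 ≤ 2 * (n + 1) + 3 + 1 by omega))
  have hp₀' : ∀ n x t, (p₀ n x).val (some t) = x.val (some (.inl t)) := fun n x t =>
    hp₀ n x _ _ fun t' => by
      rcases t' with _ | t' | t' | t' <;> simp [α₀]
  have hp₁' : ∀ n x t, (p₁ n x).val (some t) = x.val (some (.inr (.inl t))) := fun n x t =>
    hp₁ n x _ _ fun t' => by
      rcases t' with _ | t' | t' | t' <;> simp [α₁]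
  have hinj : Function.Injective fun n : ℕ => 2 * n + 3 := fun m n h => by
    dsimp only at h; omega
  refine canAvoid_of_telescope R hA
    (M := fun n => TopRealization τ (complexJ (none : Option T) (2 * n + 3 + 1)))
    (K := fun n => TopRealization τ
      (complexJ (none : Option (T ⊕ T ⊕ PUnit.{u + 1})) (2 * n + 3 + 1))) a hR₀ hR₀ρ hR
    (famCanAvoid_of_retracts (fun g hg => H g fun n z =>
      Metric.closedBall_subset_closedBall (min_le_left _ _) (hg n z)) hinj
      (fun n => ContinuousMap.id _) (fun n => ContinuousMap.id _) (fun _ _ => rfl) haρ)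
    (famCanAvoid_of_retracts (fun g hg => H' g fun n z =>
      Metric.closedBall_subset_closedBall (min_le_right _ _) (hg n z)) hinj
      (fun n => ContinuousMap.id _) (fun n => ContinuousMap.id _) (fun _ _ => rfl) haρ)
    p₀ p₁ (fun n => ⟨fun x => ⟨clamp (3 * x.val (some (.inr (.inr PUnit.unit)))), clamp_nonneg _,
      clamp_le_one _⟩, (continuous_clamp.comp (continuous_const.mul
        ((continuous_coord _).comp TopRealization.continuous_val))).subtype_mk _⟩)
    (f.restrict Y') fun ε hε => ?_
  obtain ⟨ε', hε', -, hRε⟩ := R.exists_control hε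
  obtain ⟨𝒰, h𝒰, hs⟩ := exists_cov_of_control hε'
  -- a cover by small sets, a partition of unity, and the number `N` of its functions at a point
  obtain ⟨W, hW𝒰, hWc⟩ := exists_cover_of_compact_cover (C := fun t => ((↑) ⁻¹' C t : Set Y'))
    (fun t => hY'c.isClosedEmbedding_subtypeVal.isCompact_preimage (hC t))
    (by rw [← preimage_iUnion, hcov, preimage_univ]) (cov_preimage (f.restrict Y').continuous h𝒰)
  have hWo : ∀ t, IsOpen (W t) := fun t => by
    rcases hW𝒰 t with h | ⟨U, hU, h⟩
    · rw [h]; exact isOpen_empty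
    · rw [← h]; exact (h𝒰.1 U hU).preimage (f.restrict Y').continuous
  have hW : ∀ t, ∀ y ∈ W t, ∀ y' ∈ W t,
      dist (f.restrict Y' y) (f.restrict Y' y') < ε' (f.restrict Y' y) := fun t y hy y' hy' => by
    rcases hW𝒰 t with h | ⟨U, hU, h⟩
    · exact (h.subset hy).elim
    · rw [← h] at hy hy'
      exact hs U hU _ hy _ hy'
  obtain ⟨χ, hχ⟩ := PartitionOfUnity.exists_isSubordinate isClosed_univ W hWo hWc.ge
  obtain ⟨v, hv, hvF⟩ := R.exists_vertices (f.restrict Y') hW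
  have hlf : LocallyFinite fun t => tsupport (χ t) := χ.locallyFinite.closure
  let N : Y' → ℕ := fun y => (hlf.point_finite y).toFinset.card
  obtain ⟨φ, hφ⟩ := exists_continuous_index (N := N) fun y => by
    filter_upwards [hlf.eventually_subset (fun n => isClosed_tsupport _) y] with y' hy'
    exact Finset.card_le_card (Set.Finite.toFinset_subset_toFinset.2 hy')
  let ξ : ℕ → C(Y', ℝ) := fun n => ⟨fun y => clamp (n + 2 - φ y), by fun_prop⟩
  let u : ℕ → T → Y' → ℝ := fun n t y => ξ n y * χ t y / 3
  have hu0 : ∀ n t y, 0 ≤ u n t y := fun n t y =>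
    div_nonneg (mul_nonneg (clamp_nonneg _) (χ.nonneg t y)) (by norm_num)
  have huc : ∀ n t, Continuous (u n t) := fun n t =>
    ((ξ n).continuous.mul (χ t).continuous).div_const 3
  have hχ1 : ∀ y (σ : Finset T), ∑ t ∈ σ, χ t y ≤ 1 := fun y σ => by
    rw [← χ.sum_eq_one (mem_univ y), finsum_eq_sum_of_support_subset
      (s := σ ∪ (χ.locallyFinite.point_finite y).toFinset) _ fun t ht =>
        Finset.mem_union_right _ ((χ.locallyFinite.point_finite y).mem_toFinset.2 ht)]
    · exact Finset.sum_le_sum_of_subset_of_nonneg Finset.subset_union_left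
        fun t _ _ => χ.nonneg t y
  have hu1 : ∀ n y (σ : Finset T), ∑ t ∈ σ, u n t y ≤ 1 / 3 := fun n y σ => by
    simp only [u]
    rw [← Finset.sum_div, ← Finset.mul_sum]
    have h1 := mul_le_one₀ (clamp_le_one (n + 2 - φ y))
      (Finset.sum_nonneg fun t (_ : t ∈ σ) => χ.nonneg t y) (hχ1 y σ)
    have h2 : ξ n y = clamp (n + 2 - φ y) := rfl
    rw [h2]
    linarith
  have hun : ∀ n t y, u n t y ≠ 0 → χ t y ≠ 0 ∧ φ y < n + 2 := fun n t y h => by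
    refine ⟨fun h0 => h (by simp only [u, h0]; ring), ?_⟩
    by_contra! hle
    refine h ?_
    have h2 : ξ n y = 0 := clamp_of_le (by linarith)
    simp only [u, h2]; ring
  have hum : ∀ n y (σ : Finset T), (∀ t ∈ σ, u n t y ≠ 0) → σ.card ≤ n + 1 := fun n y σ hσ => by
    rcases σ.eq_empty_or_nonempty with rfl | ⟨t, ht⟩
    · simp
    have h1 : (N y : ℝ) < n + 2 := (hφ y).trans_lt (hun n t y (hσ t ht)).2
    have h2 : N y < n + 2 := by exact_mod_cast h1
    have h3 : σ.card ≤ N y := Finset.card_le_card fun t ht =>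
      (hlf.point_finite y).mem_toFinset.2 (subset_tsupport _ (hun n t y (hσ t ht)).1)
    omega
  have hulf : ∀ n, LocallyFinite fun t => Function.support (u n t) := fun n =>
    χ.locallyFinite.subset fun t y hy => (hun n t y hy).1
  choose p hp using fun n => exists_map_complexJ (2 * n + 3 + 1) (u n) (huc n) (hulf n) (hu0 n)
    (fun y σ => (hu1 n y σ).trans (by norm_num)) fun y σ hσ =>
      (hum n y σ hσ).trans (by omega)
  let w : ℕ → T ⊕ T ⊕ PUnit.{u + 1} → Y' × unitInterval → ℝ := fun n s q =>
    Sum.elim (fun t => u n t q.1) (Sum.elim (fun t => u (n + 1) t q.1) fun _ => (q.2 : ℝ) / 3) s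
  have hsplit : ∀ σ : Finset (T ⊕ T ⊕ PUnit.{u + 1}),
      σ = σ.toLeft.disjSum (σ.toRight.toLeft.disjSum σ.toRight.toRight) := fun σ => by
    rw [Finset.toLeft_disjSum_toRight, Finset.toLeft_disjSum_toRight]
  have hunit : ∀ σ : Finset PUnit.{u + 1}, σ.card ≤ 1 := fun σ =>
    (Finset.card_le_univ σ).trans (by simp)
  choose P hP using fun n => exists_map_complexJ (2 * n + 3 + 1) (w n) (fun s => by
      rcases s with t | t | t
      · exact (huc n t).comp continuous_fst
      · exact (huc (n + 1) t).comp continuous_fst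
      · exact (continuous_subtype_val.comp continuous_snd).div_const 3)
    (fun q => by
      obtain ⟨V₀, hV₀, hf₀⟩ := hulf n q.1
      obtain ⟨V₁, hV₁, hf₁⟩ := hulf (n + 1) q.1
      refine ⟨Prod.fst ⁻¹' (V₀ ∩ V₁), continuous_fst.continuousAt.preimage_mem_nhds
        (inter_mem hV₀ hV₁), ((hf₀.image Sum.inl).union
          ((hf₁.image (Sum.inr ∘ Sum.inl)).union
            (finite_univ.image (Sum.inr ∘ Sum.inr)))).subset ?_⟩
      rintro (t | t | t) ⟨q', hq', hV⟩
      · exact Or.inl ⟨t, ⟨q'.1, hq', hV.1⟩, rfl⟩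
      · exact Or.inr (Or.inl ⟨t, ⟨q'.1, hq', hV.2⟩, rfl⟩)
      · exact Or.inr (Or.inr ⟨t, mem_univ _, rfl⟩))
    (fun s q => by
      rcases s with t | t | t
      · exact hu0 n t q.1
      · exact hu0 (n + 1) t q.1
      · exact div_nonneg q.2.2.1 (by norm_num))
    (fun q σ => by
      rw [hsplit σ, Finset.sum_disjSum, Finset.sum_disjSum]
      have h1 := hu1 n q.1 σ.toLeft
      have h2 := hu1 (n + 1) q.1 σ.toRight.toLeft
      have h3 : ∑ _t ∈ σ.toRight.toRight, (q.2 : ℝ) / 3 ≤ 1 / 3 := by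
        rw [Finset.sum_const, nsmul_eq_mul]
        have h4 : (σ.toRight.toRight.card : ℝ) ≤ 1 := by exact_mod_cast hunit _
        have h5 := q.2.2.2
        have h6 := q.2.2.1
        nlinarith
      simp only [w, Sum.elim_inl, Sum.elim_inr]
      linarith)
    (fun q σ hσ => by
      rw [hsplit σ, Finset.card_disjSum, Finset.card_disjSum]
      have h1 := hum n q.1 σ.toLeft fun t ht => hσ _ (Finset.mem_toLeft.1 ht)
      have h2 := hum (n + 1) q.1 σ.toRight.toLeft fun t ht =>
        hσ _ (Finset.mem_toRight.1 (Finset.mem_toLeft.1 ht))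
      have h3 := hunit σ.toRight.toRight
      omega)
  -- the maps `h n`, which undo the division of the coordinates by three
  let v' : Option T → E := fun t => t.elim (R.emb a) v
  have hvC : ∀ t, v' t ∈ R.C ∩ Metric.closedBall (R.emb a) R₁ := fun t => by
    cases t with
    | none => exact ⟨R.emb_mem_C _, Metric.mem_closedBall_self hR₁.le⟩
    | some t =>
      obtain ⟨_, ⟨y, rfl⟩, hy⟩ := hvF t
      change v t ∈ _
      rw [← hy]
      refine ⟨R.emb_mem_C _, ?_⟩
      rw [Metric.mem_closedBall, R.isometry_emb.dist_eq]
      exact y.2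
  have hbound : ∀ t, ‖v' t‖ ≤ R₁ + ‖R.emb a‖ := fun t => by
    have h1 := (hvC t).2
    rw [Metric.mem_closedBall, dist_eq_norm] at h1
    have h2 := norm_add_le (v' t - R.emb a) (R.emb a)
    rw [sub_add_cancel] at h2
    linarith
  let q : ∀ n, TopRealization τ (complexJ (none : Option T) (2 * n + 3 + 1)) → E := fun n x =>
    R.emb a + (max (1 / 3) (1 - x.val none))⁻¹ • (barycenter v' x.val - R.emb a)
  have hqC : ∀ n x, q n x ∈ R.C ∩ Metric.closedBall (R.emb a) R₁ := fun n x =>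
    smul_barycenter_mem x.val_mem none (R.convex_closedBall _ _) hvC
  have hqc : ∀ n, Continuous (q n) := fun n => by
    refine continuous_const.add (Continuous.smul (Continuous.inv₀ (continuous_const.max
      (continuous_const.sub ((continuous_coord _).comp TopRealization.continuous_val)))
        fun x => ?_) ((TopRealization.continuous_barycenter hbound).sub continuous_const))
    exact (lt_max_of_lt_left (by norm_num)).ne'
  refine ⟨φ, fun n => ⟨fun x => R.r (q n x), R.continuous_r_comp (hqc n) fun x =>
    (hR' _ (hqC n x).1 (hqC n x).2).1⟩, fun n => (TopRealization.ofWeak τ _).comp (p n),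
    fun n => (TopRealization.ofWeak τ _).comp (P n), fun y => (Nat.cast_nonneg _).trans (hφ y),
    fun n x => (hR' _ (hqC n x).1 (hqC n x).2).2, fun n y => ?_, fun n y => ?_, fun n y => ?_,
    fun n y hy => ?_⟩
  · refine TopRealization.val_injective (ext_of_forall_ne (TopRealization.val_mem _)
      (TopRealization.val_mem _) none fun t ht => ?_)
    obtain ⟨t, rfl⟩ := Option.ne_none_iff_exists'.1 ht
    rw [hp₀']
    exact (hP n y (.inl t)).trans (hp n y.1 t).symm
  · refine TopRealization.val_injective (ext_of_forall_ne (TopRealization.val_mem _)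
      (TopRealization.val_mem _) none fun t ht => ?_)
    obtain ⟨t, rfl⟩ := Option.ne_none_iff_exists'.1 ht
    rw [hp₁']
    exact (hP n y (.inr (.inl t))).trans (hp (n + 1) y.1 t).symm
  · refine Subtype.ext ?_
    change clamp (3 * (P n y).val (some (.inr (.inr PUnit.unit)))) = y.2
    rw [hP n y]
    change clamp (3 * ((y.2 : ℝ) / 3)) = y.2
    rw [mul_div_cancel₀ _ (by norm_num : (3 : ℝ) ≠ 0)]
    exact clamp_of_mem y.2.2.1 y.2.2.2
  · have hξ : ξ n y = 1 := clamp_of_ge (by linarith [(abs_le.1 hy).2])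
    have hx := (p n y).val_mem
    let σ : Finset T := (χ.locallyFinite.point_finite y).toFinset
    have hσ : ∀ t, t ∈ σ ↔ χ t y ≠ 0 := fun t => (χ.locallyFinite.point_finite y).mem_toFinset
    have hcoord : ∀ t, (p n y).val (some t) = χ t y / 3 := fun t => by
      rw [hp n y t]; simp only [u, hξ, one_mul]
    have hσ1 : ∑ t ∈ σ, χ t y = 1 := by
      rw [← χ.sum_eq_one (mem_univ y)]
      exact (finsum_eq_sum_of_support_subset _ fun t ht => (hσ t).2 ht).symm
    have hsupp : ∀ t, (p n y).val t ≠ 0 → t ∈ Finset.insertNone σ := fun t ht => by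
      cases t with
      | none => simp
      | some t =>
        refine Finset.some_mem_insertNone.2 ((hσ t).2 fun h0 => ht ?_)
        rw [hcoord, h0, zero_div]
    have hnone : (p n y).val none = 2 / 3 := by
      have h1 := finsum_coord hx
      rw [finsum_eq_sum_of_support_subset (s := Finset.insertNone σ) _ fun t ht => hsupp t ht,
        Finset.sum_insertNone] at h1
      simp only [hcoord] at h1
      rw [← Finset.sum_div, hσ1] at h1
      linarith
    have hbary : barycenter v' (p n y).val =
        (2 / 3 : ℝ) • R.emb a + (1 / 3 : ℝ) • ∑ t ∈ σ, χ t y • v t := by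
      rw [barycenter, finsum_eq_sum_of_support_subset (s := Finset.insertNone σ) _ fun t ht =>
        hsupp t (left_ne_zero_of_smul ht), Finset.sum_insertNone, hnone, Finset.smul_sum]
      congr 1
      refine Finset.sum_congr rfl fun t _ => ?_
      rw [hcoord, smul_smul, div_mul_eq_mul_div, one_mul]
      rfl
    have hq : q n (TopRealization.ofWeak τ _ (p n y)) = ∑ t ∈ σ, χ t y • v t := by
      simp only [q, TopRealization.val_ofWeak]
      rw [hnone, hbary, max_eq_left (by norm_num)]
      module
    have hmem : q n (TopRealization.ofWeak τ _ (p n y)) ∈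
        R.C ∩ Metric.ball (R.emb (f.restrict Y' y)) (ε' (f.restrict Y' y)) := by
      rw [hq]
      exact (R.convex_ball _ _).sum_mem (fun t _ => χ.nonneg t y) hσ1 fun t ht =>
        hv t y (hχ t (subset_tsupport _ ((hσ t).1 ht)))
    exact (hRε _ _ hmem.1 hmem.2).2

end CompactCover

end StrongZ

namespace StrongZ

/-! ### Realizations of `J_n` as test spaces -/

section JSequences

variable {X : Type u} [MetricSpace X] {E : Type w} [NormedAddCommGroup E] [NormedSpace ℝ E]
  {A : Set X}

theorem canAvoid_of_forall_close {Y : Type*} [TopologicalSpace Y] {f : C(Y, X)}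
    (h : ∀ δ : X → ℝ, IsControl δ → ∃ g : C(Y, X), (∀ y, dist (f y) (g y) < δ (f y)) ∧
      CanAvoid A g) : CanAvoid A f := fun δ hδ => by
  obtain ⟨g, hg, hgA⟩ := h _ (hδ.div (c := 4) (by norm_num))
  obtain ⟨g', hg', hA'⟩ := hgA _ (hδ.div (c := 4) (by norm_num))
  refine ⟨g', fun y => ?_, hA'⟩
  have h1 := hg y
  have h2 := hg' y
  have h3 := hδ.le_add (g y) (f y)
  have h4 := dist_triangle (f y) (g y) (g' y)
  rw [dist_comm (g y) (f y)] at h3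
  linarith [hδ.pos (f y)]

theorem mk_option_lt {S : Type u} {κ : Cardinal.{u}} (hκ : ℵ₀ ≤ κ) (hS : #S < κ) :
    #(Option S) < κ := by
  rw [Cardinal.mk_option]
  exact Cardinal.add_lt_of_lt hκ hS (Cardinal.one_lt_aleph0.trans_le hκ)

instance {T : Type u} (K : PreAbstractSimplicialComplex T) :
    MetrizableSpace (TopRealization false K) :=
  inferInstanceAs (MetrizableSpace (realization K))

theorem iUnion_cells {S : Type u} (K : PreAbstractSimplicialComplex S) :
    ∃ C : Finset S → Set (TopRealization false K), (∀ σ, IsCompact (C σ)) ∧ ⋃ σ, C σ = univ := by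
  classical
  refine ⟨fun σ => if σ ∈ K.faces then TopRealization.val ⁻¹' cell σ else ∅, fun σ => ?_,
    eq_univ_of_forall fun x => ?_⟩
  · dsimp only
    split_ifs with hσ
    · refine (Subtype.isCompact_iff (p := (· ∈ realization K))).2 ?_
      have h : Subtype.val '' (Subtype.val ⁻¹' cell σ : Set (realization K)) = cell σ := by
        rw [Subtype.image_preimage_coe]
        exact inter_eq_right.2 fun x hx => mem_realization_iff.2 ⟨σ, hσ, hx⟩
      exact h.symm ▸ isCompact_cell σ
    · exact isCompact_empty
  · obtain ⟨σ, hσ, hx⟩ := mem_realization_iff.1 x.val_mem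
    refine mem_iUnion.2 ⟨σ, ?_⟩
    rw [if_pos hσ]
    exact hx

/-- The inclusion of a small closed ball factors approximately through the nerve of a cover of the
ball with fewer than `compL X` members. The realization of the nerve is covered by its cells, which
are compact and equally few. -/
theorem isStrongZSet_of_avoidsJ_of_lt (R : ConvexRetract X E) (hA : IsClosed A) (τ : Bool)
    (hκ : ℵ₀ < compL X)
    (H : ∀ a ∈ A, ∀ S : Type u, #S < compL X → AvoidsJSequences τ A a S) : IsStrongZSet A := by
  refine isStrongZSet_of_inclusion R hA fun a _ => ?_
  obtain ⟨G, hG, hGκ⟩ := (compL_mem X).2 a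
  obtain ⟨ρ, hρ, hρG⟩ := Metric.nhds_basis_closedBall.mem_iff.1 hG
  refine ⟨ρ, hρ, canAvoid_of_forall_close fun δ hδ => ?_⟩
  set F := Metric.closedBall a ρ with hF
  have hFc : IsClosed F := Metric.isClosed_closedBall
  have : Nonempty F := ⟨⟨a, Metric.mem_closedBall_self hρ.le⟩⟩
  obtain ⟨ε, hε, -, hR⟩ := R.exists_control hδ
  obtain ⟨𝒰, h𝒰, hs⟩ := exists_cov_of_control hε
  obtain ⟨𝒱, h𝒱𝒰, h𝒱, hcard⟩ := exists_subcover_of_comp_le hGκ hFc hρG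
    (cov_preimage (inclusion F).continuous h𝒰)
  let W : 𝒱 → Set F := fun V => V.1
  have hW : ∀ V, ∀ y ∈ W V, ∀ y' ∈ W V,
      dist (inclusion F y) (inclusion F y') < ε (inclusion F y) := by
    rintro ⟨V, hV⟩ y hy y' hy'
    obtain ⟨U, hU, rfl⟩ := h𝒱𝒰 hV
    exact hs U hU _ hy _ hy'
  obtain ⟨p, hp⟩ := exists_nerve_map (W := W) (fun V => h𝒱.1 _ V.2)
    (by rw [← h𝒱.2, sUnion_eq_iUnion])
  obtain ⟨v, hv, hvF⟩ := R.exists_vertices (inclusion F) hW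
  have hbound : ∀ t, ‖v t‖ ≤ ρ + ‖R.emb a‖ := fun t => by
    obtain ⟨_, ⟨y, rfl⟩, hy⟩ := hvF t
    have h1 : dist (R.emb (inclusion F y)) (R.emb a) ≤ ρ := by
      rw [R.isometry_emb.dist_eq]; exact y.2
    rw [hy, dist_eq_norm] at h1
    have h2 := norm_add_le (v t - R.emb a) (R.emb a)
    rw [sub_add_cancel] at h2
    linarith
  let h : C(TopRealization false (nerve W), X) := ⟨fun x => R.r (barycenter v x.val),
    R.continuous_r_comp (TopRealization.continuous_barycenter hbound) fun x => by
      obtain ⟨y, hy⟩ := exists_forall_coord_mem x.val_mem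
      have h1 := R.barycenter_mem_ball hv x.val_mem hy
      exact (hR _ _ h1.1 h1.2).1⟩
  have hT : #(Finset 𝒱 × ULift.{u} ℕ) < compL X := by
    rw [Cardinal.mk_prod, Cardinal.lift_id, Cardinal.lift_id]
    exact Cardinal.mul_lt_of_lt hκ.le (mk_finset_lt hκ.le hcard) (by simpa using hκ)
  obtain ⟨C, hC, hCu⟩ := iUnion_cells (nerve W)
  have hav : CanAvoid A h := canAvoid_of_compact_cover R hA τ (T := Finset 𝒱 × ULift.{u} ℕ)
    (fun a ha => H a ha _ hT) (fun a ha => H a ha _ (by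
      rw [Cardinal.mk_sum, Cardinal.mk_sum]
      simp only [Cardinal.lift_id]
      exact Cardinal.add_lt_of_lt hκ.le hT (Cardinal.add_lt_of_lt hκ.le hT
        ((Cardinal.lt_aleph0_of_finite _).trans hκ))))
    (C := fun t => C t.1) (fun t => hC t.1) (eq_univ_of_forall fun x => by
      obtain ⟨σ, hσ⟩ := mem_iUnion.1 (hCu.symm ▸ mem_univ x)
      exact mem_iUnion.2 ⟨(σ, ⟨0⟩), hσ⟩) h
  refine ⟨h.comp ((TopRealization.ofWeak false _).comp p), fun y => ?_, hav.comp _⟩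
  have h1 := R.barycenter_mem_ball hv (p y).val_mem (hp y)
  rw [dist_comm]
  exact (hR _ _ h1.1 h1.2).2

/-- The cube `I^j` is a retract of the realization of `J_m` with `j` vertices besides the
distinguished one. -/
theorem exists_cube_retract_complexJ (τ : Bool) (j : ℕ) :
    ∃ (i : C(Cube j, TopRealization τ (complexJ (none : Option (ULift.{u} (Fin j))) (j + 1))))
      (p : C(TopRealization τ (complexJ (none : Option (ULift.{u} (Fin j))) (j + 1)), Cube j)),
      ∀ z, p (i z) = z := by
  have hj : (0 : ℝ) < j + 1 := by positivity
  obtain ⟨i, hi⟩ := exists_map_complexJ (S := ULift.{u} (Fin j)) (j + 1)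
    (fun s (y : Cube j) => (y s.down : ℝ) / (j + 1)) (fun s => by fun_prop)
    (locallyFinite_of_finite _) (fun s y => div_nonneg (y s.down).2.1 hj.le)
    (fun y σ => by
      rw [← Finset.sum_div, div_le_one hj]
      have h1 : ∑ s ∈ σ, (y s.down : ℝ) ≤ ∑ _s ∈ σ, (1 : ℝ) :=
        Finset.sum_le_sum fun s _ => (y s.down).2.2
      have h2 : (σ.card : ℝ) ≤ j := by
        exact_mod_cast (Finset.card_le_univ σ).trans (by simp)
      rw [Finset.sum_const, nsmul_one] at h1
      linarith)
    (fun y σ _ => (Finset.card_le_univ σ).trans (by simp))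
  refine ⟨(TopRealization.ofWeak τ _).comp i, ⟨fun x k =>
    ⟨clamp ((j + 1) * x.val (some ⟨k⟩)), clamp_nonneg _, clamp_le_one _⟩, continuous_pi fun k =>
      (continuous_clamp.comp (continuous_const.mul
        ((continuous_coord _).comp TopRealization.continuous_val))).subtype_mk _⟩,
    fun z => funext fun k => Subtype.ext ?_⟩
  change clamp ((j + 1) * (i z).val (some ⟨k⟩)) = z k
  rw [hi z ⟨k⟩, mul_div_cancel₀ _ hj.ne']
  exact clamp_of_mem (z k).2.1 (z k).2.2

theorem locallyAvoids_of_avoidsJ (τ : Bool)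
    (H : ∀ a ∈ A, ∀ S : Type u, #S < ℵ₀ → AvoidsJSequences τ A a S) (j : ℕ) :
    LocallyAvoids A ℵ₀ j := fun a ha => by
  obtain ⟨ρ, hρ, H⟩ := H a ha (ULift.{u} (Fin j)) (Cardinal.lt_aleph0_of_finite _)
  refine ⟨ρ, hρ, fun S hS g hg => ?_⟩
  have := Cardinal.lt_aleph0_iff_finite.1 hS
  refine famCanAvoid_of_locallyFinite (locallyFinite_of_finite _) fun s δ hδ => ?_
  obtain ⟨i, p, hip⟩ := exists_cube_retract_complexJ.{u} τ j
  obtain ⟨g', hg', hA'⟩ := famCanAvoid_of_retracts H (S' := Unit) (m := fun _ => j)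
    (fun _ _ _ => rfl) (fun _ => i) (fun _ => p) (fun _ => hip)
    (Metric.mem_closedBall_self hρ.le) (fun _ => g s) (fun _ => hg s) δ hδ
  exact ⟨g' (), hg' (), hA'.mono_right (closure_mono (subset_iUnion (fun i => range (g' i)) ()))⟩

theorem locallyFDT_of_compL_le (h : compL X ≤ ℵ₀) : LocallyFDT X := fun x => by
  obtain ⟨F, hF, hFκ⟩ := (compL_mem X).2 x
  refine ⟨F, hF, fun 𝒰 h𝒰 => ?_⟩
  obtain ⟨𝒱, h𝒱𝒰, h𝒱, hcard⟩ := (comp_mem F).2 𝒰 h𝒰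
  have hfin : 𝒱.Finite := Cardinal.lt_aleph0_iff_set_finite.1 (hcard.trans_le (hFκ.trans h))
  refine ⟨𝒱, h𝒱, fun V hV => ⟨V, h𝒱𝒰 hV, Subset.rfl⟩, 𝒱.ncard, fun y => ?_⟩
  rw [hfin.cast_ncard_eq]
  exact encard_le_encard fun V hV => hV.1

theorem isStrongZSet_of_avoidsJ (R : ConvexRetract X E) (hA : IsClosed A) (τ : Bool)
    (H : ∀ a ∈ A, ∀ S : Type u, #S < compL X → AvoidsJSequences τ A a S) : IsStrongZSet A := by
  rcases (compL_mem X).1.lt_or_eq with hκ | hκ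
  · exact isStrongZSet_of_avoidsJ_of_lt R hA τ hκ H
  · refine isStrongZSet_of_avoidsCubes R hA (locallyFDT_of_compL_le hκ.ge) fun n S hS g => ?_
    rw [← hκ] at hS H
    exact famCanAvoid_cube R hA Cardinal.isRegular_aleph0 (Or.inr (coveringDimLE_cube n))
      (fun j _ => locallyAvoids_of_avoidsJ τ H j) hS g

theorem isStrongZSet_of_smap_metricJSum (R : ConvexRetract X E) (hA : IsClosed A)
    (h : ∀ (T : Type u) (e : T), #T < compL X → SMAP (smallMaps (MetricJSum e) Aᶜ)) :
    IsStrongZSet A :=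
  isStrongZSet_of_avoidsJ R hA false fun a _ S hS =>
    (h (Option S) none (mk_option_lt (compL_mem X).1 hS)).exists_famCanAvoid_sigma a

theorem isStrongZSet_of_smap_weakJSum (R : ConvexRetract X E) (hA : IsClosed A)
    (h : ∀ (T : Type u) (e : T), #T < compL X → SMAP (smallMaps (WeakJSum e) Aᶜ)) :
    IsStrongZSet A :=
  isStrongZSet_of_avoidsJ R hA true fun a _ S hS =>
    (h (Option S) none (mk_option_lt (compL_mem X).1 hS)).exists_famCanAvoid_sigma a

/-! ### Discrete cells and locally finite approximation -/

theorem IsZSet.avoidsCubes {B : Set X} (hB : IsZSet B)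
    (h : ∀ m : ℕ, 1 ≤ m → ∀ (T : Type u) [TopologicalSpace T] [DiscreteTopology T],
      #T < compL X → DiscreteCells T m X) : AvoidsCubes B (compL X) := by
  have hpos : ∀ m : ℕ, 1 ≤ m → ∀ S : Type u, #S < compL X → ∀ g : S → C(Cube m, X),
      FamCanAvoid B g := fun m hm S hS g => famCanAvoid_of_forall_close fun δ hδ => by
    let : TopologicalSpace S := ⊥
    have : DiscreteTopology S := ⟨rfl⟩
    obtain ⟨f, hf, hfg⟩ := limitationDense_iff.1 (h m hm S hS) ⟨fun q => g q.2 q.1,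
      continuous_prod_of_discrete_right.2 fun s => (g s).continuous⟩ δ hδ
    exact ⟨fun s => f.comp ((ContinuousMap.id _).prodMk (ContinuousMap.const _ s)),
      fun s z => hfg (z, s), famCanAvoid_of_locallyFinite (DiscreteFamily.locallyFinite hf)
        fun s => hB.canAvoid_finite_cube _⟩
  intro n S hS g
  obtain ⟨i, p, hip⟩ := exists_cube_retract (Nat.le_succ n)
  rcases isEmpty_or_nonempty S with hE | ⟨⟨s⟩⟩
  · exact fun δ _ => ⟨g, fun s => hE.elim s, by simp⟩
  exact famCanAvoid_of_retracts (Z := fun _ : S => Cube (n + 1)) (B := univ)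
    (fun g _ => hpos (n + 1) (Nat.le_add_left _ _) S hS g) Function.injective_id (fun _ => i)
    (fun _ => p) (fun _ => hip) (mem_univ (g s fun _ => 0)) g fun _ _ => mem_univ _

/-- Composing the `n`-th map with the `n`-th of a locally finite sequence of maps close to the
identity makes a sequence of maps locally finite, so that its members can be treated one by one. -/
theorem IsZSet.isStrongZSet_of_omegaLFAP (R : ConvexRetract X E) (hX : OmegaLFAP X)
    (h : ∀ m : ℕ, 1 ≤ m → ∀ (T : Type u) [TopologicalSpace T] [DiscreteTopology T],
      #T < compL X → DiscreteCells T m X) {B : Set X} (hB : IsZSet B) : IsStrongZSet B := by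
  have hcubes := hB.avoidsCubes h
  refine isStrongZSet_of_avoidsJ R hB.1 true fun a _ S hS => ⟨1, one_pos, fun g _ =>
    famCanAvoid_of_forall_close fun δ hδ => ?_⟩
  obtain ⟨𝒰, h𝒰, hs⟩ := exists_cov_of_control hδ
  obtain ⟨f, hf, hlf⟩ := hX 𝒰 h𝒰
  refine ⟨fun n => (f n).comp (g n), fun n z => ?_, famCanAvoid_of_locallyFinite
    (hlf.subset fun n => range_comp_subset_range (g n) (f n)) fun n => ?_⟩
  · obtain ⟨U, hU, h1, h2⟩ := hf n (g n z)
    exact hs U hU _ h1 _ h2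
  · refine canAvoid_weakRealization R hB.1 (B := univ) (n + 2) (fun j _ P g _ => hcubes j P
      ((Cardinal.mk_set_le P).trans_lt (mk_finset_lt (compL_mem X).1
        (mk_option_lt (compL_mem X).1 hS))) g) _ (fun σ hσ => ?_) ((f n).comp (g n))
      (IsControl.const one_pos) fun _ _ _ => mem_univ _
    exact (Finset.card_le_card (@Finset.subset_insert _ (_) _ _)).trans hσ.2

end JSequences

end StrongZ

theorem mainTheorem4 {X : Type u} [TopologicalSpace X] (hX : StrongZ.IsANR X)
    (A : Set X) (hA : IsClosed A) :
    -- (Z1)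
    (LocallyCompactSpace X → ∀ B : Set X, StrongZ.IsZSet B → StrongZ.IsStrongZSet B) ∧
    -- (Z2)
    (StrongZ.LocallySeparable X →
      (StrongZ.IsStrongZSet A ↔ StrongZ.SMAP (StrongZ.smallMaps StrongZ.CubeSum Aᶜ)) ∧
      ∀ p : StrongZ.HilbertCube,
        (StrongZ.IsStrongZSet A ↔
          StrongZ.SMAP (StrongZ.smallMaps {q : StrongZ.HilbertCube // q ≠ p} Aᶜ))) ∧
    -- (Z3)
    (StrongZ.LocallyFDT X →
      (StrongZ.IsStrongZSet A ↔
        ∀ n : ℕ, 1 ≤ n → (n : WithBot ℕ∞) ≤ max 1 (StrongZ.coveringDim X) →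
          ∀ (T : Type u) [TopologicalSpace T] [DiscreteTopology T], #T < StrongZ.compL X →
            StrongZ.SMAP (StrongZ.smallMaps (StrongZ.Cube n × T) Aᶜ))) ∧
    -- (Z4), for the metric and for the weak topology
    (StrongZ.IsStrongZSet A ↔
      ∀ (T : Type u) (e : T), #T < StrongZ.compL X →
        StrongZ.SMAP (StrongZ.smallMaps (StrongZ.MetricJSum e) Aᶜ)) ∧
    (StrongZ.IsStrongZSet A ↔
      ∀ (T : Type u) (e : T), #T < StrongZ.compL X →
        StrongZ.SMAP (StrongZ.smallMaps (StrongZ.WeakJSum e) Aᶜ)) ∧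
    -- (Z5)
    (StrongZ.IsStrongZSet A → ∀ U : Set X, IsOpen U →
      StrongZ.IsStrongZSet ((↑) ⁻¹' A : Set U)) ∧
    -- (Z6)
    ((∀ a ∈ A, ∃ U : Set X, IsOpen U ∧ a ∈ U ∧ StrongZ.IsStrongZSet ((↑) ⁻¹' A : Set U)) →
      StrongZ.IsStrongZSet A) ∧
    -- (Z7)
    (StrongZ.LocallySeparable X → StrongZ.SDAP X →
      ∀ B : Set X, StrongZ.IsZSet B → StrongZ.IsStrongZSet B) ∧
    (StrongZ.OmegaLFAP X →
      (∀ m : ℕ, 1 ≤ m →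
        ∀ (T : Type u) [TopologicalSpace T] [DiscreteTopology T], #T < StrongZ.compL X →
          StrongZ.DiscreteCells T m X) →
      ∀ B : Set X, StrongZ.IsZSet B → StrongZ.IsStrongZSet B) := by
  classical
  have := hX.1
  let : MetricSpace X := metrizableSpaceMetric X
  rcases isEmpty_or_nonempty X with hE | hE
  · have hZ : ∀ B : Set X, StrongZ.IsStrongZSet B := StrongZ.isStrongZSet_of_isEmpty
    exact ⟨fun _ B _ => hZ B, fun _ => ⟨⟨fun h => h.smap, fun _ => hZ A⟩,
      fun p => ⟨fun h => h.smap, fun _ => hZ A⟩⟩,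
      fun _ => ⟨fun h _ _ _ _ _ _ _ => h.smap, fun _ => hZ A⟩,
      ⟨fun h _ _ _ => h.smap, fun _ => hZ A⟩, ⟨fun h _ _ _ => h.smap, fun _ => hZ A⟩,
      fun _ U _ => StrongZ.isStrongZSet_of_isEmpty _, fun _ => hZ A, fun _ _ B _ => hZ B,
      fun _ _ B _ => hZ B⟩
  obtain ⟨R⟩ := hX.exists_convexRetract
  refine ⟨fun _ B hB => hB.isStrongZSet R,
    fun hs => ⟨⟨fun h => h.smap, fun h => StrongZ.isStrongZSet_of_avoidsCubeSequences R hA hs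
      (StrongZ.avoidsCubeSequences_of_cubeSum h)⟩, fun p => ⟨fun h => h.smap, fun h =>
        StrongZ.isStrongZSet_of_avoidsCubeSequences R hA hs
          (StrongZ.avoidsCubeSequences_of_punctured R h)⟩⟩,
    fun hF => ⟨fun h _ _ _ _ _ _ _ => h.smap,
      fun h => StrongZ.isStrongZSet_of_smap_cube_prod R hA hF h⟩,
    ⟨fun h _ _ _ => h.smap, fun h => StrongZ.isStrongZSet_of_smap_metricJSum R hA h⟩,
    ⟨fun h _ _ _ => h.smap, fun h => StrongZ.isStrongZSet_of_smap_weakJSum R hA h⟩,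
    fun h U hU => h.preimage_val R hU, fun h => StrongZ.isStrongZSet_of_locally R hA h,
    fun hs hX B hB => StrongZ.isStrongZSet_of_avoidsCubeSequences R hB.1 hs
      (hB.avoidsCubeSequences hX),
    fun hL hD B hB => hB.isStrongZSet_of_omegaLFAP R hL hD⟩
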